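/- **Setting.** Let $d,N\ge 0$ be integers, $0<q<1$, and let $y_1>\dots>y_d$ and $x_1>\dots>x_{d+N}=-d-N$ be integers with $y_1-y_d\le N-1$; put $y_{d+i}=-d-i$ for $1\le i\le N$. A configuration is a family $x^{(k)}=(x^{(k)}_1,\dots,x^{(k)}_{d+k})\in\mathbb Z^{d+k}$, $0\le k\le N$, with $x^{(0)}_i=y_i$ $(i\le d)$, $x^{(N)}_i=x_i$ and $x^{(k)}_{i+1}<x^{(k-1)}_i\le x^{(k)}_i$ for $1\le k\le N$, $1\le i\le d+k-1$. Assume that at least one configuration exists. With $|\nu^{(k)}|=\sum_{i=1}^{d+k}(x^{(k)}_i+i)$, let $\mathbb P_q$ be the probability measure on configurations proportional to $(q^{-1})^{\sum_{i=1}^{N-1}|\nu^{(i)}|-(N-1)|\nu^{(0)}|}$. The $\mathbb K_q$-process is the point process of the dots $(k,x^{(k)}_i)\in\{0,\dots,N\}\times\mathbb Z$ under $\mathbb P_q$. *The kernel.* Let $h_r$ be the complete homogeneous symmetric polynomial ($h_r=0$ for $r<0$) and $H=(h_{x_i-y_j}(q^d,\dots,q^{d+N-1}))_{1\le i,j\le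 d+N}$. Put $\chi_i(z)=\mathbf 1_{z=y_i}$, $\varphi_k(x,z)=q^{(k-1)(z-x)}\mathbf 1_{x\le z}$ for $x\in\mathbb Z$, $\varphi_k(\mathrm{virt},z)=q^{(k-1)z}$ and $\psi_i(z)=\sum_j(H^{-1})_{ij}\mathbf 1_{z=x_j}$; let $f*g=\sum_{z\in\mathbb Z}f(z)g(z)$, with an empty convolution of $\varphi$'s being the identity; let $\psi^{(m+1)}_k=\varphi_{d+m+1}*\dots*\varphi_{d+N}*\psi_k$, and let $M_{k\ell}=\chi_k*\psi^{(1)}_\ell$ for $k\le d$, $M_{k\ell}=\varphi_k(\mathrm{virt},\cdot)*\psi_\ell^{(k+1-d)}$ for $d<k\le d+N$. Define, for $0\le m,n\le N$ and $x,y\in\mathbb Z$, $$\begin{aligned}\mathbb K_q(m,x;n,y)={}&-\mathbf 1_{n>m}(\varphi_{d+m+1}*\dots*\varphi_{d+n})(x,y)+\sum_{k=1}^{d+N}\sum_{\ell=1}^{d}\psi^{(m+1)}_k(x)(M^{-1})_{k\ell}(\chi_\ell*\varphi_{d+1}*\dots*\varphi_{d+n})(y)\\&+\sum_{k=1}^{d+N}\sum_{\ell=d+1}^{d+n}\psi_k^{(m+1)}(x)(M^{-1})_{k\ell}(\varphi_\ell(\mathrm{virt},\cdot)*\varphi_{\ell+1}*\dots*\varphi_{d+n})(y).\end{aligned}$$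 *Notation.* $(a;q)_k=\prod_{j=0}^{k-1}(1-aq^j)$; $\mathcal P_n(z)=\frac{(zq;q)_n}{(q;q)_n}$; $\tilde{\mathcal P}^{t}_n(z)=q^{-dt}\mathcal P_n(zq^{-t})$; $Q_q(z)=\prod_{i=1}^{d+N}(z-q_i)$ with $q_i=q^{x_i}$; $\Delta_k(u)=\prod_{i<j}(u_i-u_j)$; $\Phi_q(w)=\sum_{k=1}^n w^{k-1}\prod_{r=n+1}^N(1-q^{r-k})$. Let $c$ be the number of $x_i\ge y_d$. A contour is a closed piecewise smooth curve; it encloses (excludes) a point off the curve if its winding number about it is $1$ (is $0$). Contours: $\Gamma=\Gamma(q_1,\dots,q_c)$ encloses $q_1,\dots,q_c$, excludes the other $q_i$ and does not pass through $0$; $\Gamma_0$ encloses $0$ and excludes $q^{-(d+k-1)}$, $1\le k\le n$; $\Gamma_v=\Gamma(q^{x-y+\mathbb N})$ encloses $q^{x-y+j}$, $j=0,1,2,\dots$, and excludes the remaining zeros $q^{x_i-y}$ ($x_i<x$) of $v\mapsto Q_q(vq^y)$; $\Gamma_\infty$ is so large that it encloses $0$, all of $\Gamma_v$ and all of $q^{-y}\Gamma$,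 while $\Gamma$ excludes all of $q^y\Gamma_\infty$. In the case $m=N$, $\mathcal P_{-1}$ is read as $1$ and $\Gamma_v$ as a contour that encloses $q^{x-y}$ and excludes the other zeros of $v\mapsto Q_q(vq^y)$ (this is $h_r(\varnothing)=\mathbf 1_{r=0}$). Let $$\Omega_q(v,z)=\Big(\prod_{j=1}^d\oint_{\Gamma}\frac{du_j}{2\pi i\,Q_q(u_j)}\Big)\prod_{i=1}^d\frac{v-u_i}{z-u_i}\;\Delta_d(u_1,\dots,u_d)\,\det\big(\tilde{\mathcal P}^{y_\beta}_{N-1}(u_\alpha)\big)_{1\le\alpha,\beta\le d},$$ ($\Omega_q=1$ for $d=0$) and for $d\ge1$ $$\tilde\Omega_q(v,y)=\Big(\prod_{j=2}^d\oint_{\Gamma}\frac{du_j}{2\pi i\,Q_q(u_j)}\Big)\Delta_d(v,u_2,\dots,u_d)\,\tilde\Delta_{q,d,n}(y;u_2,\dots,u_d),$$ $$\tilde\Delta_{q,d,n}(y;u_2,\dots,u_d)=\oint_{\Gamma_0}\frac{dw}{2\pi i\,w^{y+1}\prod_{k=1}^n(1-wq^{d+k-1})}\det\begin{pmatrix}w^{y_1}&\cdots&w^{y_d}\\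 \tilde{\mathcal P}^{y_1}_{N-1}(u_2)&\cdots&\tilde{\mathcal P}^{y_d}_{N-1}(u_2)\\ \vdots&&\vdots\\ \tilde{\mathcal P}^{y_1}_{N-1}(u_d)&\cdots&\tilde{\mathcal P}^{y_d}_{N-1}(u_d)\end{pmatrix},$$ $$F_r(v)=\Big(\prod_{j=1}^{d-1}\oint_{\Gamma}\frac{du_j}{2\pi i\,Q_q(u_j)}\Big)\det\big(\tilde{\mathcal P}^{y_\beta}_{N-1}(u_\alpha)\big)_{1\le\alpha\le d-1,\;\beta\ne r}\,\Delta_d(v,u_1,\dots,u_{d-1}).$$ **Theorem.** The $\mathbb K_q$-process is determinantal with kernel $\mathbb K_q$: for distinct points $(m_i,a_i)$, $1\le i\le k$, in $\{0,\dots,N\}\times\mathbb Z$, the $\mathbb P_q$-probability that all of them are dots is $\det(\mathbb K_q(m_i,a_i;m_j,a_j))_{1\le i,j\le k}$. Moreover $\Omega_q(0,0)\ne0$ and, for $0\le m,n\le N$ and $x,y\in\mathbb Z$, $$\begin{aligned}&q^{(d+m)(x-y)}\,\mathbb K_q(m,x;n,y)=-\frac{(q^{y-x+1};q)_{n-m-1}}{(q;q)_{n-m-1}}\mathbf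 1_{n>m}\mathbf 1_{y\ge x}\\&+\oint_{\Gamma_v}\frac{v^m\,dv}{2\pi i}\oint_{\Gamma_\infty}\frac{\Phi_q(z^{-1})\,dz}{2\pi i\,z}\,\frac{\mathcal P_{N-m-1}(vq^{y-x})}{z-v}\,\frac{Q_q(zq^y)}{Q_q(vq^y)}\,\frac{\Omega_q(vq^y,zq^y)}{\Omega_q(0,0)}\\&+\frac{d}{q^{(d-1)y}}\oint_{\Gamma_v}\frac{v^m\,dv}{2\pi i}\,\frac{\mathcal P_{N-m-1}(vq^{y-x})}{Q_q(vq^y)}\,\frac{\tilde\Omega_q(vq^y,y)}{\Omega_q(0,0)}=:(\mathbb K_q^{(0)}+\mathbb K_q^{(1)}+\mathbb K_q^{(2)})(m,x;n,y)\end{aligned}$$ (the last term being $0$ for $d=0$). For $1\le n\le N$, $\Phi_q(w)=(q^{N-1};q^{-1})_{N-n}\;{}_2\phi_1(q^{-1},q^{n-1};q^{N-1}\,|\,q^{-1},w)$ (terminating series). For $d\ge1$, $$\tilde\Omega_q(v,y)=\sum_{1\le r\le d,\;y_r\le y}(-1)^{r-1}h_{y-y_r}(q^d,\dots,q^{d+n-1})\,F_r(v).$$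 Finally, $\mathbb K_q^{(2)}(m,x;n,y)=0$ when $y\le y_d-1$. -/

import Mathlib

open scoped BigOperators

noncomputable section

namespace Lozenge

/-! ### Contours -/

/-- A closed contour: a closed curve on `[0,1]`, differentiable off finitely many parameters, with
integrable derivative (in particular every closed piecewise `C¹` curve). -/
structure Contour where
  toFun : ℝ → ℂ
  continuousOn : ContinuousOn toFun (Set.Icc 0 1)
  closed : toFun 0 = toFun 1
  differentiable : ∃ S : Finset ℝ, ∀ t ∈ Set.Ioo (0 : ℝ) 1, t ∉ S → DifferentiableAt ℝ toFun t
  integrable : IntervalIntegrable (deriv toFun) MeasureTheory.volume 0 1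

/-- The set of points through which the contour passes. -/
def Contour.trace (γ : Contour) : Set ℂ := γ.toFun '' Set.Icc 0 1

/-- The normalized contour integral `∮_γ f(z) dz / (2πi)`. -/
def Contour.integral (γ : Contour) (f : ℂ → ℂ) : ℂ :=
  (2 * Real.pi * Complex.I)⁻¹ * ∫ t in (0 : ℝ)..1, f (γ.toFun t) * deriv γ.toFun t

/-- The contour avoids `p` and winds around it exactly once, counterclockwise. -/
def Contour.Encloses (γ : Contour) (p : ℂ) : Prop :=
  p ∉ γ.trace ∧ γ.integral (fun z => (z - p)⁻¹) = 1

/-- The contour avoids `p` and has winding number zero about it. -/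
def Contour.Excludes (γ : Contour) (p : ℂ) : Prop :=
  p ∉ γ.trace ∧ γ.integral (fun z => (z - p)⁻¹) = 0

/-- The iterated normalized integral of a function of `k` variables, all along `γ`. -/
def Contour.iterIntegral (γ : Contour) : (k : ℕ) → ((Fin k → ℂ) → ℂ) → ℂ
  | 0, f => f Fin.elim0
  | k + 1, f => γ.integral fun u => γ.iterIntegral k fun us => f (Fin.cons u us)

/-! ### Red dot configurations and the measure `P_q` -/

/-- Families `x^{(k)} ∈ ℤ^{d+k}`, `0 ≤ k ≤ N`; entries are indexed from `0`. -/
abbrev Config (d N : ℕ) : Type := (k : Fin (N + 1)) → Fin (d + (k : ℕ)) → ℤ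

/-- The interlacing families from the bottom row `y` to the top row `x`. -/
def configs {d N : ℕ} (y : Fin d → ℤ) (x : Fin (d + N) → ℤ) : Set (Config d N) :=
  {w | (∀ i : Fin d, w 0 ⟨i, by simp⟩ = y i) ∧
    (∀ i : Fin (d + N), w (Fin.last N) ⟨i, by simp⟩ = x i) ∧
    ∀ (k : Fin N) (i : Fin (d + (k : ℕ))),
      w k.succ ⟨i + 1, by have := i.2; simp only [Fin.val_succ]; omega⟩
          < w k.castSucc ⟨i, by have := i.2; simp only [Fin.val_castSucc]; omega⟩ ∧
        w k.castSucc ⟨i, by have := i.2; simp only [Fin.val_castSucc]; omega⟩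
          ≤ w k.succ ⟨i, by have := i.2; simp only [Fin.val_succ]; omega⟩}

/-- There are finitely many interlacing families, so the sums over them are genuine. -/
theorem configs_finite {d N : ℕ} (y : Fin d → ℤ) (x : Fin (d + N) → ℤ) :
    (configs y x).Finite := by
  obtain ⟨B, hB⟩ : ∃ B : ℤ, ∀ i, |x i| ≤ B :=
    ⟨∑ i, |x i|, fun i => Finset.single_le_sum (f := fun i => |x i|)
      (fun j _ => abs_nonneg _) (Finset.mem_univ i)⟩
  have hfin : (Set.pi Set.univ fun k : Fin (N + 1) =>
      Set.pi Set.univ fun _ : Fin (d + (k : ℕ)) => Set.Icc (-B) B).Finite :=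
    Set.Finite.pi fun k => Set.Finite.pi fun _ => Set.finite_Icc _ _
  refine hfin.subset ?_
  rintro w ⟨_, h2, h3⟩ k _
  induction k using Fin.reverseInduction with
  | last =>
    intro i _
    have := h2 ⟨i, by simp⟩
    rw [this]
    exact abs_le.1 (hB _)
  | cast k ih =>
    intro i _
    have := h3 k i
    have a := ih trivial ⟨i + 1, by
      have := i.2; simp only [Fin.val_succ, Fin.val_castSucc] at *; omega⟩ trivial
    have b := ih trivial ⟨i, by
      have := i.2; simp only [Fin.val_succ, Fin.val_castSucc] at *; omega⟩ trivial
    exact ⟨a.1.trans this.1.le, this.2.trans b.2⟩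

/-- `|ν^{(k)}|`, where `ν_i^{(k)} = x_i^{(k)} + i` for `1 ≤ i ≤ d + k` (further parts vanish). -/
def nuSize {d N : ℕ} (w : Config d N) (k : Fin (N + 1)) : ℤ :=
  ∑ i : Fin (d + (k : ℕ)), (w k i + ((i : ℕ) + 1))

/-- The unnormalized weight `(q⁻¹)^{∑_{i=1}^{N-1} |ν^{(i)}| - (N-1)|ν^{(0)}|}`. -/
def weight {d N : ℕ} (q : ℝ) (w : Config d N) : ℝ :=
  q⁻¹ ^ ((∑ k : Fin (N + 1), if 0 < (k : ℕ) ∧ (k : ℕ) < N then nuSize w k else 0)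
    - ((N : ℤ) - 1) * nuSize w 0)

/-- The skew Schur polynomial `s_{λ∖μ}(q^{1-N}, …, q^0)`, as the sum over the interlacing
sequences `μ = ν^{(0)} ⊂ … ⊂ ν^{(N)} = λ`. -/
def partitionFunction {d N : ℕ} (y : Fin d → ℤ) (x : Fin (d + N) → ℤ) (q : ℝ) : ℝ :=
  ∑ᶠ w ∈ configs y x, weight q w

open Classical in
/-- The probability `P_q` of a single family. -/
def Pq {d N : ℕ} (y : Fin d → ℤ) (x : Fin (d + N) → ℤ) (q : ℝ) (w : Config d N) : ℝ :=
  if w ∈ configs y x then weight q w / partitionFunction y x q else 0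

/-- There is a red dot at `(k, z)`: at position `z` on level `k`. -/
def HasDot {d N : ℕ} (w : Config d N) (p : ℕ × ℤ) : Prop :=
  ∃ (hk : p.1 < N + 1) (i : Fin (d + p.1)), w ⟨p.1, hk⟩ i = p.2

/-- The process of red dots under `P_q` is determinantal with correlation kernel `K`. -/
def IsCorrelationKernel {d N : ℕ} (y : Fin d → ℤ) (x : Fin (d + N) → ℤ) (q : ℝ)
    (K : ℕ → ℤ → ℕ → ℤ → ℝ) : Prop :=
  ∀ (r : ℕ) (p : Fin r → ℕ × ℤ), Function.Injective p → (∀ i, (p i).1 ≤ N) →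
    ∑ᶠ w ∈ {w : Config d N | ∀ i, HasDot w (p i)}, Pq y x q w
      = (Matrix.of fun i j => K (p i).1 (p i).2 (p j).1 (p j).2).det

/-! ### The kernel `K_q` -/

/-- The complete homogeneous symmetric polynomial `h_r(q^a, q^{a+1}, …, q^{a+l-1})`, zero for
`r < 0`. -/
def hq (q : ℝ) (a l : ℕ) (r : ℤ) : ℝ :=
  if 0 ≤ r then
    MvPolynomial.aeval (fun i : Fin l => q ^ (a + (i : ℕ))) (MvPolynomial.hsymm (Fin l) ℝ r.toNat)
  else 0

/-- The points `y_1 > … > y_d` completed by `y_{d+i} = -d-i`, `1 ≤ i ≤ N`. -/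
def yFull {d : ℕ} (N : ℕ) (y : Fin d → ℤ) : Fin (d + N) → ℤ :=
  Fin.append y fun i : Fin N => -(d : ℤ) - ((i : ℕ) + 1)

/-- `H = (h_{x_i - y_j}(q^d, …, q^{d+N-1}))`. -/
def Hmat {d N : ℕ} (y : Fin d → ℤ) (x : Fin (d + N) → ℤ) (q : ℝ) :
    Matrix (Fin (d + N)) (Fin (d + N)) ℝ :=
  Matrix.of fun i j => hq q d N (x i - yFull N y j)

/-- `φ_k(x, z)`; the first argument `none` is the virtual point. -/
def phi (q : ℝ) (k : ℕ) : Option ℤ → ℤ → ℝ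
  | none, z => q ^ (((k : ℤ) - 1) * z)
  | some x, z => if x ≤ z then q ^ (((k : ℤ) - 1) * (z - x)) else 0

/-- The convolution `φ_a ∗ ⋯ ∗ φ_{a+l-1}` on `ℤ × ℤ`, the identity for `l = 0`. -/
def phiConv (q : ℝ) (a : ℕ) : ℕ → ℤ → ℤ → ℝ
  | 0, x, y => if x = y then 1 else 0
  | l + 1, x, y => ∑' z : ℤ, phiConv q a l x z * phi q (a + l) (some z) y

/-- `ψ_k(z) = ∑_j (H⁻¹)_{kj} 1_{z = x_j}`. -/
def psi {d N : ℕ} (y : Fin d → ℤ) (x : Fin (d + N) → ℤ) (q : ℝ) (k : Fin (d + N)) (z : ℤ) : ℝ :=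
  ∑ j, (Hmat y x q)⁻¹ k j * if z = x j then 1 else 0

/-- `ψ_k^{(m+1)} = φ_{d+m+1} ∗ ⋯ ∗ φ_{d+N} ∗ ψ_k`, for `0 ≤ m ≤ N`. -/
def psiLevel {d N : ℕ} (y : Fin d → ℤ) (x : Fin (d + N) → ℤ) (q : ℝ) (m : ℕ) (k : Fin (d + N))
    (s : ℤ) : ℝ :=
  ∑' z : ℤ, phiConv q (d + m + 1) (N - m) s z * psi y x q k z

/-- `χ_i(z) = 1_{z = y_i}`. -/
def chi {d N : ℕ} (y : Fin d → ℤ) (i : Fin (d + N)) (z : ℤ) : ℝ :=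
  if z = yFull N y i then 1 else 0

/-- The matrix `M`; with rows counted from `1`, row `k ≤ d` is `χ_k ∗ ψ^{(1)}` and row `k > d` is
`φ_k(virt, ·) ∗ ψ^{(k+1-d)}`. -/
def Mmat {d N : ℕ} (y : Fin d → ℤ) (x : Fin (d + N) → ℤ) (q : ℝ) :
    Matrix (Fin (d + N)) (Fin (d + N)) ℝ :=
  Matrix.of fun i j =>
    if (i : ℕ) < d then ∑' z : ℤ, chi y i z * psiLevel y x q 0 j z
    else ∑' z : ℤ, phi q (i + 1) none z * psiLevel y x q (i + 1 - d) j z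

/-- With `ℓ` counted from `1`: `χ_ℓ ∗ φ_{d+1} ∗ ⋯ ∗ φ_{d+n}` for `ℓ ≤ d`,
`φ_ℓ(virt, ·) ∗ φ_{ℓ+1} ∗ ⋯ ∗ φ_{d+n}` for `d < ℓ ≤ d+n`, and `0` for `ℓ > d+n`. -/
def entrance {d N : ℕ} (y : Fin d → ℤ) (q : ℝ) (n : ℕ) (l : Fin (d + N)) (t : ℤ) : ℝ :=
  if (l : ℕ) < d then ∑' z : ℤ, chi y l z * phiConv q (d + 1) n z t
  else if (l : ℕ) < d + n then
    ∑' z : ℤ, phi q (l + 1) none z * phiConv q (l + 2) (d + n - (l + 1)) z t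
  else 0

/-- The kernel `K_q(m, s; n, t)` of the red dot process. -/
def Kq {d N : ℕ} (y : Fin d → ℤ) (x : Fin (d + N) → ℤ) (q : ℝ) (m : ℕ) (s : ℤ) (n : ℕ) (t : ℤ) :
    ℝ :=
  -(if m < n then phiConv q (d + m + 1) (n - m) s t else 0)
    + ∑ k, ∑ l, psiLevel y x q m k s * (Mmat y x q)⁻¹ k l * entrance y q n l t

/-! ### The ingredients of the integral representation -/

/-- The `q`-Pochhammer symbol `(a; q)_k`. -/
def qPoch (a q : ℂ) (k : ℕ) : ℂ := ∏ j ∈ Finset.range k, (1 - a * q ^ j)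

/-- The basic hypergeometric series `₂φ₁(a, b; c | p, w)`. -/
def phi21 (a b c p w : ℂ) : ℂ :=
  ∑' k : ℕ, qPoch a p k * qPoch b p k / (qPoch p p k * qPoch c p k) * w ^ k

/-- `𝒫_n(z) = (zq; q)_n / (q; q)_n`. -/
def calP (q : ℂ) (n : ℕ) (z : ℂ) : ℂ := qPoch (z * q) q n / qPoch q q n

/-- `𝒫̃_n^t(z) = q^{-dt} 𝒫_n(z q^{-t})`. -/
def calPt (d : ℕ) (q : ℂ) (n : ℕ) (t : ℤ) (z : ℂ) : ℂ :=
  q ^ (-((d : ℤ) * t)) * calP q n (z * q ^ (-t))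

/-- `Q_q(z) = ∏ (z - q^{x_i})`. -/
def Qq {M : ℕ} (x : Fin M → ℤ) (q z : ℂ) : ℂ := ∏ i, (z - q ^ x i)

/-- `Φ_q(w) = ∑_{k=1}^n w^{k-1} ∏_{r=n+1}^N (1 - q^{r-k})`. -/
def PhiQ (N n : ℕ) (q w : ℂ) : ℂ :=
  ∑ k ∈ Finset.Icc 1 n, w ^ (k - 1) * ∏ r ∈ Finset.Icc (n + 1) N, (1 - q ^ (r - k))

/-- The Vandermonde determinant `Δ_k(u) = ∏_{i<j} (u_i - u_j)`. -/
def vdm {k : ℕ} (u : Fin k → ℂ) : ℂ := ∏ i, ∏ j ∈ Finset.Ioi i, (u i - u j)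

/-- `Δ_{q,d}^{(y_cut)}(u_1, …, u_d)`. -/
def deltaCut {d : ℕ} (N : ℕ) (y : Fin d → ℤ) (q : ℂ) (u : Fin d → ℂ) : ℂ :=
  (Matrix.of fun α β : Fin d => calPt d q (N - 1) (y β) (u α)).det

/-- `Δ̃_{q,d}^{(y_cut)}(w; u_2, …, u_d)`: the first row is `(w^{y_1}, …, w^{y_d})`. -/
def deltaTildeW {d : ℕ} (N : ℕ) (y : Fin d → ℤ) (q w : ℂ) (u : Fin (d - 1) → ℂ) : ℂ :=
  (Matrix.of fun α β : Fin d =>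
    if h : (α : ℕ) = 0 then w ^ y β
    else calPt d q (N - 1) (y β) (u ⟨α - 1, by have := α.2; omega⟩)).det

/-- `Δ̃_{q,d,n}^{(y_cut)}(t; u_2, …, u_d)`, an integral along a contour `Γ₀` about the origin. -/
def deltaTilde {d : ℕ} (N : ℕ) (y : Fin d → ℤ) (q : ℂ) (Γ₀ : Contour) (n : ℕ) (t : ℤ)
    (u : Fin (d - 1) → ℂ) : ℂ :=
  Γ₀.integral fun w =>
    deltaTildeW N y q w u / (w ^ (t + 1) * ∏ k ∈ Finset.range n, (1 - w * q ^ (d + k)))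

/-- `Ω_q(v, z)`. -/
def OmegaQ {d N : ℕ} (y : Fin d → ℤ) (x : Fin (d + N) → ℤ) (q : ℂ) (Γ : Contour) (v z : ℂ) : ℂ :=
  Γ.iterIntegral d fun u =>
    (∏ j, (Qq x q (u j))⁻¹) * (∏ j, (v - u j) / (z - u j)) * vdm u * deltaCut N y q u

/-- `Ω̃_q(v, t)`, which depends on `n` as well. -/
def OmegaTilde {d N : ℕ} (y : Fin d → ℤ) (x : Fin (d + N) → ℤ) (q : ℂ) (Γ Γ₀ : Contour) (n : ℕ)
    (v : ℂ) (t : ℤ) : ℂ :=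
  Γ.iterIntegral (d - 1) fun u =>
    (∏ j, (Qq x q (u j))⁻¹) * vdm (Fin.cons v u : Fin (d - 1 + 1) → ℂ)
      * deltaTilde N y q Γ₀ n t u

/-- `F_r(v)`; the column of `y_r` is removed from the determinant. -/
def Fr {d N : ℕ} (y : Fin d → ℤ) (x : Fin (d + N) → ℤ) (q : ℂ) (Γ : Contour) (r : Fin d) (v : ℂ) :
    ℂ :=
  Γ.iterIntegral (d - 1) fun u =>
    (∏ j, (Qq x q (u j))⁻¹)
      * (Matrix.of fun α β : Fin (d - 1) =>
          calPt d q (N - 1)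
            (y ⟨if (β : ℕ) < (r : ℕ) then (β : ℕ) else (β : ℕ) + 1, by
              have := β.2; split <;> omega⟩) (u α)).det
      * vdm (Fin.cons v u : Fin (d - 1 + 1) → ℂ)

/-- `K_q^{(0)}(m, s; n, t)`. -/
def K0 (q : ℂ) (m : ℕ) (s : ℤ) (n : ℕ) (t : ℤ) : ℂ :=
  -(if m < n ∧ s ≤ t then
      qPoch (q ^ (t - s) * q) q (n - m - 1) / qPoch q q (n - m - 1) else 0)

/-- `K_q^{(1)}(m, s; n, t)`. For `m = N` the truncated subtraction gives `𝒫_0 = 1`. -/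
def K1 {d N : ℕ} (y : Fin d → ℤ) (x : Fin (d + N) → ℤ) (q : ℂ) (Γ Γv Γinf : Contour)
    (m : ℕ) (s : ℤ) (n : ℕ) (t : ℤ) : ℂ :=
  Γv.integral fun v => v ^ m * Γinf.integral fun z =>
    PhiQ N n q z⁻¹ / z * (calP q (N - m - 1) (v * q ^ (t - s)) / (z - v))
      * (Qq x q (z * q ^ t) / Qq x q (v * q ^ t))
      * (OmegaQ y x q Γ (v * q ^ t) (z * q ^ t) / OmegaQ y x q Γ 0 0)

/-- `K_q^{(2)}(m, s; n, t)`. For `m = N` the truncated subtraction gives `𝒫_0 = 1`. -/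
def K2 {d N : ℕ} (y : Fin d → ℤ) (x : Fin (d + N) → ℤ) (q : ℂ) (Γ Γ₀ Γv : Contour)
    (m : ℕ) (s : ℤ) (n : ℕ) (t : ℤ) : ℂ :=
  d / q ^ (((d : ℤ) - 1) * t) * Γv.integral fun v =>
    v ^ m * (calP q (N - m - 1) (v * q ^ (t - s)) / Qq x q (v * q ^ t))
      * (OmegaTilde y x q Γ Γ₀ n (v * q ^ t) t / OmegaQ y x q Γ 0 0)

/-! ### The contours of the integral representation -/

/-- `Γ(q_1, …, q_c)`, where `q_i = q^{x_i}` and `x_1, …, x_c` are the `x_i ≥ y_d = min y`. The origin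
may lie inside or outside, but not on the contour. -/
def IsGammaU {d N : ℕ} (y : Fin d → ℤ) (x : Fin (d + N) → ℤ) (q : ℂ) (Γ : Contour) : Prop :=
  (0 : ℂ) ∉ Γ.trace ∧
  ∀ i, ((∃ j, y j ≤ x i) → Γ.Encloses (q ^ x i)) ∧ ((∀ j, x i < y j) → Γ.Excludes (q ^ x i))

/-- `Γ₀`: encloses `0` and none of the points `q^{-(d+k-1)}`, `1 ≤ k ≤ n`. -/
def IsGammaZero (d n : ℕ) (q : ℂ) (Γ₀ : Contour) : Prop :=
  Γ₀.Encloses 0 ∧ ∀ k < n, Γ₀.Excludes (q ^ (d + k))⁻¹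

/-- `Γ(q^{s-t+ℕ})` for `m < N`: encloses these points and none of the other zeros of `Q_q(v q^t)`.
For `m = N`: encloses `q^{s-t}` and none of the other zeros of `Q_q(v q^t)`. -/
def IsGammaV {d N : ℕ} (x : Fin (d + N) → ℤ) (q : ℂ) (m : ℕ) (s t : ℤ) (Γv : Contour) : Prop :=
  if m < N then
    (∀ j : ℕ, Γv.Encloses (q ^ (s - t + j))) ∧ ∀ i, x i < s → Γv.Excludes (q ^ (x i - t))
  else
    Γv.Encloses (q ^ (s - t)) ∧ ∀ i, x i ≠ s → Γv.Excludes (q ^ (x i - t))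

/-- `Γ_∞`: encloses all the poles `0`, `v`, `u_j q^{-t}` of the `z`-integrand, where `v` and `u_j`
run through their contours, and `z q^t` stays outside the contour of the `u_j`. -/
def IsGammaInf (q : ℂ) (t : ℤ) (Γ Γv Γinf : Contour) : Prop :=
  Γinf.Encloses 0 ∧ (∀ v ∈ Γv.trace, Γinf.Encloses v) ∧
  (∀ u ∈ Γ.trace, Γinf.Encloses (u * q ^ (-t))) ∧
  ∀ z ∈ Γinf.trace, Γ.Excludes (z * q ^ t)

end Lozenge

end

open scoped BigOperators

noncomputable section

namespace Lozenge

/-! ### Complete homogeneous symmetric polynomials of geometric progressions -/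

/-! Let `A` be `topMat`, the matrix of the level `N` entrance functions at the points of the top
row.

The determinantal part rests on one recurrence: an entrance function at level `n+1` equals the one
at level `n` plus `q^(d+n)` times its own value one step to the left (`entrance_succ`). Column
operations then expand `det A` over the interlacing rows below the top row (`det_eq_sum_below`), and
iteration gives a sum over configurations whose weight is a constant multiple of `weight`
(`det_eq_finsum_chainWeight`, `exists_chainWeight_one_eq`). A factor `1 + T` at each of finitely
many points changes the entrance functions by multiples of the propagators started at these points,
so `A` receives a perturbation of finite rank, and its determinant becomes `det A * det (1 + T K)`
(`finsum_chainWeight_mul_prod`). The top coefficient in `T` is the correlation function. The matrix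
`H` cancels from the kernel because `M = A * (H⁻¹)ᵀ` (`Mmat_eq`, `Kq_eq`); only its invertibility
matters.

The integral representation is an explicit inversion of `A`. By `hq_eq_qRatio`, `h_r` is a geometric
factor times a polynomial in `q^r` that vanishes for `-N < r < 0`. Since `y_1 - y_d ≤ N - 1`, the
first `d` rows of `A` are therefore, up to factors depending on the column, the polynomials `𝒫̃` cut
off to the nodes with `x_j ≥ y_d`; the other rows are powers of `q^{x_j}`. A column of the inverse
thus amounts to a function on the nodes with prescribed sums against `𝒫̃` with the residue weights
inside `Γ`, and against monomials with all residue weights (`sum_topMat_mul`). The functions `rSum`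
are dual to the monomials and orthogonal to `𝒫̃`; the signed `F_r` are dual to `𝒫̃` and orthogonal
to the monomials. These relations follow from determinants with two equal columns and from the
coefficient formula of Lagrange interpolation. The common normalization is `Ω_q(0,0)`, which is
nonzero because `A` is invertible (`omegaSum_ne_zero`).

All contour integrals are evaluated by partial fractions and winding numbers. The integral over
`Γ_v` is a sum over the top row weighted by `h_{x_j - s}`, the one over `Γ_∞` collects the poles `0`
and `v` and yields `rSum`, and the one over `Γ₀` reads off coefficients of a generating function. -/

theorem hsymm_option_succ {σ : Type*} [Fintype σ] [DecidableEq σ] (f : Option σ → ℝ) (n : ℕ) :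
    MvPolynomial.aeval f (MvPolynomial.hsymm (Option σ) ℝ (n + 1))
      = f none * MvPolynomial.aeval f (MvPolynomial.hsymm (Option σ) ℝ n)
        + MvPolynomial.aeval (f ∘ some) (MvPolynomial.hsymm σ ℝ (n + 1)) := by
  have h : ∀ {τ : Type _} [Fintype τ] [DecidableEq τ] (g : τ → ℝ) (k : ℕ),
      MvPolynomial.aeval g (MvPolynomial.hsymm τ ℝ k) = ∑ s : Sym τ k, (s.1.map g).prod := by
    intro τ _ _ g k
    simp [MvPolynomial.hsymm, map_sum, map_multiset_prod, Multiset.map_map]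
  -- A multiset of size `n + 1` either contains `none`, and one copy can be removed, or lives on
  -- `σ`.
  rw [h f (n + 1), h f n, h (f ∘ some) (n + 1),
    ← (Equiv.sum_comp (symOptionSuccEquiv.symm : Sym (Option σ) n ⊕ Sym σ n.succ ≃ _) _),
    Fintype.sum_sum_type, Finset.mul_sum]
  congr 1
  · refine Finset.sum_congr rfl fun s _ => ?_
    change ((SymOptionSuccEquiv.decode (Sum.inl s)).1.map f).prod = _
    rw [SymOptionSuccEquiv.decode_inl, ← Multiset.prod_cons, ← Multiset.map_cons]
    rfl
  · refine Finset.sum_congr rfl fun s _ => ?_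
    change ((SymOptionSuccEquiv.decode (Sum.inr s)).1.map f).prod = _
    simp [SymOptionSuccEquiv.decode]

theorem hq_of_neg (q : ℝ) (a l : ℕ) {r : ℤ} (hr : r < 0) : hq q a l r = 0 := by
  simp [hq, not_le.2 hr]

theorem hq_zero_right (q : ℝ) (a l : ℕ) : hq q a l 0 = 1 := by simp [hq]

theorem hq_no_vars (q : ℝ) (a : ℕ) (r : ℤ) : hq q a 0 r = if r = 0 then 1 else 0 := by
  rcases lt_trichotomy r 0 with h | h | h
  · rw [hq_of_neg _ _ _ h, if_neg h.ne]
  · subst h; simp [hq]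
  · obtain ⟨n, rfl⟩ : ∃ n : ℕ, r = n + 1 := ⟨(r - 1).toNat, by omega⟩
    rw [if_neg h.ne', hq, if_pos h.le]
    have : ((n : ℤ) + 1).toNat = n + 1 := by omega
    rw [this]
    simp [MvPolynomial.hsymm]

theorem hq_succ (q : ℝ) (a l : ℕ) (r : ℤ) :
    hq q a (l + 1) r = hq q a l r + q ^ (a + l) * hq q a (l + 1) (r - 1) := by
  rcases lt_trichotomy r 0 with h | h | h
  · rw [hq_of_neg _ _ _ h, hq_of_neg _ _ _ h, hq_of_neg _ _ _ (by omega)]; simp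
  · subst h; rw [hq_zero_right, hq_zero_right, hq_of_neg _ _ _ (by omega)]; simp
  · obtain ⟨n, rfl⟩ : ∃ n : ℕ, r = n + 1 := ⟨(r - 1).toNat, by omega⟩
    have h1 : ((n : ℤ) + 1).toNat = n + 1 := by omega
    have h2 : ((n : ℤ) + 1 - 1).toNat = n := by omega
    -- The variable sent to `none` is the last one, `q ^ (a + l)`.
    have tr : ∀ k, MvPolynomial.aeval (fun i : Fin (l + 1) => q ^ (a + (i : ℕ)))
        (MvPolynomial.hsymm (Fin (l + 1)) ℝ k)
        = MvPolynomial.aeval (fun o : Option (Fin l) => q ^ (a + ((finSuccEquivLast.symm o : Fin (l + 1)) : ℕ)))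
          (MvPolynomial.hsymm (Option (Fin l)) ℝ k) := by
      intro k
      rw [← MvPolynomial.rename_hsymm (Fin (l + 1)) ℝ k finSuccEquivLast, MvPolynomial.aeval_rename]
      congr 2
      funext i
      simp
    rw [hq, if_pos h.le, hq, if_pos h.le, hq, if_pos (by omega), h1, h2, tr, tr, hsymm_option_succ,
      add_comm]
    simp [Function.comp_def]

/-- Solving the first order recurrence `f z = g z + θ f (z - 1)`. -/
theorem eq_zpow_mul_add_sum_Ioc {θ : ℝ} (hθ : θ ≠ 0) (f g : ℤ → ℝ)
    (h : ∀ z, f z = g z + θ * f (z - 1)) {a b : ℤ} (hab : a ≤ b) :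
    f b = θ ^ (b - a) * f a + ∑ z ∈ Finset.Ioc a b, θ ^ (b - z) * g z := by
  induction b, hab using Int.leInduction with
  | base => simp
  | succ b hb ih =>
    have hI : Finset.Ioc a (b + 1) = insert (b + 1) (Finset.Ioc a b) := by
      ext z; simp only [Finset.mem_Ioc, Finset.mem_insert]; omega
    rw [hI, Finset.sum_insert (by simp), h, add_sub_cancel_right, ih, mul_add, Finset.mul_sum]
    have : ∀ z : ℤ, θ ^ (b + 1 - z) = θ * θ ^ (b - z) := by
      intro z
      rw [show b + 1 - z = 1 + (b - z) by ring, zpow_add₀ hθ, zpow_one]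
    simp only [this]
    have e : θ * θ ^ (b - (b + 1)) = 1 := by rw [← this]; simp
    rw [e]
    simp only [mul_assoc]
    ring

theorem phi_some (q : ℝ) (k : ℕ) (x z : ℤ) :
    phi q (k + 1) (some x) z = if x ≤ z then (q ^ k) ^ (z - x) else 0 := by
  simp [phi, zpow_mul]

theorem phi_none (q : ℝ) (k : ℕ) (z : ℤ) : phi q (k + 1) none z = (q ^ k) ^ z := by
  simp [phi, zpow_mul]

/-- Convolution with a geometric kernel solves the first order recurrence `hq_succ`, so each further
factor adjoins one variable. The shift to `a + 1` reflects the exponent `k - 1` in `phi`. -/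
theorem phiConv_eq_hq {q : ℝ} (hq0 : q ≠ 0) (a l : ℕ) (x y : ℤ) :
    phiConv q (a + 1) l x y = hq q a l (y - x) := by
  induction l generalizing y with
  | zero =>
    rw [phiConv, hq_no_vars]
    simp only [sub_eq_zero, eq_comm]
  | succ l ih =>
    -- The interval starts just after `x - 1`, where the left side of the recurrence vanishes, so no
    -- boundary term remains.
    have hsupp : ∀ z ∉ Finset.Ioc (x - 1) y,
        phiConv q (a + 1) l x z * phi q (a + 1 + l) (some z) y = 0 := by
      intro z hz
      rw [ih, show a + 1 + l = a + l + 1 by ring, phi_some]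
      simp only [Finset.mem_Ioc, not_and_or, not_lt, not_le] at hz
      rcases hz with hz | hz
      · rw [hq_of_neg _ _ _ (by omega), zero_mul]
      · rw [if_neg (by omega), mul_zero]
    rw [phiConv, tsum_eq_sum hsupp]
    rcases lt_or_ge y x with hyx | hyx
    · rw [hq_of_neg _ _ _ (by omega), Finset.Ioc_eq_empty (by omega), Finset.sum_empty]
    · have := eq_zpow_mul_add_sum_Ioc (pow_ne_zero (a + l) hq0) (fun z => hq q a (l + 1) (z - x))
        (fun z => hq q a l (z - x)) (fun z => by
          rw [hq_succ]; congr 3; ring) (show x - 1 ≤ y by omega)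
      rw [this, hq_of_neg _ _ _ (by omega), mul_zero, zero_add]
      refine Finset.sum_congr rfl fun z hz => ?_
      rw [ih, show a + 1 + l = a + l + 1 by ring, phi_some, if_pos (Finset.mem_Ioc.1 hz).2, mul_comm]

/-- The ratio `(q^{r+1}; q)_L / (q; q)_L`. -/
def qRatio (q : ℝ) (L : ℕ) (r : ℤ) : ℝ := ∏ j ∈ Finset.range L, (1 - q ^ (r + 1 + j)) / (1 - q ^ (j + 1))

theorem one_sub_pow_succ_pos {q : ℝ} (hq0 : 0 < q) (hq1 : q < 1) (j : ℕ) : 0 < 1 - q ^ (j + 1) :=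
  sub_pos.2 (pow_lt_one₀ hq0.le hq1 (by omega))

theorem qRatio_of_neg {q : ℝ} {L : ℕ} {r : ℤ} (h1 : -(L : ℤ) ≤ r) (h2 : r < 0) : qRatio q L r = 0 := by
  refine Finset.prod_eq_zero (i := (-r - 1).toNat) (Finset.mem_range.2 (by omega)) ?_
  rw [show r + 1 + ((-r - 1).toNat : ℤ) = 0 by omega]
  simp

theorem qRatio_zero_right {q : ℝ} (hq0 : 0 < q) (hq1 : q < 1) (L : ℕ) : qRatio q L 0 = 1 := by
  refine Finset.prod_eq_one fun j _ => ?_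
  rw [show (0 : ℤ) + 1 + j = ((j + 1 : ℕ) : ℤ) by push_cast; ring, zpow_natCast]
  exact div_self (one_sub_pow_succ_pos hq0 hq1 j).ne'

theorem qRatio_succ {q : ℝ} (hq0 : 0 < q) (hq1 : q < 1) (L : ℕ) (r : ℤ) :
    qRatio q (L + 1) r = qRatio q L r + q ^ (L + 1) * qRatio q (L + 1) (r - 1) := by
  -- Both products run over the same window of exponents except for the factor `1 - q^r` at its
  -- lower end.
  have e1 : qRatio q (L + 1) (r - 1) = (1 - q ^ r) / (1 - q ^ (L + 1)) * qRatio q L r := by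
    unfold qRatio
    rw [Finset.prod_div_distrib, Finset.prod_div_distrib, Finset.prod_range_succ',
      Finset.prod_range_succ (fun j => 1 - q ^ (j + 1))]
    have : ∀ j : ℕ, r - 1 + 1 + ((j + 1 : ℕ) : ℤ) = r + 1 + j := by intro j; push_cast; ring
    simp only [this]
    simp only [Nat.cast_zero, sub_add_cancel, add_zero]
    rw [mul_comm (∏ j ∈ Finset.range L, (1 - q ^ (r + 1 + (j : ℤ)))), mul_comm _ (1 - q ^ (L + 1)),
      mul_div_mul_comm]
  rw [e1]
  conv_lhs => rw [qRatio, Finset.prod_range_succ, ← qRatio]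
  have hne := (one_sub_pow_succ_pos hq0 hq1 L).ne'
  have : q ^ (r + 1 + (L : ℤ)) = q ^ r * q ^ (L + 1) := by
    rw [add_assoc, zpow_add₀ hq0.ne', show (1 : ℤ) + L = ((L + 1 : ℕ) : ℤ) by push_cast; ring,
      zpow_natCast]
  rw [this]
  field_simp
  ring

/-- Both sides obey the same recurrence. The range of `r` is essential: for `-L ≤ r < 0` the product
already contains a zero factor, so a cut-off function agrees there with a polynomial in `q^r`. This
is what later lets a single cut replace `d` different ones. -/
theorem hq_eq_qRatio {q : ℝ} (hq0 : 0 < q) (hq1 : q < 1) (a L : ℕ) (r : ℤ) (hr : -(L : ℤ) ≤ r) :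
    hq q a (L + 1) r = (q ^ a) ^ r * qRatio q L r := by
  rcases lt_or_ge r 0 with h | h
  · rw [hq_of_neg _ _ _ h, qRatio_of_neg hr h, mul_zero]
  obtain ⟨n, rfl⟩ := Int.eq_ofNat_of_zero_le h
  clear h hr
  have hqa : q ^ a ≠ 0 := pow_ne_zero _ hq0.ne'
  induction L generalizing n with
  | zero =>
    induction n with
    | zero => simp [hq_zero_right, qRatio]
    | succ n ih =>
      rw [hq_succ, hq_no_vars, if_neg (by omega),
        show ((n + 1 : ℕ) : ℤ) - 1 = n by push_cast; ring, ih]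
      rw [Nat.cast_succ, zpow_add_one₀ hqa]
      simp [qRatio, mul_comm]
  | succ L ihL =>
    induction n with
    | zero => simp [hq_zero_right, qRatio_zero_right hq0 hq1]
    | succ n ih =>
      rw [hq_succ, ihL, qRatio_succ hq0 hq1 L, show ((n + 1 : ℕ) : ℤ) - 1 = n by push_cast; ring, ih]
      rw [show ((n + 1 : ℕ) : ℤ) = 1 + n by push_cast; ring, zpow_add₀ hqa, zpow_one]
      ring

theorem qRatio_nonneg {q : ℝ} (hq0 : 0 < q) (hq1 : q < 1) (L n : ℕ) : 0 ≤ qRatio q L n := by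
  refine Finset.prod_nonneg fun j _ => div_nonneg ?_ (one_sub_pow_succ_pos hq0 hq1 j).le
  rw [show (n : ℤ) + 1 + j = ((n + j + 1 : ℕ) : ℤ) by push_cast; ring, zpow_natCast]
  exact (one_sub_pow_succ_pos hq0 hq1 _).le

/-- `(q; q)_L` for real `q`. -/
def qFact (q : ℝ) (L : ℕ) : ℝ := ∏ j ∈ Finset.range L, (1 - q ^ (j + 1))

theorem qFact_pos {q : ℝ} (hq0 : 0 < q) (hq1 : q < 1) (L : ℕ) : 0 < qFact q L :=
  Finset.prod_pos fun j _ => one_sub_pow_succ_pos hq0 hq1 j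

theorem qFact_succ (q : ℝ) (L : ℕ) : qFact q (L + 1) = qFact q L * (1 - q ^ (L + 1)) :=
  Finset.prod_range_succ _ _

theorem qRatio_le {q : ℝ} (hq0 : 0 < q) (hq1 : q < 1) (L n : ℕ) :
    qRatio q L n ≤ (qFact q L)⁻¹ := by
  unfold qFact
  rw [← Finset.prod_inv_distrib]
  refine Finset.prod_le_prod (fun j _ => ?_) fun j _ => ?_
  · refine div_nonneg ?_ (one_sub_pow_succ_pos hq0 hq1 j).le
    rw [show (n : ℤ) + 1 + j = ((n + j + 1 : ℕ) : ℤ) by push_cast; ring, zpow_natCast]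
    exact (one_sub_pow_succ_pos hq0 hq1 _).le
  · rw [div_eq_mul_inv]
    refine mul_le_of_le_one_left (inv_nonneg.2 (one_sub_pow_succ_pos hq0 hq1 j).le) ?_
    have := zpow_pos hq0 ((n : ℤ) + 1 + j)
    linarith

/-- The smallest exponent among the variables is `l + 1`, so after division by `(q^l)^r` a factor
`q^r` is left over a bounded quotient. -/
theorem summable_hq {q : ℝ} (hq0 : 0 < q) (hq1 : q < 1) (l L : ℕ) :
    Summable fun r : ℕ => ((q ^ l) ^ r)⁻¹ * hq q (l + 1) L r := by
  cases L with
  | zero =>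
    refine summable_of_ne_finset_zero (s := {0}) fun r hr => ?_
    rw [hq_no_vars, if_neg (by simpa using hr), mul_zero]
  | succ L =>
    have e : ∀ r : ℕ, ((q ^ l) ^ r)⁻¹ * hq q (l + 1) (L + 1) r = q ^ r * qRatio q L r := by
      intro r
      rw [hq_eq_qRatio hq0 hq1 _ _ _ (by omega), zpow_natCast, pow_succ q l, mul_pow]
      have := pow_ne_zero r (pow_ne_zero l hq0.ne')
      field_simp
    simp only [e]
    refine Summable.of_nonneg_of_le (fun r => mul_nonneg (pow_nonneg hq0.le _)
      (qRatio_nonneg hq0 hq1 _ _)) (fun r => mul_le_mul_of_nonneg_left (qRatio_le hq0 hq1 _ _)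
      (pow_nonneg hq0.le _)) ?_
    exact (summable_geometric_of_lt_one hq0.le hq1).mul_right _

/-- The generating function of the `h_r` at `w = q^{-l}`, where the factors `1 - w q^{l+1+j}` become
those of `(q;q)_L`. -/
theorem tsum_hq {q : ℝ} (hq0 : 0 < q) (hq1 : q < 1) (l L : ℕ) :
    ∑' r : ℕ, ((q ^ l) ^ r)⁻¹ * hq q (l + 1) L r = (qFact q L)⁻¹ := by
  induction L with
  | zero =>
    rw [tsum_eq_single 0]
    · simp [hq_zero_right, qFact]
    · intro r hr
      rw [hq_no_vars, if_neg (by simpa using hr), mul_zero]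
  | succ L ih =>
    have h1 := summable_hq hq0 hq1 l L
    have h2 := summable_hq hq0 hq1 l (L + 1)
    set S := ∑' r : ℕ, ((q ^ l) ^ r)⁻¹ * hq q (l + 1) (L + 1) r with hS
    have hql : q ^ l ≠ 0 := pow_ne_zero _ hq0.ne'
    -- Summing `hq_succ` over `r` gives a linear equation for the sum; its coefficient is `q^{-l}
    -- q^{l+1+L}`.
    have e : S = (qFact q L)⁻¹ + q ^ (L + 1) * S := by
      have a : S = 1 + ∑' r : ℕ, ((q ^ l) ^ (r + 1))⁻¹ * hq q (l + 1) (L + 1) ((r + 1 : ℕ) : ℤ) := by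
        rw [hS, h2.tsum_eq_zero_add]; simp [hq_zero_right]
      have b : (qFact q L)⁻¹ = 1 + ∑' r : ℕ, ((q ^ l) ^ (r + 1))⁻¹ * hq q (l + 1) L ((r + 1 : ℕ) : ℤ) := by
        rw [← ih, h1.tsum_eq_zero_add]; simp [hq_zero_right]
      conv_lhs => rw [a]
      rw [b, add_assoc]
      congr 1
      rw [hS, ← tsum_mul_left, ← Summable.tsum_add]
      · refine tsum_congr fun r => ?_
        rw [hq_succ, show ((r + 1 : ℕ) : ℤ) - 1 = r by push_cast; ring,
          show l + 1 + L = l + (L + 1) by ring, pow_add q l (L + 1), pow_succ (q ^ l) r, mul_add]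
        generalize hq q (l + 1) (L + 1) r = h₁
        generalize hq q (l + 1) L ((r + 1 : ℕ) : ℤ) = h₂
        generalize q ^ (L + 1) = c
        generalize q ^ l = b at hql
        congr 1
        field_simp
      · exact (summable_nat_add_iff (f := fun r : ℕ => ((q ^ l) ^ r)⁻¹ * hq q (l + 1) L r) 1).2 h1
      · exact h2.mul_left _
    rw [qFact_succ, mul_inv]
    have hp := (one_sub_pow_succ_pos hq0 hq1 L).ne'
    rw [eq_mul_inv_iff_mul_eq₀ hp]
    linear_combination e

/-- The entrance law of a virtual particle stays geometric under propagation; only points `z = t -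
r` with `r ≥ 0` contribute. -/
theorem hasSum_zpow_mul_hq {q : ℝ} (hq0 : 0 < q) (hq1 : q < 1) (l L : ℕ) (t : ℤ) :
    HasSum (fun z : ℤ => (q ^ l) ^ z * hq q (l + 1) L (t - z)) ((q ^ l) ^ t * (qFact q L)⁻¹) := by
  have hql : q ^ l ≠ 0 := pow_ne_zero _ hq0.ne'
  have h := ((summable_hq hq0 hq1 l L).hasSum.mul_left ((q ^ l) ^ t))
  rw [tsum_hq hq0 hq1] at h
  have hinj : Function.Injective fun r : ℕ => t - (r : ℤ) := fun a b hab => by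
    simp only at hab; omega
  rw [← hinj.hasSum_iff]
  · refine h.congr_fun fun r => ?_
    simp only [Function.comp]
    rw [zpow_sub₀ hql, zpow_natCast, sub_sub_cancel]
    ring
  · intro z hz
    rw [hq_of_neg, mul_zero]
    by_contra hcon
    exact hz ⟨(t - z).toNat, by simp only; omega⟩

/-! ### The entrance functions and the kernel -/

variable {d N : ℕ}

theorem yFull_of_lt (y : Fin d → ℤ) (l : Fin (d + N)) (hl : (l : ℕ) < d) : yFull N y l = y ⟨l, hl⟩ :=
  Fin.append_left y _ ⟨l, hl⟩

theorem yFull_natAdd (y : Fin d → ℤ) (i : Fin N) :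
    yFull N y (Fin.natAdd d i) = -(d : ℤ) - ((i : ℕ) + 1) := by
  rw [yFull, Fin.append_right]

theorem entrance_of_lt {q : ℝ} (hq0 : q ≠ 0) (y : Fin d → ℤ) (n : ℕ) (l : Fin (d + N))
    (hl : (l : ℕ) < d) (t : ℤ) : entrance y q n l t = hq q d n (t - yFull N y l) := by
  rw [entrance, if_pos hl, tsum_eq_single (yFull N y l)]
  · simp [chi, phiConv_eq_hq hq0]
  · intro z hz
    simp [chi, hz]

theorem entrance_of_ge_of_lt {q : ℝ} (hq0 : 0 < q) (hq1 : q < 1) (y : Fin d → ℤ) (n : ℕ)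
    (l : Fin (d + N)) (hl : d ≤ (l : ℕ)) (hl' : (l : ℕ) < d + n) (t : ℤ) :
    entrance y q n l t = (q ^ (l : ℕ)) ^ t * (qFact q (d + n - (l + 1)))⁻¹ := by
  rw [entrance, if_neg (by omega), if_pos hl']
  simp only [phi_none, show (l : ℕ) + 2 = l + 1 + 1 from rfl, phiConv_eq_hq hq0.ne']
  exact (hasSum_zpow_mul_hq hq0 hq1 _ _ _).tsum_eq

theorem entrance_of_ge {q : ℝ} (y : Fin d → ℤ) (n : ℕ)
    (l : Fin (d + N)) (hl : d + n ≤ (l : ℕ)) (t : ℤ) : entrance y q n l t = 0 := by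
  rw [entrance, if_neg (by omega), if_neg (by omega)]

/-- For the real particles this is the recurrence of `hq`. For the virtual ones it is `(q;q)_{k+1} =
(q;q)_k (1 - q^{k+1})`, because `q^{d+n}` is `q^l q^{k+1}` with `k = d + n - (l + 1)`. -/
theorem entrance_succ {q : ℝ} (hq0 : 0 < q) (hq1 : q < 1) (y : Fin d → ℤ) (n : ℕ)
    (l : Fin (d + N)) (hl : (l : ℕ) < d + n) (t : ℤ) :
    entrance y q (n + 1) l t = entrance y q n l t + q ^ (d + n) * entrance y q (n + 1) l (t - 1) := by
  rcases lt_or_ge (l : ℕ) d with h | h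
  · rw [entrance_of_lt hq0.ne' _ _ _ h, entrance_of_lt hq0.ne' _ _ _ h,
      entrance_of_lt hq0.ne' _ _ _ h, hq_succ]
    congr 3
    ring
  · rw [entrance_of_ge_of_lt hq0 hq1 _ _ _ h (by omega), entrance_of_ge_of_lt hq0 hq1 _ _ _ h hl,
      entrance_of_ge_of_lt hq0 hq1 _ _ _ h (by omega)]
    have e : d + (n + 1) - (l + 1) = d + n - (l + 1) + 1 := by omega
    have e2 : q ^ (d + n) = q ^ (l : ℕ) * q ^ (d + n - (l + 1) + 1) := by
      rw [← pow_add]; congr 1; omega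
    rw [e, qFact_succ, e2, zpow_sub_one₀ (pow_ne_zero _ hq0.ne')]
    have h1 := (one_sub_pow_succ_pos hq0 hq1 (d + n - (l + 1))).ne'
    have h2 := (qFact_pos hq0 hq1 (d + n - (l + 1))).ne'
    have h3 := pow_ne_zero (l : ℕ) hq0.ne'
    generalize q ^ (d + n - (l + 1) + 1) = c at *
    generalize qFact q (d + n - (l + 1)) = c' at *
    generalize q ^ (l : ℕ) = c'' at *
    field_simp
    ring

theorem entrance_last {q : ℝ} (hq0 : 0 < q) (hq1 : q < 1) (y : Fin d → ℤ) (n : ℕ)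
    (l : Fin (d + N)) (hl : (l : ℕ) = d + n) (t : ℤ) :
    entrance y q (n + 1) l t = (q ^ (d + n)) ^ t := by
  rw [entrance_of_ge_of_lt hq0 hq1 _ _ _ (by omega) (by omega), hl,
    show d + (n + 1) - (d + n + 1) = 0 by omega]
  simp [qFact]

theorem entrance_zero {q : ℝ} (hq0 : q ≠ 0) (y : Fin d → ℤ) (l : Fin (d + N)) (hl : (l : ℕ) < d)
    (t : ℤ) : entrance y q 0 l t = if t = yFull N y l then 1 else 0 := by
  rw [entrance_of_lt hq0 _ _ _ hl, hq_no_vars]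
  simp only [sub_eq_zero]

/-- The entrance functions of the top level, at the points of the top row. -/
def topMat (y : Fin d → ℤ) (x : Fin (d + N) → ℤ) (q : ℝ) : Matrix (Fin (d + N)) (Fin (d + N)) ℝ :=
  Matrix.of fun l j => entrance y q N l (x j)

theorem psiLevel_eq {q : ℝ} (hq0 : q ≠ 0) (y : Fin d → ℤ) (x : Fin (d + N) → ℤ) (m : ℕ)
    (k : Fin (d + N)) (s : ℤ) :
    psiLevel y x q m k s = ∑ j, (Hmat y x q)⁻¹ k j * hq q (d + m) (N - m) (x j - s) := by
  have h : ∀ j ∈ Finset.univ, HasSum (fun z : ℤ => hq q (d + m) (N - m) (z - s) *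
      ((Hmat y x q)⁻¹ k j * if z = x j then 1 else 0))
      ((Hmat y x q)⁻¹ k j * hq q (d + m) (N - m) (x j - s)) := by
    intro j _
    have := hasSum_single (f := fun z : ℤ => hq q (d + m) (N - m) (z - s) *
      ((Hmat y x q)⁻¹ k j * if z = x j then 1 else 0)) (x j) (fun z hz => by simp [hz])
    simpa [mul_comm] using this
  have h' := (hasSum_sum h).tsum_eq
  simp only [psiLevel, psi, phiConv_eq_hq hq0, Finset.mul_sum]
  exact h'

/-- By associativity of convolution, every row pairs a top level entrance function with the `ψ`,
which are supported on the top row with coefficients `H⁻¹`. -/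
theorem Mmat_eq {q : ℝ} (hq0 : 0 < q) (hq1 : q < 1) (y : Fin d → ℤ) (x : Fin (d + N) → ℤ) :
    Mmat y x q = topMat y x q * ((Hmat y x q)⁻¹).transpose := by
  ext i j
  simp only [Mmat, topMat, Matrix.of_apply, Matrix.mul_apply, Matrix.transpose_apply]
  split_ifs with hi
  · rw [tsum_eq_single (yFull N y i)]
    · rw [chi, if_pos rfl, one_mul, psiLevel_eq hq0.ne']
      refine Finset.sum_congr rfl fun k _ => ?_
      rw [entrance_of_lt hq0.ne' _ _ _ hi]
      simp [mul_comm]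
    · intro z hz
      simp [chi, hz]
  · push Not at hi
    have h : ∀ k ∈ Finset.univ, HasSum (fun z : ℤ => (q ^ (i : ℕ)) ^ z *
        ((Hmat y x q)⁻¹ j k * hq q (i + 1) (d + N - (i + 1)) (x k - z)))
        (entrance y q N i (x k) * (Hmat y x q)⁻¹ j k) := by
      intro k _
      rw [entrance_of_ge_of_lt hq0 hq1 _ _ _ hi i.2]
      refine ((hasSum_zpow_mul_hq hq0 hq1 i (d + N - (i + 1)) (x k)).mul_right
        ((Hmat y x q)⁻¹ j k)).congr_fun fun z => ?_
      ring
    rw [← (hasSum_sum h).tsum_eq]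
    refine tsum_congr fun z => ?_
    rw [phi_none, psiLevel_eq hq0.ne', Finset.mul_sum, show d + (i + 1 - d) = (i : ℕ) + 1 by omega,
      show N - (i + 1 - d) = d + N - (i + 1) by omega]

/-- The factor `(H⁻¹)ᵀ` contributed by the `ψ` cancels against the one in `M`. -/
theorem Kq_eq {q : ℝ} (hq0 : 0 < q) (hq1 : q < 1) (y : Fin d → ℤ) (x : Fin (d + N) → ℤ)
    (hH : (Hmat y x q).det ≠ 0) (m : ℕ) (s : ℤ) (n : ℕ) (t : ℤ) :
    Kq y x q m s n t = -(if m < n then hq q (d + m) (n - m) (t - s) else 0)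
      + ∑ j, hq q (d + m) (N - m) (x j - s) * ∑ l, (topMat y x q)⁻¹ j l * entrance y q n l t := by
  set g : Fin (d + N) → ℝ := fun j => hq q (d + m) (N - m) (x j - s)
  set e : Fin (d + N) → ℝ := fun l => entrance y q n l t
  have h1 : (fun k => psiLevel y x q m k s) = Matrix.vecMul g ((Hmat y x q)⁻¹).transpose := by
    funext k
    simp only [psiLevel_eq hq0.ne', Matrix.vecMul, dotProduct, Matrix.transpose_apply, g]
    exact Finset.sum_congr rfl fun j _ => mul_comm _ _
  have hu : IsUnit ((Hmat y x q)⁻¹).transpose.det := by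
    rw [Matrix.det_transpose]
    exact Matrix.isUnit_nonsing_inv_det _ (isUnit_iff_ne_zero.2 hH)
  have h2 : ∑ k, ∑ l, psiLevel y x q m k s * (Mmat y x q)⁻¹ k l * e l
      = dotProduct (Matrix.vecMul (fun k => psiLevel y x q m k s) (Mmat y x q)⁻¹) e := by
    simp only [dotProduct, Matrix.vecMul, Finset.sum_mul]
    rw [Finset.sum_comm]
  rw [Kq, h2, h1, Mmat_eq hq0 hq1, Matrix.mul_inv_rev, Matrix.vecMul_vecMul, ← mul_assoc,
    Matrix.mul_nonsing_inv _ hu, one_mul, ← Matrix.dotProduct_mulVec]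
  congr 1
  rw [phiConv_eq_hq hq0.ne']

/-! ### Sums over interlacing families as determinants -/

/-- Interlacing rows below a given row. -/
def below {n : ℕ} (x : Fin (n + 1) → ℤ) : Finset (Fin n → ℤ) :=
  Fintype.piFinset fun j => Finset.Ioc (x j.succ) (x j.castSucc)

theorem mem_below {n : ℕ} {x : Fin (n + 1) → ℤ} {z : Fin n → ℤ} :
    z ∈ below x ↔ ∀ j, x j.succ < z j ∧ z j ≤ x j.castSucc := by
  simp [below]

theorem strictAnti_of_mem_below {n : ℕ} {x : Fin (n + 1) → ℤ} {z : Fin n → ℤ} (hz : z ∈ below x) :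
    StrictAnti z := by
  cases n with
  | zero => exact fun i => i.elim0
  | succ n =>
    refine Fin.strictAnti_iff_succ_lt.2 fun i => ?_
    have h1 := (mem_below.1 hz i.succ).2
    have h2 := (mem_below.1 hz i.castSucc).1
    rw [← Fin.succ_castSucc] at h1
    exact h1.trans_lt h2

/-- Reversing the order of the columns turns the right neighbour into the predecessor. -/
theorem det_col_sub_succ {n : ℕ} (A B : Matrix (Fin (n + 1)) (Fin (n + 1)) ℝ) (c : Fin n → ℝ)
    (hlast : ∀ i, A i (Fin.last n) = B i (Fin.last n))
    (h : ∀ i j, A i j.castSucc = B i j.castSucc + c j * A i j.succ) : A.det = B.det := by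
  rw [← Matrix.det_submatrix_equiv_self Fin.revPerm A,
    ← Matrix.det_submatrix_equiv_self Fin.revPerm B]
  refine Matrix.det_eq_of_forall_col_eq_smul_add_pred (fun j => c j.rev) (fun i => ?_) fun i j => ?_
  · simp [hlast]
  · simp only [Matrix.submatrix_apply, Fin.revPerm_apply, Fin.rev_succ, Fin.rev_castSucc]
    exact h _ _

/-- One step of the summation over interlacing rows. -/
theorem det_eq_sum_below {n : ℕ} {θ : ℝ} (hθ : θ ≠ 0) (f : Fin (n + 1) → ℤ → ℝ) (g : Fin n → ℤ → ℝ)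
    (hrec : ∀ i z, f i.castSucc z = g i z + θ * f i.castSucc (z - 1))
    (hlast : ∀ z, f (Fin.last n) z = θ ^ z) (x : Fin (n + 1) → ℤ) (hx : StrictAnti x) :
    (Matrix.of fun i j => f i (x j)).det = ∑ z ∈ below x,
      θ ^ ((∑ i, x i) - ∑ i, z i) * (Matrix.of fun i j => g i (z j)).det := by
  have step : ∀ j : Fin n, x j.succ ≤ x j.castSucc := fun j => (hx (Fin.castSucc_lt_succ)).le
  -- Subtracting the multiple `θ^(gap)` of the next column kills the last row `θ^z` except in the
  -- corner, and turns the other entries into sums over the intervals allowed by interlacing.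
  set B : Matrix (Fin (n + 1)) (Fin (n + 1)) ℝ := Matrix.of fun i j =>
    Fin.lastCases (motive := fun _ => ℝ) (f i (x (Fin.last n)))
      (fun j => f i (x j.castSucc) - θ ^ (x j.castSucc - x j.succ) * f i (x j.succ)) j with hB
  rw [det_col_sub_succ _ B (fun j => θ ^ (x j.castSucc - x j.succ)) (fun i => by simp [hB])
    (fun i j => by simp [hB])]
  rw [Matrix.det_succ_row B (Fin.last n), Fin.sum_univ_castSucc, Finset.sum_eq_zero, zero_add]
  swap
  · intro j _
    have : B (Fin.last n) j.castSucc = 0 := by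
      simp only [hB, Matrix.of_apply, Fin.lastCases_castSucc, hlast]
      rw [← zpow_add₀ hθ]; simp
    rw [this]; simp
  have e1 : B (Fin.last n) (Fin.last n) = θ ^ x (Fin.last n) := by simp [hB, hlast]
  have e2 : (B.submatrix (Fin.last n).succAbove (Fin.last n).succAbove)
      = (Matrix.of fun j i => ∑ z ∈ Finset.Ioc (x j.succ) (x j.castSucc),
          θ ^ (x j.castSucc - z) * g i z).transpose := by
    ext i j
    simp only [Matrix.submatrix_apply, Fin.succAbove_last, hB, Matrix.of_apply,
      Fin.lastCases_castSucc, Matrix.transpose_apply]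
    rw [eq_zpow_mul_add_sum_Ioc hθ (f i.castSucc) (g i) (hrec i) (step j)]
    ring
  -- Multilinearity: choosing one `z` in each interval amounts to choosing a row below `x`.
  have e3 : (Matrix.of fun j i => ∑ z ∈ Finset.Ioc (x j.succ) (x j.castSucc),
          θ ^ (x j.castSucc - z) * g i z).det
      = ∑ z ∈ below x, (Matrix.of fun j i => θ ^ (x j.castSucc - z j) * g i (z j)).det := by
    have := (Matrix.detRowAlternating (R := ℝ) (n := Fin n)).toMultilinearMap.map_sum_finset
      (fun j z => fun i => θ ^ (x j.castSucc - z) * g i z)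
      (fun j => Finset.Ioc (x j.succ) (x j.castSucc))
    refine Eq.trans ?_ this
    congr 1
    ext j i
    simp [Finset.sum_apply]
  rw [e1, e2, Matrix.det_transpose, e3, Finset.mul_sum]
  refine Finset.sum_congr rfl fun z _ => ?_
  have e4 := Matrix.det_mul_column (fun j : Fin n => θ ^ (x j.castSucc - z j))
    (Matrix.of fun j i => g i (z j))
  simp only [Matrix.of_apply] at e4
  rw [e4, ← Matrix.det_transpose (Matrix.of fun i j => g i (z j)),
    Fin.sum_univ_castSucc]
  have e5 : ∏ j : Fin n, θ ^ (x j.castSucc - z j) = θ ^ (∑ j : Fin n, x j.castSucc - ∑ j, z j) := by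
    rw [← Finset.sum_sub_distrib]
    generalize (Finset.univ : Finset (Fin n)) = s
    induction s using Finset.cons_induction with
    | empty => simp
    | cons a s ha ih => rw [Finset.prod_cons, Finset.sum_cons, zpow_add₀ hθ, ih]
  rw [e5, show ((-1 : ℝ)) ^ ((Fin.last n : ℕ) + (Fin.last n : ℕ)) = 1 by
    rw [← two_mul, pow_mul]; simp, one_mul, ← mul_assoc, ← zpow_add₀ hθ]
  congr 2
  ring

/-- Adding a top row to a family of rows. -/
def extend (w : Config d N) (x : Fin (d + (N + 1)) → ℤ) : Config d (N + 1) :=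
  Fin.snoc (α := fun k : Fin (N + 2) => Fin (d + (k : ℕ)) → ℤ) w x

theorem extend_last (w : Config d N) (x : Fin (d + (N + 1)) → ℤ) :
    extend w x (Fin.last (N + 1)) = x :=
  Fin.snoc_last (α := fun k : Fin (N + 2) => Fin (d + (k : ℕ)) → ℤ) _ _

theorem extend_castSucc (w : Config d N) (x : Fin (d + (N + 1)) → ℤ) (k : Fin (N + 1)) :
    extend w x k.castSucc = w k :=
  Fin.snoc_castSucc (α := fun k : Fin (N + 2) => Fin (d + (k : ℕ)) → ℤ) _ _ _

theorem extend_injective (x : Fin (d + (N + 1)) → ℤ) :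
    Function.Injective fun w : Config d N => extend w x := by
  intro w w' h
  funext k
  rw [← extend_castSucc w x, ← extend_castSucc w' x]
  exact congrFun h _

theorem configs_succ (y : Fin d → ℤ) (x : Fin (d + (N + 1)) → ℤ) :
    configs y x = ⋃ z ∈ (below (n := d + N) x : Set (Fin (d + N) → ℤ)),
      (fun w => extend w x) '' configs y z := by
  ext w
  simp only [Set.mem_iUnion, Set.mem_image, exists_prop, Finset.mem_coe, mem_below]
  constructor
  · rintro ⟨h1, h2, h3⟩
    refine ⟨w (Fin.last N).castSucc, fun j => ?_, fun k => w k.castSucc,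
      ⟨h1, fun _ => rfl, fun k i => h3 k.castSucc i⟩, ?_⟩
    · have := h3 (Fin.last N) j
      rw [← h2, ← h2]
      exact this
    · funext k
      induction k using Fin.lastCases with
      | last => rw [extend_last]; funext i; exact (h2 i).symm
      | cast k => rw [extend_castSucc]
  · rintro ⟨z, hz, w, ⟨h1, h2, h3⟩, rfl⟩
    refine ⟨?_, ?_, ?_⟩
    · intro i
      exact (congrFun (extend_castSucc w x 0) _).trans (h1 i)
    · intro i
      exact congrFun (extend_last w x) _
    · intro k i
      induction k using Fin.lastCases with
      | last =>
        have e1 := fun i => congrFun (extend_last w x) i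
        have e2 := fun i => congrFun (extend_castSucc w x (Fin.last N)) i
        have := hz i
        rw [← h2] at this
        refine ⟨?_, ?_⟩
        · exact (e1 _).trans_lt (this.1.trans_eq (e2 _).symm)
        · exact (e2 _).trans_le (this.2.trans_eq (e1 _).symm)
      | cast k =>
        have e1 := fun i => congrFun (extend_castSucc w x k.succ) i
        have e2 := fun i => congrFun (extend_castSucc w x k.castSucc) i
        have := h3 k i
        refine ⟨?_, ?_⟩
        · exact (e1 _).trans_lt (this.1.trans_eq (e2 _).symm)
        · exact (e2 _).trans_le (this.2.trans_eq (e1 _).symm)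

theorem finsum_configs_succ (y : Fin d → ℤ) (x : Fin (d + (N + 1)) → ℤ) (F : Config d (N + 1) → ℝ) :
    ∑ᶠ w ∈ configs y x, F w
      = ∑ z ∈ below (n := d + N) x, ∑ᶠ w ∈ configs y z, F (extend w x) := by
  rw [configs_succ, finsum_mem_biUnion]
  · rw [finsum_mem_coe_finset]
    refine Finset.sum_congr rfl fun z _ => ?_
    rw [finsum_mem_image (extend_injective x).injOn]
  · intro z hz z' hz' hne
    refine Set.disjoint_left.2 ?_
    rintro _ ⟨w, hw, rfl⟩ ⟨w', hw', h⟩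
    apply hne
    have := extend_injective x h
    subst this
    funext i
    rw [← hw.2.1, hw'.2.1]
  · exact Finset.finite_toSet _
  · exact fun z _ => (configs_finite y z).image _

/-- The family that consists of the bottom row only. -/
def bottomRow (y : Fin d → ℤ) : Config d 0 :=
  fun k i => y ⟨i, by have := i.2; have := k.2; omega⟩

theorem configs_zero (y : Fin d → ℤ) (x : Fin (d + 0) → ℤ) :
    configs y x = {w | w = bottomRow y ∧ ∀ i : Fin d, x i = y i} := by
  ext w
  constructor
  · rintro ⟨h1, h2, -⟩
    refine ⟨?_, fun i => ?_⟩
    · funext k i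
      obtain rfl : k = 0 := Fin.ext (by have := k.2; simp only [Fin.val_zero]; omega)
      exact h1 ⟨i, by simp⟩
    · exact (h2 i).symm.trans (h1 i)
  · rintro ⟨rfl, h⟩
    exact ⟨fun i => rfl, fun i => (h i).symm, fun k => k.elim0⟩

/-- The product over the levels of the transition weights, with a factor `G k z` for each dot `(k, z)`
below the top level. -/
def chainWeight (q : ℝ) (G : ℕ → ℤ → ℝ) (w : Config d N) : ℝ :=
  ∏ k : Fin N, ((q ^ (d + (k : ℕ))) ^ ((∑ i, w k.succ i) - ∑ i, w k.castSucc i)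
    * ∏ i, G k (w k.castSucc i))

theorem chainWeight_extend (q : ℝ) (G : ℕ → ℤ → ℝ) (w : Config d N) (x : Fin (d + (N + 1)) → ℤ) :
    chainWeight q G (extend w x) = chainWeight q G w *
      ((q ^ (d + N)) ^ ((∑ i, x i) - ∑ i, w (Fin.last N) i) * ∏ i, G N (w (Fin.last N) i)) := by
  unfold chainWeight
  rw [Fin.prod_univ_castSucc]
  congr 1
  · refine Finset.prod_congr rfl fun k _ => ?_
    have e1 := extend_castSucc w x k.succ
    have e2 := extend_castSucc w x k.castSucc
    rw [e2]
    rw [Fin.succ_castSucc, e1]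
    rfl
  · rw [Fin.succ_last, extend_last, extend_castSucc]
    rfl

theorem det_indicator_eq {y z : Fin d → ℤ} (hy : StrictAnti y) (hz : StrictAnti z) :
    (Matrix.of fun i j : Fin d => if z j = y i then (1 : ℝ) else 0).det = if z = y then 1 else 0 := by
  split_ifs with h
  · subst h
    have : (Matrix.of fun i j : Fin d => if z j = z i then (1 : ℝ) else 0) = 1 := by
      ext i j
      simp [Matrix.one_apply, hz.injective.eq_iff, eq_comm]
    rw [this, Matrix.det_one]
  · have : ∃ j, ∀ i, z j ≠ y i := by
      by_contra hcon
      push Not at hcon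
      choose f hf using hcon
      have hmono : StrictMono f := fun a b hab => by
        have := hz hab
        rw [hf, hf] at this
        exact hy.lt_iff_gt.1 this
      -- A strictly increasing self-map of a finite chain is an order automorphism, hence trivial.
      have : f = id := by
        have h2 := Subsingleton.elim
          (StrictMono.orderIsoOfSurjective f hmono (Finite.surjective_of_injective hmono.injective))
          (OrderIso.refl (Fin d))
        funext i
        exact congrArg (fun e : Fin d ≃o Fin d => e i) h2
      apply h
      funext j
      rw [hf, this, id]
    obtain ⟨j, hj⟩ := this
    refine Matrix.det_eq_zero_of_column_eq_zero j fun i => ?_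
    simp [hj i]

/-- The top row is peeled off with `θ = q^(d+N)`, and the factors `G N` are pulled out of the
columns before the induction hypothesis is applied. The functions `B` and the factors `G` are
arbitrary, so that one statement serves both the partition function and its perturbation by
`pointFactor`. -/
theorem det_eq_finsum_chainWeight {q : ℝ} (hq0 : q ≠ 0) {y : Fin d → ℤ} (hy : StrictAnti y)
    (G : ℕ → ℤ → ℝ) (B : ℕ → ℕ → ℤ → ℝ)
    (h0 : ∀ (i : Fin d) z, B 0 i z = if z = y i then 1 else 0)
    (hrec : ∀ k < N, ∀ i < d + k, ∀ z,
      B (k + 1) i z = B k i z * G k z + q ^ (d + k) * B (k + 1) i (z - 1))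
    (hlast : ∀ k < N, ∀ z, B (k + 1) (d + k) z = (q ^ (d + k)) ^ z)
    (x : Fin (d + N) → ℤ) (hx : StrictAnti x) :
    (Matrix.of fun i j : Fin (d + N) => B N i (x j)).det
      = ∑ᶠ w ∈ configs y x, chainWeight q G w := by
  induction N with
  | zero =>
    have e : (Matrix.of fun i j : Fin (d + 0) => B 0 i (x j))
        = Matrix.of fun i j : Fin d => if x j = y i then (1 : ℝ) else 0 := by
      ext i j; exact h0 i _
    rw [e]
    have := det_indicator_eq hy (z := x) hx
    refine this.trans ?_
    rw [configs_zero]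
    split_ifs with h
    · have hs : {w : Config d 0 | w = bottomRow y
          ∧ ∀ i : Fin d, x i = y i} = {bottomRow y} := by
        ext w
        simp only [Set.mem_ofPred_eq, Set.mem_singleton_iff, and_iff_left_iff_imp]
        exact fun _ i => congrFun h i
      rw [hs, finsum_mem_singleton]
      simp [chainWeight]
    · have hs : {w : Config d 0 | w = bottomRow y
          ∧ ∀ i : Fin d, x i = y i} = ∅ := by
        ext w
        simp only [Set.mem_ofPred_eq, Set.mem_empty_iff_false, iff_false, not_and]
        exact fun _ h' => h (funext h')
      rw [hs, finsum_mem_empty]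
  | succ N ih =>
    rw [finsum_configs_succ]
    have key := det_eq_sum_below (n := d + N) (pow_ne_zero (d + N) hq0)
      (fun i z => B (N + 1) i z) (fun i z => B N i z * G N z)
      (fun i z => hrec N (by omega) i i.2 z) (fun z => hlast N (by omega) z) x hx
    refine key.trans (Finset.sum_congr rfl fun z hz => ?_)
    have e := Matrix.det_mul_row (fun j : Fin (d + N) => G N (z j))
      (Matrix.of fun i j : Fin (d + N) => B N i (z j))
    simp only [Matrix.of_apply] at e
    simp only [mul_comm (B N _ _)]
    rw [e, ih (fun k hk => hrec k (by omega)) (fun k hk => hlast k (by omega)) z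
      (strictAnti_of_mem_below hz), ← mul_assoc, mul_finsum_mem]
    refine finsum_mem_congr rfl fun w hw => ?_
    have hw' : w (Fin.last N) = z := funext fun i => hw.2.1 i
    rw [chainWeight_extend, hw']
    exact mul_comm _ _

/-! ### The determinantal structure -/

/-- Summation by parts: the coefficient of an inner `S k` in the first sum is `(d + k - 1) - (d + k)
= -1`. -/
theorem sum_mul_sub_add_sum_inner (d : ℕ) {n : ℕ} (S : Fin (n + 2) → ℤ) :
    ∑ k : Fin (n + 1), ((d + (k : ℕ) : ℕ) : ℤ) * (S k.succ - S k.castSucc)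
      + ∑ k : Fin (n + 2), (if 0 < (k : ℕ) ∧ (k : ℕ) < n + 1 then S k else 0)
      = (d + n) * S (Fin.last _) - d * S 0 := by
  have h1 : ∑ k : Fin (n + 1), ((d + (k : ℕ) : ℕ) : ℤ) * S k.succ
      = ∑ k : Fin n, ((d + (k : ℕ) : ℕ) : ℤ) * S k.castSucc.succ + (d + n) * S (Fin.last _) := by
    rw [Fin.sum_univ_castSucc]; simp
  have h2 : ∑ k : Fin (n + 1), ((d + (k : ℕ) : ℕ) : ℤ) * S k.castSucc
      = d * S 0 + ∑ k : Fin n, ((d + (k : ℕ) + 1 : ℕ) : ℤ) * S k.castSucc.succ := by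
    rw [Fin.sum_univ_succ]; simp [add_assoc]
  have h3 : ∑ k : Fin (n + 2), (if 0 < (k : ℕ) ∧ (k : ℕ) < n + 1 then S k else 0)
      = ∑ k : Fin n, S k.castSucc.succ := by
    rw [Fin.sum_univ_succ, Fin.sum_univ_castSucc]; simp
  simp only [mul_sub, Finset.sum_sub_distrib, h1, h2, h3]
  have : ∑ k : Fin n, ((d + (k : ℕ) + 1 : ℕ) : ℤ) * S k.castSucc.succ
      = ∑ k : Fin n, ((d + (k : ℕ) : ℕ) : ℤ) * S k.castSucc.succ + ∑ k : Fin n, S k.castSucc.succ := by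
    rw [← Finset.sum_add_distrib]
    refine Finset.sum_congr rfl fun k _ => ?_
    push_cast; ring
  rw [this]; ring

/-- The product of the transition weights is a constant multiple of the weight of a family. -/
theorem exists_chainWeight_one_eq {q : ℝ} (hq0 : q ≠ 0) (y : Fin d → ℤ) (x : Fin (d + N) → ℤ) :
    ∃ E : ℤ, ∀ w ∈ configs y x, chainWeight q (fun _ _ => 1) w = q ^ E * weight q w := by
  have hprod : ∀ w : Config d N, chainWeight q (fun _ _ => 1) w
      = q ^ (∑ k : Fin N, ((d + (k : ℕ) : ℕ) : ℤ) * ((∑ i, w k.succ i) - ∑ i, w k.castSucc i)) := by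
    intro w
    simp only [chainWeight, Finset.prod_const_one, mul_one]
    generalize (Finset.univ : Finset (Fin N)) = s
    induction s using Finset.cons_induction with
    | empty => simp
    | cons a s ha ih =>
      rw [Finset.prod_cons, Finset.sum_cons, zpow_add₀ hq0, ih, zpow_mul, zpow_natCast]
  cases N with
  | zero =>
    -- For `N = 0` the exponent of `q⁻¹` in the weight is `-(0 - 1) |ν^{(0)}|`, which this constant
    -- compensates.
    refine ⟨∑ i : Fin d, (y i + ((i : ℕ) + 1)), fun w hw => ?_⟩
    rw [hprod, weight]
    have h0 : nuSize w 0 = ∑ i : Fin d, (y i + ((i : ℕ) + 1)) :=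
      Finset.sum_congr rfl fun i _ => by rw [← hw.1 i]
    simp [h0, zpow_ne_zero _ hq0]
  | succ n =>
    set τ : Fin (n + 2) → ℤ := fun k => ∑ i : Fin (d + (k : ℕ)), (((i : ℕ) : ℤ) + 1) with hτ
    have hnu : ∀ (w : Config d (n + 1)) k, nuSize w k = (∑ i, w k i) + τ k := by
      intro w k
      rw [nuSize, Finset.sum_add_distrib]
    -- The boundary terms of the summation by parts, corrected by the fixed differences `τ` between
    -- `nuSize` and the row sums.
    refine ⟨((d + n) * ∑ i, x i) - d * (∑ i, y i) +
      ∑ k : Fin (n + 2), (if 0 < (k : ℕ) ∧ (k : ℕ) < n + 1 then τ k else 0)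
      - n * ((∑ i, y i) + τ 0), fun w hw => ?_⟩
    have hlast : ∑ i, w (Fin.last _) i = ∑ i, x i := Finset.sum_congr rfl fun i _ => hw.2.1 i
    have hfirst : ∑ i, w 0 i = ∑ i, y i := Finset.sum_congr rfl fun i _ => hw.1 i
    have key := sum_mul_sub_add_sum_inner d (fun k => ∑ i, w k i)
    simp only [hlast, hfirst] at key
    have hsplit : ∑ k : Fin (n + 2), (if 0 < (k : ℕ) ∧ (k : ℕ) < n + 1 then nuSize w k else 0)
        = ∑ k : Fin (n + 2), (if 0 < (k : ℕ) ∧ (k : ℕ) < n + 1 then ∑ i, w k i else 0)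
        + ∑ k : Fin (n + 2), (if 0 < (k : ℕ) ∧ (k : ℕ) < n + 1 then τ k else 0) := by
      rw [← Finset.sum_add_distrib]
      refine Finset.sum_congr rfl fun k _ => ?_
      split_ifs
      · exact hnu w k
      · rfl
    rw [hprod, weight, inv_zpow', ← zpow_add₀ hq0]
    congr 1
    rw [hsplit, hnu, hfirst]
    push_cast
    push_cast at key
    linear_combination key

theorem weight_pos {q : ℝ} (hq0 : 0 < q) (w : Config d N) : 0 < weight q w :=
  zpow_pos (inv_pos.2 hq0) _

theorem partitionFunction_pos {q : ℝ} (hq0 : 0 < q) {y : Fin d → ℤ} {x : Fin (d + N) → ℤ}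
    (hne : (configs y x).Nonempty) : 0 < partitionFunction y x q := by
  rw [partitionFunction, finsum_mem_eq_finite_toFinset_sum _ (configs_finite y x)]
  exact Finset.sum_pos (fun w _ => weight_pos hq0 w) ((configs_finite y x).toFinset_nonempty.2 hne)

/-- With trivial factors the determinant is a power of `q` times the partition function, which is
positive. -/
theorem topMat_det_ne_zero {q : ℝ} (hq0 : 0 < q) (hq1 : q < 1) {y : Fin d → ℤ} (hy : StrictAnti y)
    {x : Fin (d + N) → ℤ} (hx : StrictAnti x) (hne : (configs y x).Nonempty) :
    (topMat y x q).det ≠ 0 := by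
  set B : ℕ → ℕ → ℤ → ℝ := fun k l z => if h : l < d + N then entrance y q k ⟨l, h⟩ z else 0 with hB
  have hBe : ∀ k (l : Fin (d + N)) z, B k l z = entrance y q k l z := fun k l z => by simp [hB]
  have h := det_eq_finsum_chainWeight hq0.ne' hy (fun _ _ => 1) B
    (fun i z => by
      rw [show (i : ℕ) = (Fin.castAdd N i : ℕ) from rfl, hBe, entrance_zero hq0.ne' _ _ i.2,
        yFull_of_lt _ _ i.2]; rfl)
    (fun k hk i hi z => by
      have hi' : i < d + N := by omega
      simp only [hB, hi', dif_pos, mul_one]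
      exact entrance_succ hq0 hq1 y k _ hi z)
    (fun k hk z => by
      have hi' : d + k < d + N := by omega
      simp only [hB, hi', dif_pos]
      exact entrance_last hq0 hq1 y k _ rfl z) x hx
  simp only [hBe] at h
  rw [topMat, h]
  obtain ⟨E, hE⟩ := exists_chainWeight_one_eq hq0.ne' y x
  rw [finsum_mem_congr rfl hE, ← mul_finsum_mem]
  exact mul_ne_zero (zpow_ne_zero _ hq0.ne') (partitionFunction_pos hq0 hne).ne'

/-! ### Perturbation of the weights at finitely many points -/

section Points

variable {r : ℕ} (p : Fin r → ℕ × ℤ) (T : ℝ)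

/-- The factor `1 + T` at each of the points `p i`, and `1` elsewhere. -/
def pointFactor (k : ℕ) (z : ℤ) : ℝ := ∏ i, (1 + T * if p i = (k, z) then 1 else 0)

variable {p}

theorem pointFactor_eq (hp : Function.Injective p) (k : ℕ) (z : ℤ) :
    pointFactor p T k z = 1 + T * ∑ i, if p i = (k, z) then 1 else 0 := by
  by_cases h : ∃ i, p i = (k, z)
  · obtain ⟨i, hi⟩ := h
    have hi' : ∀ j, p j = (k, z) ↔ j = i := fun j => by rw [← hi, hp.eq_iff]
    simp only [pointFactor, hi']
    rw [Finset.prod_eq_single i (fun j _ hj => by simp [hj]) (by simp)]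
    simp
  · push Not at h
    simp [pointFactor, h]

/-- Propagation from the point `p i` to `(k, z)`, for levels `k` above that of `p i`. -/
def fromPoint (p : Fin r → ℕ × ℤ) (d : ℕ) (q : ℝ) (i : Fin r) (k : ℕ) (z : ℤ) : ℝ :=
  if (p i).1 < k then hq q (d + (p i).1) (k - (p i).1) (z - (p i).2) else 0

theorem fromPoint_add (q : ℝ) (i : Fin r) (k : ℕ) (z : ℤ) :
    fromPoint p d q i k z + (if p i = (k, z) then 1 else 0)
      = if (p i).1 ≤ k then hq q (d + (p i).1) (k - (p i).1) (z - (p i).2) else 0 := by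
  unfold fromPoint
  rcases lt_trichotomy (p i).1 k with h | h | h
  · rw [if_pos h, if_pos h.le, if_neg (fun h' => by rw [h'] at h; exact lt_irrefl _ h), add_zero]
  · rw [if_neg h.not_lt, if_pos h.le, h, Nat.sub_self, hq_no_vars, zero_add]
    have : p i = (k, z) ↔ z - (p i).2 = 0 := by
      rw [Prod.ext_iff, sub_eq_zero]
      exact ⟨fun h' => h'.2.symm, fun h' => ⟨h, h'.symm⟩⟩
    simp only [this]
  · rw [if_neg h.not_gt, if_neg h.not_ge, if_neg (fun h' => by rw [h'] at h; exact lt_irrefl _ h),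
      add_zero]

/-- The propagator obeys the recurrence of the entrance functions with an additional unit source at
the point `p i`. -/
theorem fromPoint_succ (q : ℝ) (i : Fin r) (k : ℕ) (z : ℤ) :
    fromPoint p d q i (k + 1) z = fromPoint p d q i k z + (if p i = (k, z) then 1 else 0)
      + q ^ (d + k) * fromPoint p d q i (k + 1) (z - 1) := by
  rw [fromPoint_add, fromPoint, fromPoint]
  by_cases h : (p i).1 ≤ k
  · rw [if_pos (by omega), if_pos h, if_pos (by omega),
      show k + 1 - (p i).1 = k - (p i).1 + 1 by omega, hq_succ,
      show d + (p i).1 + (k - (p i).1) = d + k by omega]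
    congr 3
    ring
  · rw [if_neg (by omega), if_neg h, if_neg (by omega)]; simp

/-- Ordered by level, `Φ` is strictly block triangular, so each diagonal block of `1 - T • Φ` is an
identity. -/
theorem det_one_sub_smul_levels (Φ : Matrix (Fin r) (Fin r) ℝ)
    (hΦ : ∀ i j, (p j).1 ≤ (p i).1 → Φ i j = 0) : (1 - T • Φ).det = 1 := by
  have hb : Matrix.BlockTriangular (1 - T • Φ) fun i => (p i).1 := by
    intro i j hij
    simp only at hij
    have : i ≠ j := fun h => by subst h; exact lt_irrefl _ hij
    simp [Matrix.one_apply_ne this, hΦ i j hij.le]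
  rw [hb.det]
  refine Finset.prod_eq_one fun a _ => ?_
  have : (1 - T • Φ).toSquareBlock (fun i => (p i).1) a = 1 := by
    ext ⟨i, hi⟩ ⟨j, hj⟩
    simp only [Matrix.toSquareBlock_def, Matrix.of_apply, Matrix.sub_apply, Matrix.smul_apply]
    rw [hΦ i j (by rw [hi, hj])]
    simp [Matrix.one_apply]
  rw [this, Matrix.det_one]

/-- The determinant of a perturbation of `A` along finitely many points. -/
theorem det_add_smul_mul {D : ℕ} (A : Matrix (Fin D) (Fin D) ℝ) (hA : A.det ≠ 0)
    (a c : Matrix (Fin D) (Fin r) ℝ) (Ψ : Matrix (Fin r) (Fin D) ℝ) (Φ : Matrix (Fin r) (Fin r) ℝ)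
    (hΦ : (1 - T • Φ).det = 1) (hc : c * (1 - T • Φ) = a) :
    (A + T • (c * Ψ)).det = A.det * (1 + T • (-Φ + Ψ * A⁻¹ * a)).det := by
  have hu : IsUnit A.det := isUnit_iff_ne_zero.2 hA
  have h1 : A + T • (c * Ψ) = A * (1 + (T • (A⁻¹ * c)) * Ψ) := by
    rw [mul_add, mul_one, Matrix.smul_mul, Matrix.mul_smul, Matrix.mul_assoc A⁻¹,
      Matrix.mul_nonsing_inv_cancel_left _ _ hu]
  -- The factor `1 - T • Φ` of determinant one trades the self-consistent `c` for the explicit `a`;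
  -- the extra term is `-Φ`.
  have h2 : (1 + Ψ * (T • (A⁻¹ * c))) * (1 - T • Φ) = 1 + T • (-Φ + Ψ * A⁻¹ * a) := by
    rw [add_mul, one_mul, ← hc, Matrix.mul_smul, Matrix.smul_mul, ← Matrix.mul_assoc Ψ A⁻¹ c,
      Matrix.mul_assoc (Ψ * A⁻¹) c, smul_add, smul_neg]
    abel
  rw [h1, Matrix.det_mul, Matrix.det_one_add_mul_comm, ← h2, Matrix.det_mul, hΦ, mul_one]

end Points

theorem configs_row_strictAnti {y : Fin d → ℤ} {x : Fin (d + N) → ℤ} (hx : StrictAnti x)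
    {w : Config d N} (hw : w ∈ configs y x) (k : Fin (N + 1)) : StrictAnti (w k) := by
  induction k using Fin.reverseInduction with
  | last =>
    intro i j hij
    have h : x j < x i := hx hij
    rwa [← hw.2.1, ← hw.2.1] at h
  | cast k ih =>
    intro i j hij
    have h1 := (hw.2.2 k i).1
    have h2 := (hw.2.2 k j).2
    refine h2.trans_lt (lt_of_le_of_lt (ih.antitone ?_) h1)
    exact Fin.mk_le_mk.2 (Fin.lt_def.1 hij)

open Classical in
theorem prod_pointFactor {r : ℕ} {p : Fin r → ℕ × ℤ} (T : ℝ) (w : Config d N)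
    (hw : ∀ k, Function.Injective (w k)) :
    ∏ k : Fin (N + 1), ∏ i, pointFactor p T k (w k i)
      = ∏ j, (1 + T * if HasDot w (p j) then 1 else 0) := by
  simp only [pointFactor]
  have : ∀ k : Fin (N + 1), ∏ i, ∏ j, (1 + T * if p j = ((k : ℕ), w k i) then (1 : ℝ) else 0)
      = ∏ j, ∏ i, (1 + T * if p j = ((k : ℕ), w k i) then (1 : ℝ) else 0) :=
    fun k => Finset.prod_comm
  rw [Finset.prod_congr rfl fun k _ => this k, Finset.prod_comm]
  refine Finset.prod_congr rfl fun j _ => ?_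
  split_ifs with h
  · obtain ⟨hk, i, hi⟩ := h
    rw [Finset.prod_eq_single ⟨(p j).1, hk⟩, Finset.prod_eq_single i]
    · have h' : p j = ((p j).1, w ⟨(p j).1, hk⟩ i) := Prod.ext rfl hi.symm
      rw [if_pos h']
    · intro i' _ hne
      rw [if_neg, mul_zero, add_zero]
      intro h'
      apply hne
      apply hw ⟨(p j).1, hk⟩
      rw [hi]
      exact (Prod.ext_iff.1 h').2.symm
    · simp
    · intro k _ hne
      refine Finset.prod_eq_one fun i' _ => ?_
      rw [if_neg, mul_zero, add_zero]
      intro h'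
      exact hne (Fin.ext (Prod.ext_iff.1 h').1.symm)
    · simp
  · refine (Finset.prod_eq_one fun k _ => Finset.prod_eq_one fun i _ => ?_).trans (by simp)
    rw [if_neg, mul_zero, add_zero]
    intro h'
    refine h ?_
    rw [h']
    exact ⟨k.2, i, rfl⟩

theorem chainWeight_mul (q : ℝ) (G : ℕ → ℤ → ℝ) (w : Config d N) :
    chainWeight q G w * ∏ i, G N (w (Fin.last N) i)
      = chainWeight q (fun _ _ => 1) w * ∏ k : Fin (N + 1), ∏ i, G k (w k i) := by
  rw [Fin.prod_univ_castSucc, ← mul_assoc]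
  congr 1
  simp only [chainWeight, Finset.prod_mul_distrib, Finset.prod_const_one, mul_one]
  rfl

open Classical in
/-- The generating function of the dots at finitely many points. -/
theorem finsum_chainWeight_mul_prod {q : ℝ} (hq0 : 0 < q) (hq1 : q < 1) {y : Fin d → ℤ}
    (hy : StrictAnti y) {x : Fin (d + N) → ℤ} (hx : StrictAnti x)
    (hA : (topMat y x q).det ≠ 0) (hH : (Hmat y x q).det ≠ 0)
    {r : ℕ} {p : Fin r → ℕ × ℤ} (hp : Function.Injective p) (hpN : ∀ i, (p i).1 ≤ N) (T : ℝ) :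
    ∑ᶠ w ∈ configs y x, chainWeight q (fun _ _ => 1) w
        * ∏ j, (1 + T * if HasDot w (p j) then 1 else 0)
      = (topMat y x q).det * (1 + T • Matrix.of fun i j =>
          Kq y x q (p i).1 (p i).2 (p j).1 (p j).2).det := by
  set Φ : Matrix (Fin r) (Fin r) ℝ := Matrix.of fun i j => fromPoint p d q i (p j).1 (p j).2 with hΦ
  set a : Matrix (Fin (d + N)) (Fin r) ℝ := Matrix.of fun l j => entrance y q (p j).1 l (p j).2
    with ha
  set Ψ : Matrix (Fin r) (Fin (d + N)) ℝ :=
    Matrix.of fun i j => hq q (d + (p i).1) (N - (p i).1) (x j - (p i).2) with hΨ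
  have hdet : (1 - T • Φ).det = 1 := det_one_sub_smul_levels (p := p) T Φ fun i j hij => by
    simp [hΦ, fromPoint, hij.not_gt]
  -- The entry `c l j` is the value at `p j` of the perturbed entrance function `B`: the relation `c
  -- = a + T c Φ` says that each point emits `T` times the amplitude that arrives there.
  set c : Matrix (Fin (d + N)) (Fin r) ℝ := a * (1 - T • Φ)⁻¹ with hcdef
  have hc : c * (1 - T • Φ) = a := by
    rw [hcdef, Matrix.nonsing_inv_mul_cancel_right _ _ (by rw [hdet]; exact isUnit_one)]
  have hc' : ∀ l j, c l j = a l j + T * ∑ i, c l i * Φ i j := by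
    intro l j
    have := congrFun (congrFun hc l) j
    rw [Matrix.mul_sub, Matrix.mul_one, Matrix.mul_smul] at this
    simp only [Matrix.sub_apply, Matrix.smul_apply, Matrix.mul_apply, smul_eq_mul] at this
    linarith
  -- A virtual particle that enters at level `k + 1` meets no point at level `k` or below, so its
  -- initial function stays geometric.
  have hc0 : ∀ n, ∀ (l : Fin (d + N)) j, (p j).1 = n → d + n ≤ (l : ℕ) → c l j = 0 := by
    intro n
    induction n using Nat.strong_induction_on with
    | _ n ih =>
      intro l j hj hl
      rw [hc', ha, Matrix.of_apply, entrance_of_ge _ _ _ (by omega), zero_add,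
        Finset.sum_eq_zero, mul_zero]
      intro i _
      by_cases h : (p i).1 < n
      · rw [ih _ h l i rfl (by omega), zero_mul]
      · simp [hΦ, fromPoint, hj, h]
  set B : ℕ → ℕ → ℤ → ℝ := fun k l z => if h : l < d + N then
    entrance y q k ⟨l, h⟩ z + T * ∑ i, c ⟨l, h⟩ i * fromPoint p d q i k z else 0 with hB
  have hBe : ∀ k (l : Fin (d + N)) z,
      B k l z = entrance y q k l z + T * ∑ i, c l i * fromPoint p d q i k z :=
    fun k l z => by simp [hB]
  have hBp : ∀ (l : Fin (d + N)) j, B (p j).1 l (p j).2 = c l j := fun l j => by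
    rw [hBe, hc' l j]; rfl
  -- Multiplication by the point factor adds exactly the sources of `fromPoint_succ`.
  have hBG : ∀ k (l : Fin (d + N)) z, B k l z * pointFactor p T k z = entrance y q k l z
      + T * ∑ i, c l i * (fromPoint p d q i k z + if p i = (k, z) then 1 else 0) := by
    intro k l z
    rw [pointFactor_eq T hp, mul_add, mul_one]
    have : B k l z * (T * ∑ i, if p i = (k, z) then (1 : ℝ) else 0)
        = T * ∑ i, c l i * (if p i = (k, z) then (1 : ℝ) else 0) := by
      rw [mul_left_comm, Finset.mul_sum]
      congr 1
      refine Finset.sum_congr rfl fun i _ => ?_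
      split_ifs with h
      · rw [← hBp, h]
      · simp
    rw [this, hBe]
    simp only [mul_add, Finset.sum_add_distrib]
    ring
  have h := det_eq_finsum_chainWeight hq0.ne' hy (pointFactor p T) B
    (fun i z => by
      rw [show (i : ℕ) = (Fin.castAdd N i : ℕ) from rfl, hBe, entrance_zero hq0.ne' _ _ i.2,
        yFull_of_lt _ _ i.2]
      simp [fromPoint])
    (fun k hk i hi z => by
      obtain ⟨l, rfl⟩ : ∃ l : Fin (d + N), (l : ℕ) = i := ⟨⟨i, by omega⟩, rfl⟩
      rw [hBG, hBe, hBe, entrance_succ hq0 hq1 y k _ hi z]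
      simp only [fromPoint_succ (p := p) (d := d) q _ k z, mul_add, Finset.mul_sum,
        Finset.sum_add_distrib]
      have : ∀ i', c l i' * (q ^ (d + k) * fromPoint p d q i' (k + 1) (z - 1))
        = q ^ (d + k) * (c l i' * fromPoint p d q i' (k + 1) (z - 1)) := fun i' => by ring
      simp only [this, ← Finset.mul_sum]
      ring)
    (fun k hk z => by
      have hi' : d + k < d + N := by omega
      rw [show d + k = ((⟨d + k, hi'⟩ : Fin (d + N)) : ℕ) from rfl, hBe,
        entrance_last hq0 hq1 y k _ rfl z, Finset.sum_eq_zero, mul_zero, add_zero]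
      intro i _
      by_cases h : (p i).1 ≤ k
      · rw [hc0 _ _ i rfl (by simpa using h), zero_mul]
      · rw [fromPoint, if_neg (by omega), mul_zero]) x hx
  -- Points on level `N` are not covered by `chainWeight`; their factors multiply the columns of the
  -- top matrix.
  have h2 : (topMat y x q + T • (c * Ψ)) = Matrix.of fun l j =>
      pointFactor p T N (x j) * (Matrix.of fun l j : Fin (d + N) => B N l (x j)) l j := by
    ext l j
    rw [Matrix.of_apply, Matrix.of_apply, mul_comm, hBG]
    simp only [fromPoint_add, hpN, if_true]
    simp [topMat, hΨ, Matrix.mul_apply]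
  have h3 := det_add_smul_mul T (topMat y x q) hA a c Ψ Φ hdet hc
  have hK : (-Φ + Ψ * (topMat y x q)⁻¹ * a) = Matrix.of fun i j =>
      Kq y x q (p i).1 (p i).2 (p j).1 (p j).2 := by
    ext i j
    rw [Matrix.of_apply, Kq_eq hq0 hq1 y x hH, Matrix.mul_assoc]
    rfl
  rw [← hK, ← h3, h2, Matrix.det_mul_row, h, mul_finsum_mem]
  refine finsum_mem_congr rfl fun w hw => ?_
  have hw' : ∏ i, pointFactor p T N (x i) = ∏ i, pointFactor p T N (w (Fin.last N) i) :=
    Finset.prod_congr rfl fun i _ => by rw [← hw.2.1 i]; rfl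
  rw [hw']
  refine Eq.trans ?_ ((chainWeight_mul q (pointFactor p T) w).symm.trans (mul_comm _ _))
  rw [prod_pointFactor T w fun k => (configs_row_strictAnti hx hw k).injective]

/-- The generating function gives the expectation of `∏ (1 + T 1_{dot})` as `det (1 + T K)`. With `T
= ε⁻¹`, after multiplication by `ε^r`, the value at `ε = 0` is the joint probability. -/
theorem isCorrelationKernel_Kq {q : ℝ} (hq0 : 0 < q) (hq1 : q < 1) {y : Fin d → ℤ}
    (hy : StrictAnti y) {x : Fin (d + N) → ℤ} (hx : StrictAnti x) (hne : (configs y x).Nonempty)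
    (hH : (Hmat y x q).det ≠ 0) : IsCorrelationKernel y x q (Kq y x q) := by
  classical
  intro r p hp hpN
  have hA := topMat_det_ne_zero hq0 hq1 hy hx hne
  obtain ⟨E, hE⟩ := exists_chainWeight_one_eq hq0.ne' y x
  have hqE : q ^ E ≠ 0 := zpow_ne_zero _ hq0.ne'
  have hZ := (partitionFunction_pos hq0 hne).ne'
  -- The case `T = 0` identifies the normalization.
  have hA' : (topMat y x q).det = q ^ E * partitionFunction y x q := by
    have := finsum_chainWeight_mul_prod hq0 hq1 hy hx hA hH hp hpN 0
    simp only [zero_mul, add_zero, Finset.prod_const_one, mul_one, zero_smul, Matrix.det_one] at this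
    rw [← this, finsum_mem_congr rfl hE, ← mul_finsum_mem, partitionFunction]
  set K := Matrix.of fun i j => Kq y x q (p i).1 (p i).2 (p j).1 (p j).2 with hK
  set s := (configs_finite y x).toFinset
  have gen : ∀ ε : ℝ, ε ≠ 0 → ∑ w ∈ s, weight q w / partitionFunction y x q *
      ∏ j, (ε + if HasDot w (p j) then 1 else 0) = (ε • (1 : Matrix (Fin r) (Fin r) ℝ) + K).det := by
    intro ε hε
    have h := finsum_chainWeight_mul_prod hq0 hq1 hy hx hA hH hp hpN ε⁻¹
    rw [finsum_mem_eq_finite_toFinset_sum _ (configs_finite y x), hA'] at h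
    have e1 : ε • (1 : Matrix (Fin r) (Fin r) ℝ) + K = ε • (1 + ε⁻¹ • K) := by
      rw [smul_add, smul_smul, mul_inv_cancel₀ hε, one_smul]
    rw [e1, Matrix.det_smul, Fintype.card_fin]
    have h' : (1 + ε⁻¹ • K).det = (q ^ E * partitionFunction y x q)⁻¹ *
        (q ^ E * partitionFunction y x q * (1 + ε⁻¹ • K).det) := by
      rw [inv_mul_cancel_left₀ (mul_ne_zero hqE hZ)]
    rw [h', ← h, Finset.mul_sum, Finset.mul_sum]
    refine Finset.sum_congr rfl fun w hw => ?_
    have e2 : ∏ j : Fin r, (ε + if HasDot w (p j) then 1 else 0)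
        = ε ^ r * ∏ j : Fin r, (1 + ε⁻¹ * if HasDot w (p j) then 1 else 0) := by
      rw [← Fin.prod_const, ← Finset.prod_mul_distrib]
      refine Finset.prod_congr rfl fun j _ => ?_
      rw [mul_add, mul_one, mul_inv_cancel_left₀ hε]
    rw [hE w ((configs_finite y x).mem_toFinset.1 hw), e2]
    generalize ∏ j : Fin r, (1 + ε⁻¹ * if HasDot w (p j) then 1 else 0) = P
    field_simp
  -- Both sides are continuous in `ε` and agree off the origin, hence also at `ε = 0`.
  have hext := Continuous.ext_on (dense_compl_singleton (0 : ℝ))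
    (f := fun ε : ℝ => ∑ w ∈ s, weight q w / partitionFunction y x q *
      ∏ j, (ε + if HasDot w (p j) then 1 else 0))
    (g := fun ε : ℝ => (ε • (1 : Matrix (Fin r) (Fin r) ℝ) + K).det)
    (by fun_prop) (by fun_prop) (fun ε hε => gen ε hε)
  have h0 := congrFun hext 0
  simp only [zero_add, zero_smul] at h0
  rw [← h0]
  have : ∀ w ∈ {w : Config d N | ∀ i, HasDot w (p i)}, Pq y x q w
      = if w ∈ configs y x then weight q w / partitionFunction y x q *
        ∏ j, (if HasDot w (p j) then 1 else 0) else 0 := by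
    intro w hw
    have hw' : ∀ i, HasDot w (p i) := hw
    simp [Pq, hw']
  -- The set of families with the given dots need not be finite, but `Pq` vanishes outside
  -- `configs`.
  rw [finsum_mem_congr rfl this, finsum_mem_eq_sum_of_inter_support_eq (t := s)]
  · refine Finset.sum_congr rfl fun w hw => ?_
    rw [if_pos ((configs_finite y x).mem_toFinset.1 hw)]
  · ext w
    simp only [Set.mem_inter_iff, Set.mem_ofPred_eq, Function.mem_support, ne_eq,
      ite_eq_right_iff, Classical.not_imp, Finset.mem_coe]
    constructor
    · rintro ⟨-, h, h'⟩
      exact ⟨(configs_finite y x).mem_toFinset.2 h, h, h'⟩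
    · rintro ⟨-, h, h'⟩
      refine ⟨fun i => ?_, h, h'⟩
      by_contra hcon
      exact h' (by rw [Finset.prod_eq_zero (Finset.mem_univ i) (if_neg hcon), mul_zero])

/-! ### Invertibility of `H` -/

/-- The polynomial with value `(q^{x+b+1}; q)_M / (q; q)_M` at `q^x`. -/
def ratioPoly (q : ℝ) (M : ℕ) (b : ℤ) : Polynomial ℝ :=
  ∏ j ∈ Finset.range M, (Polynomial.C (1 - q ^ (j + 1))⁻¹
    * (1 - Polynomial.C (q ^ (b + 1 + j)) * Polynomial.X))

theorem natDegree_ratioPoly_le (q : ℝ) (M : ℕ) (b : ℤ) : (ratioPoly q M b).natDegree ≤ M := by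
  refine (Polynomial.natDegree_prod_le _ _).trans ?_
  refine (Finset.sum_le_card_nsmul _ _ 1 fun j _ => ?_).trans (by simp)
  compute_degree

theorem eval_ratioPoly {q : ℝ} (hq0 : q ≠ 0) (M : ℕ) (b x : ℤ) :
    (ratioPoly q M b).eval (q ^ x) = qRatio q M (x + b) := by
  rw [ratioPoly, Polynomial.eval_prod, qRatio]
  refine Finset.prod_congr rfl fun j _ => ?_
  rw [Polynomial.eval_mul, Polynomial.eval_C, Polynomial.eval_sub, Polynomial.eval_one,
    Polynomial.eval_mul, Polynomial.eval_C, Polynomial.eval_X, ← zpow_add₀ hq0, div_eq_inv_mul]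
  congr 3
  ring

theorem det_qRatio_sub_eq_one {q : ℝ} (hq0 : 0 < q) (hq1 : q < 1) (M : ℕ) :
    (Matrix.of fun i i' : Fin (M + 1) => qRatio q M ((i' : ℤ) - (i : ℤ))).det = 1 := by
  rw [Matrix.det_of_isUpperTriangular]
  · refine Finset.prod_eq_one fun i _ => ?_
    simp [qRatio_zero_right hq0 hq1]
  · intro i i' h
    simp only [id] at h
    rw [Matrix.of_apply, qRatio_of_neg]
    · have := i.2; omega
    · have : (i' : ℕ) < i := h
      omega

/-- In the columns that belong to `y_{d+i}`, the bound on `x` makes the entries of `H` a power of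
`q^d` times a polynomial of degree at most `M` in `q^{x_j}`. They are therefore combinations of the
virtual rows of `A`, and a null vector of `H` produces one of `A`. -/
theorem Hmat_det_ne_zero_succ {M : ℕ} {q : ℝ} (hq0 : 0 < q) (hq1 : q < 1) (y : Fin d → ℤ)
    (x : Fin (d + (M + 1)) → ℤ) (hleft : ∀ i, -(d : ℤ) - (M + 1) ≤ x i)
    (hA : (topMat y x q).det ≠ 0) : (Hmat y x q).det ≠ 0 := by
  intro hdet
  obtain ⟨c, hc, hHc⟩ := Matrix.exists_mulVec_eq_zero_iff.2 hdet
  apply hc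
  set p : Polynomial ℝ := ∑ i : Fin (M + 1),
    Polynomial.C (c (Fin.natAdd d i) * (q ^ d) ^ ((d : ℤ) + (i : ℕ) + 1))
      * ratioPoly q M ((d : ℤ) + (i : ℕ) + 1) with hp
  have hpdeg : p.natDegree < M + 1 := by
    refine Nat.lt_succ_of_le (Polynomial.natDegree_sum_le_of_forall_le _ _ fun i _ => ?_)
    exact (Polynomial.natDegree_C_mul_le _ _).trans (natDegree_ratioPoly_le _ _ _)
  -- The factor `qFact` undoes the normalization of the virtual entrance functions.
  set c' : Fin (d + (M + 1)) → ℝ := Fin.append (fun l => c (Fin.castAdd _ l))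
    (fun i => p.coeff i * qFact q (d + (M + 1) - (d + i + 1))) with hc'
  have key : Matrix.vecMul c' (topMat y x q) = 0 := by
    funext j
    have hj := congrFun hHc j
    simp only [Matrix.mulVec, dotProduct, Pi.zero_apply] at hj
    simp only [Matrix.vecMul, dotProduct, Pi.zero_apply]
    rw [← hj, Fin.sum_univ_add (a := d) (b := M + 1), Fin.sum_univ_add (a := d) (b := M + 1)]
    congr 1
    · refine Finset.sum_congr rfl fun l _ => ?_
      rw [hc', Fin.append_left, topMat, Matrix.of_apply, entrance_of_lt hq0.ne' _ _ _ l.2, mul_comm]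
      rfl
    · have e1 : ∀ i : Fin (M + 1), c' (Fin.natAdd d i) * topMat y x q (Fin.natAdd d i) j
          = (q ^ d) ^ x j * (p.coeff i * (q ^ x j) ^ (i : ℕ)) := by
        intro i
        rw [hc', Fin.append_right, topMat, Matrix.of_apply,
          entrance_of_ge_of_lt hq0 hq1 _ _ _ (by simp) (by simp only [Fin.val_natAdd]; omega), Fin.val_natAdd]
        have hF := (qFact_pos hq0 hq1 (d + (M + 1) - (d + i + 1))).ne'
        rw [pow_add, mul_zpow, ← zpow_natCast (q ^ x j) i, ← zpow_mul, mul_comm (x j), zpow_mul,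
          zpow_natCast]
        field_simp
      rw [Finset.sum_congr rfl fun i _ => e1 i, ← Finset.mul_sum,
        Fin.sum_univ_eq_sum_range (fun i => p.coeff i * (q ^ x j) ^ i) (M + 1),
        ← Polynomial.eval_eq_sum_range' hpdeg, hp, Polynomial.eval_finsetSum, Finset.mul_sum]
      refine Finset.sum_congr rfl fun i _ => ?_
      rw [Polynomial.eval_mul, Polynomial.eval_C, eval_ratioPoly hq0.ne', Hmat, Matrix.of_apply,
        yFull_natAdd, hq_eq_qRatio hq0 hq1 _ _ _ (by have := hleft j; omega),
        show x j - (-(d : ℤ) - ((i : ℕ) + 1)) = x j + ((d : ℤ) + (i : ℕ) + 1) by ring,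
        zpow_add₀ (pow_ne_zero _ hq0.ne') (x j)]
      ring
  have hc'0 : c' = 0 := Matrix.eq_zero_of_vecMul_eq_zero hA key
  have hp0 : p = 0 := by
    ext i
    rw [Polynomial.coeff_zero]
    rcases lt_or_ge i (M + 1) with hi | hi
    · have := congrFun hc'0 (Fin.natAdd d ⟨i, hi⟩)
      rw [hc', Fin.append_right, Pi.zero_apply] at this
      exact (mul_eq_zero.1 this).resolve_right (qFact_pos hq0 hq1 _).ne'
    · exact Polynomial.coeff_eq_zero_of_natDegree_lt (by omega)
  -- Evaluating the vanishing polynomial `p` at `q^{-d-i-1}` gives a unitriangular system for the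
  -- coefficients.
  have hv : (fun i : Fin (M + 1) => c (Fin.natAdd d i) * (q ^ d) ^ ((d : ℤ) + (i : ℕ) + 1)) = 0 := by
    refine Matrix.eq_zero_of_mulVec_eq_zero
      (M := Matrix.of fun i i' : Fin (M + 1) => qRatio q M ((i' : ℤ) - (i : ℤ))) ?_ ?_
    · rw [det_qRatio_sub_eq_one hq0 hq1]; exact one_ne_zero
    · funext i
      have := congrArg (Polynomial.eval (q ^ (-(d : ℤ) - (i : ℕ) - 1))) hp0
      rw [hp, Polynomial.eval_finsetSum, Polynomial.eval_zero] at this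
      rw [Pi.zero_apply, ← this, Matrix.mulVec, dotProduct]
      refine Finset.sum_congr rfl fun i' _ => ?_
      rw [Polynomial.eval_mul, Polynomial.eval_C, eval_ratioPoly hq0.ne', Matrix.of_apply, mul_comm]
      congr 2
      ring
  funext l
  induction l using Fin.addCases with
  | left l =>
    have := congrFun hc'0 (Fin.castAdd _ l)
    rwa [hc', Fin.append_left] at this
  | right i =>
    exact (mul_eq_zero.1 (congrFun hv i)).resolve_right (zpow_ne_zero _ (pow_ne_zero _ hq0.ne'))

theorem neg_le_of_hleft {x : Fin (d + N) → ℤ} (hx : StrictAnti x)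
    (hleft : ∀ i : Fin (d + N), (i : ℕ) + 1 = d + N → x i = -(d : ℤ) - N) (i : Fin (d + N)) :
    -(d : ℤ) - N ≤ x i := by
  have hpos : 0 < d + N := i.pos
  have h := hleft ⟨d + N - 1, by omega⟩ (by simp only; omega)
  rw [← h]
  exact hx.antitone (Fin.le_def.2 (by have := i.2; simp only; omega))

theorem eq_zero_of_spread {y : Fin d → ℤ} (hspread : ∀ i j, y i - y j ≤ ((0 : ℕ) : ℤ) - 1) : d = 0 := by
  by_contra h
  have := hspread ⟨0, by omega⟩ ⟨0, by omega⟩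
  simp at this

/-- For `N = 0` the spread condition with `i = j` leaves only `d = 0`, and `H` is empty. -/
theorem Hmat_det_ne_zero {q : ℝ} (hq0 : 0 < q) (hq1 : q < 1) {y : Fin d → ℤ}
    {x : Fin (d + N) → ℤ} (hx : StrictAnti x)
    (hspread : ∀ i j, y i - y j ≤ (N : ℤ) - 1)
    (hleft : ∀ i : Fin (d + N), (i : ℕ) + 1 = d + N → x i = -(d : ℤ) - N)
    (hA : (topMat y x q).det ≠ 0) : (Hmat y x q).det ≠ 0 := by
  cases N with
  | zero =>
    obtain rfl := eq_zero_of_spread hspread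
    rw [Matrix.det_eq_one_of_card_eq_zero (by simp)]
    exact one_ne_zero
  | succ M =>
    refine Hmat_det_ne_zero_succ hq0 hq1 y x (fun i => ?_) hA
    have := neg_le_of_hleft hx hleft i
    push_cast at this
    exact this

/-! ### Contour integrals of rational functions -/

namespace Contour

variable (γ : Contour)

theorem mem_trace {t : ℝ} (ht : t ∈ Set.Icc (0 : ℝ) 1) : γ.toFun t ∈ γ.trace := ⟨t, ht, rfl⟩

theorem intervalIntegrable {f : ℂ → ℂ} (hf : ContinuousOn f γ.trace) :
    IntervalIntegrable (fun t => f (γ.toFun t) * deriv γ.toFun t) MeasureTheory.volume 0 1 := by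
  refine γ.integrable.continuousOn_mul ?_
  rw [Set.uIcc_of_le zero_le_one]
  exact hf.comp γ.continuousOn fun t ht => γ.mem_trace ht

theorem integral_congr {f g : ℂ → ℂ} (h : ∀ z ∈ γ.trace, f z = g z) :
    γ.integral f = γ.integral g := by
  unfold Contour.integral
  congr 1
  refine intervalIntegral.integral_congr fun t ht => ?_
  rw [Set.uIcc_of_le zero_le_one] at ht
  simp only [h _ (γ.mem_trace ht)]

theorem integral_const_mul (c : ℂ) (f : ℂ → ℂ) :
    γ.integral (fun z => c * f z) = c * γ.integral f := by
  unfold Contour.integral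
  simp only [mul_assoc c, intervalIntegral.integral_const_mul]
  ring

theorem integral_add {f g : ℂ → ℂ} (hf : ContinuousOn f γ.trace) (hg : ContinuousOn g γ.trace) :
    γ.integral (fun z => f z + g z) = γ.integral f + γ.integral g := by
  unfold Contour.integral
  simp only [add_mul]
  rw [intervalIntegral.integral_add (γ.intervalIntegrable hf) (γ.intervalIntegrable hg), mul_add]

theorem integral_sub {f g : ℂ → ℂ} (hf : ContinuousOn f γ.trace) (hg : ContinuousOn g γ.trace) :
    γ.integral (fun z => f z - g z) = γ.integral f - γ.integral g := by
  unfold Contour.integral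
  simp only [sub_mul]
  rw [intervalIntegral.integral_sub (γ.intervalIntegrable hf) (γ.intervalIntegrable hg), mul_sub]

theorem integral_sum {ι : Type*} (s : Finset ι) {f : ι → ℂ → ℂ}
    (hf : ∀ i ∈ s, ContinuousOn (f i) γ.trace) :
    γ.integral (fun z => ∑ i ∈ s, f i z) = ∑ i ∈ s, γ.integral (f i) := by
  unfold Contour.integral
  simp only [Finset.sum_mul]
  rw [intervalIntegral.integral_finsetSum fun i hi => γ.intervalIntegrable (hf i hi), Finset.mul_sum]

/-- The fundamental theorem of calculus along a closed curve; the finitely many corners do not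
matter. -/
theorem integral_eq_zero_of_hasDerivAt {F f : ℂ → ℂ} (hF : ∀ z ∈ γ.trace, HasDerivAt F (f z) z)
    (hf : ContinuousOn f γ.trace) : γ.integral f = 0 := by
  obtain ⟨S, hS⟩ := γ.differentiable
  have hFc : ContinuousOn F γ.trace := fun z hz => (hF z hz).continuousAt.continuousWithinAt
  have h := MeasureTheory.integral_eq_of_hasDerivAt_off_countable_of_le
    (fun t => F (γ.toFun t)) (fun t => f (γ.toFun t) * deriv γ.toFun t) (a := 0) (b := 1)
    zero_le_one (s := (S : Set ℝ)) S.countable_toSet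
    (hFc.comp γ.continuousOn fun t ht => γ.mem_trace ht)
    (fun t ht => (hF _ (γ.mem_trace ⟨ht.1.1.le, ht.1.2.le⟩)).comp t
      (hS t ht.1 ht.2).hasDerivAt) (γ.intervalIntegrable hf)
  rw [Contour.integral, h, γ.closed, sub_self, mul_zero]

theorem integral_zpow_sub {e : ℂ} (he : e ∉ γ.trace) {n : ℤ} (hn : n ≠ -1) :
    γ.integral (fun z => (z - e) ^ n) = 0 := by
  have hne : ∀ z ∈ γ.trace, z - e ≠ 0 := fun z hz h => he (by rwa [← sub_eq_zero.1 h])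
  have hn' : (n : ℂ) + 1 ≠ 0 := by exact_mod_cast fun h => hn (by omega)
  refine γ.integral_eq_zero_of_hasDerivAt (F := fun z => ((n : ℂ) + 1)⁻¹ * (z - e) ^ (n + 1)) ?_ ?_
  · intro z hz
    have h := ((hasDerivAt_zpow (n + 1) (z - e) (Or.inl (hne z hz))).comp z
      ((hasDerivAt_id z).sub_const e)).const_mul ((n : ℂ) + 1)⁻¹
    refine h.congr_deriv ?_
    push_cast
    rw [add_sub_cancel_right, mul_one, inv_mul_cancel_left₀ hn']
  · exact fun z hz => ((continuousAt_id.sub continuousAt_const).zpow₀ n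
      (Or.inl (hne z hz))).continuousWithinAt

theorem continuousOn_inv_sub {e : ℂ} (he : e ∉ γ.trace) :
    ContinuousOn (fun z => (z - e)⁻¹) γ.trace := by
  refine ContinuousOn.inv₀ (by fun_prop) fun z hz h => he ?_
  rwa [← sub_eq_zero.1 h]

theorem integral_eval (p : Polynomial ℂ) : γ.integral (fun z => p.eval z) = 0 := by
  simp only [Polynomial.eval_eq_sum_range]
  rw [γ.integral_sum _ fun i _ => by fun_prop]
  refine Finset.sum_eq_zero fun i _ => ?_
  rw [γ.integral_const_mul, γ.integral_eq_zero_of_hasDerivAt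
    (F := fun z => ((i : ℂ) + 1)⁻¹ * z ^ (i + 1)) (fun z _ => ?_) (by fun_prop), mul_zero]
  have h := (hasDerivAt_pow (i + 1) z).const_mul ((i : ℂ) + 1)⁻¹
  refine h.congr_deriv ?_
  have : (i : ℂ) + 1 ≠ 0 := by exact_mod_cast Nat.succ_ne_zero i
  push_cast
  rw [inv_mul_cancel_left₀ this]

/-- The winding number. -/
def wind (p : ℂ) : ℂ := γ.integral fun z => (z - p)⁻¹

/-! ### Residue formulas from partial fractions -/

variable {ι : Type*} [Fintype ι] [DecidableEq ι] {v : ι → ℂ}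

/-- Division by the nodal polynomial leaves a quotient, which has a primitive, and a remainder equal
to its Lagrange interpolant. This gives simple poles, and each integrates to a winding number. -/
theorem integral_inv_prod_mul_eval (hv : Function.Injective v) (hvt : ∀ i, v i ∉ γ.trace)
    (p : Polynomial ℂ) :
    γ.integral (fun u => (∏ i, (u - v i))⁻¹ * p.eval u)
      = ∑ i, γ.wind (v i) * Lagrange.nodalWeight Finset.univ v i * p.eval (v i) := by
  set Q := Lagrange.nodal Finset.univ v with hQ
  have hQm : Q.Monic := Lagrange.nodal_monic
  have hr : p %ₘ Q = Lagrange.interpolate Finset.univ v fun i => p.eval (v i) := by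
    refine Lagrange.eq_interpolate_of_eval_eq _ hv.injOn ?_ fun i _ => ?_
    · refine (Polynomial.degree_modByMonic_lt _ hQm).trans_eq ?_
      rw [hQ, Lagrange.degree_nodal]
    · have := congrArg (Polynomial.eval (v i)) (Polynomial.modByMonic_add_div p Q)
      rw [Polynomial.eval_add, Polynomial.eval_mul,
        Lagrange.eval_nodal_at_node (Finset.mem_univ i), zero_mul, add_zero] at this
      exact this
  have hpt : ∀ u ∈ γ.trace, (∏ i, (u - v i))⁻¹ * p.eval u = (p /ₘ Q).eval u
      + ∑ i, (Lagrange.nodalWeight Finset.univ v i * p.eval (v i)) * (u - v i)⁻¹ := by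
    intro u hu
    have hne : ∀ i, u ≠ v i := fun i h => hvt i (h ▸ hu)
    have hprod : ∏ i, (u - v i) ≠ 0 := Finset.prod_ne_zero_iff.2 fun i _ => sub_ne_zero.2 (hne i)
    have h1 := congrArg (Polynomial.eval u) (Polynomial.modByMonic_add_div p Q)
    rw [Polynomial.eval_add, Polynomial.eval_mul, hr,
      Lagrange.eval_interpolate_not_at_node _ (fun i _ => hne i), Lagrange.eval_nodal] at h1
    rw [← h1, ← mul_add, inv_mul_cancel_left₀ hprod, add_comm]
    congr 1
    exact Finset.sum_congr rfl fun i _ => by ring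
  have hc : ∀ i ∈ Finset.univ, ContinuousOn (fun u =>
      (Lagrange.nodalWeight Finset.univ v i * p.eval (v i)) * (u - v i)⁻¹) γ.trace :=
    fun i _ => continuousOn_const.mul (γ.continuousOn_inv_sub (hvt i))
  rw [γ.integral_congr hpt, γ.integral_add (by fun_prop) (continuousOn_finsetSum _ hc),
    γ.integral_eval, zero_add, γ.integral_sum _ hc]
  refine Finset.sum_congr rfl fun i _ => ?_
  rw [γ.integral_const_mul, wind]
  ring

theorem integral_inv_sub_mul_inv_sub {e z : ℂ} (he : e ∉ γ.trace) (hz : γ.Excludes z) :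
    γ.integral (fun u => (u - e)⁻¹ * (z - u)⁻¹) = γ.wind e * (z - e)⁻¹ := by
  by_cases h : z = e
  · subst h
    have : ∀ u ∈ γ.trace, (u - z)⁻¹ * (z - u)⁻¹ = (-1) * (u - z) ^ (-2 : ℤ) := by
      intro u hu
      rw [← neg_sub u z, inv_neg, zpow_neg, zpow_ofNat, pow_two, mul_inv]
      ring
    rw [γ.integral_congr this, γ.integral_const_mul, γ.integral_zpow_sub he (by norm_num)]
    simp
  · have hze : z - e ≠ 0 := sub_ne_zero.2 h
    have : ∀ u ∈ γ.trace, (u - e)⁻¹ * (z - u)⁻¹ = (z - e)⁻¹ * ((u - e)⁻¹ - (u - z)⁻¹) := by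
      intro u hu
      have h1 : u - e ≠ 0 := fun h => he (by rwa [← sub_eq_zero.1 h])
      have h2 : u - z ≠ 0 := fun h => hz.1 (by rwa [← sub_eq_zero.1 h])
      have h3 : z - u ≠ 0 := by rw [← neg_sub]; exact neg_ne_zero.2 h2
      field_simp
      ring
    rw [γ.integral_congr this, γ.integral_const_mul,
      γ.integral_sub (γ.continuousOn_inv_sub he) (γ.continuousOn_inv_sub hz.1), hz.2, sub_zero, wind,
      mul_comm]

/-- Writing `p(u) = p(z) + (u - z) g(u)` separates the factor `(z - u)⁻¹` from the polynomial. The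
point `z` may coincide with a node, which then has winding number zero. Nonemptiness allows the
partial fraction expansion of the reciprocal nodal polynomial with constant numerator `1`. -/
theorem integral_inv_prod_mul_inv_sub_mul_eval [Nonempty ι] (hv : Function.Injective v)
    (hvt : ∀ i, v i ∉ γ.trace) {z : ℂ} (hz : γ.Excludes z) (p : Polynomial ℂ) :
    γ.integral (fun u => (∏ i, (u - v i))⁻¹ * (z - u)⁻¹ * p.eval u)
      = ∑ i, γ.wind (v i) * Lagrange.nodalWeight Finset.univ v i * (z - v i)⁻¹ * p.eval (v i) := by
  set g := p /ₘ (Polynomial.X - Polynomial.C z) with hg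
  have hp : ∀ u, p.eval u = p.eval z + (u - z) * g.eval u := by
    intro u
    have := congrArg (Polynomial.eval u)
      (Polynomial.modByMonic_add_div p (Polynomial.X - Polynomial.C z))
    rw [Polynomial.modByMonic_X_sub_C_eq_C_eval] at this
    simpa using this.symm
  have hpt : ∀ u ∈ γ.trace, (∏ i, (u - v i))⁻¹ * (z - u)⁻¹ * p.eval u
      = (∑ i, (p.eval z * Lagrange.nodalWeight Finset.univ v i) * ((u - v i)⁻¹ * (z - u)⁻¹))
        - (∏ i, (u - v i))⁻¹ * g.eval u := by
    intro u hu
    have hne : ∀ i, u ≠ v i := fun i h => hvt i (h ▸ hu)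
    have h3 : z - u ≠ 0 := fun h => hz.1 (by rwa [sub_eq_zero.1 h])
    have h1 := Lagrange.eval_interpolate_not_at_node (s := Finset.univ) (v := v) 1
      (fun i _ => hne i)
    rw [Lagrange.interpolate_one hv.injOn Finset.univ_nonempty, Polynomial.eval_one,
      Lagrange.eval_nodal] at h1
    have h2 := inv_eq_of_mul_eq_one_right h1.symm
    have h4 : ∑ i, (p.eval z * Lagrange.nodalWeight Finset.univ v i) * ((u - v i)⁻¹ * (z - u)⁻¹)
        = p.eval z * (z - u)⁻¹ * (∏ i, (u - v i))⁻¹ := by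
      rw [h2, Finset.mul_sum]
      refine Finset.sum_congr rfl fun i _ => ?_
      simp only [Pi.one_apply]
      ring
    rw [h4, hp u]
    field_simp
    ring
  have hc1 : ContinuousOn (fun u => (z - u)⁻¹) γ.trace :=
    ContinuousOn.inv₀ (by fun_prop) fun u hu h => hz.1 (by rwa [sub_eq_zero.1 h])
  have hc2 : ContinuousOn (fun u => (∏ i, (u - v i))⁻¹) γ.trace := by
    refine ContinuousOn.inv₀ (by fun_prop) fun u hu => ?_
    exact Finset.prod_ne_zero_iff.2 fun i _ h => hvt i (by rwa [← sub_eq_zero.1 h])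
  have hc : ∀ i ∈ Finset.univ, ContinuousOn (fun u =>
      (p.eval z * Lagrange.nodalWeight Finset.univ v i) * ((u - v i)⁻¹ * (z - u)⁻¹)) γ.trace :=
    fun i _ => continuousOn_const.mul ((γ.continuousOn_inv_sub (hvt i)).mul hc1)
  have hc3 : ContinuousOn (fun u => (∏ i, (u - v i))⁻¹ * g.eval u) γ.trace :=
    hc2.mul (by fun_prop)
  rw [γ.integral_congr hpt, γ.integral_sub (continuousOn_finsetSum _ hc) hc3, γ.integral_sum _ hc, γ.integral_inv_prod_mul_eval hv hvt,
    ← Finset.sum_sub_distrib]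
  refine Finset.sum_congr rfl fun i _ => ?_
  rw [γ.integral_const_mul, γ.integral_inv_sub_mul_inv_sub (hvt i) hz, hp (v i)]
  by_cases h : z = v i
  · have : γ.wind (v i) = 0 := by rw [← h]; exact hz.2
    rw [this]; ring
  · have : z - v i ≠ 0 := sub_ne_zero.2 h
    field_simp
    ring

/-- The residues at `0` and `v` cancel, as the integrand is of order `z^{-2}` at infinity. For `v =
0` there is a primitive; otherwise partial fractions lower the power. -/
theorem integral_inv_pow_mul_inv_sub {v : ℂ} (h0 : γ.Encloses 0) (hv : γ.Encloses v) (k : ℕ) :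
    γ.integral (fun z => z⁻¹ ^ (k + 1) * (z - v)⁻¹) = 0 := by
  have hz0 : ∀ z ∈ γ.trace, z ≠ 0 := fun z hz h => h0.1 (h ▸ hz)
  have hzv : ∀ z ∈ γ.trace, z - v ≠ 0 := fun z hz h => hv.1 (by rwa [← sub_eq_zero.1 h])
  have hpow : ∀ k : ℕ, γ.integral (fun z => z⁻¹ ^ (k + 2)) = 0 := by
    intro k
    have := γ.integral_zpow_sub h0.1 (n := -((k + 2 : ℕ) : ℤ)) (by omega)
    refine (γ.integral_congr fun z _ => ?_).trans this
    rw [sub_zero, zpow_neg, zpow_natCast, inv_pow]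
  by_cases h : v = 0
  · subst h
    refine (γ.integral_congr fun z _ => ?_).trans (hpow k)
    rw [sub_zero, ← pow_succ]
  have hone : γ.integral (fun z => z⁻¹) = 1 := by simpa using h0.2
  have hcz : ContinuousOn (fun z : ℂ => z⁻¹) γ.trace := ContinuousOn.inv₀ continuousOn_id hz0
  have hcv := γ.continuousOn_inv_sub hv.1
  have hpt : ∀ k : ℕ, ∀ z ∈ γ.trace, z⁻¹ ^ (k + 1) * (z - v)⁻¹
      = v⁻¹ * (z⁻¹ ^ k * (z - v)⁻¹ - z⁻¹ ^ (k + 1)) := by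
    intro k z hz
    have h1 := hz0 z hz
    have h2 := hzv z hz
    rw [pow_succ]
    generalize z⁻¹ ^ k = c
    field_simp
    ring
  induction k with
  | zero =>
    rw [γ.integral_congr (hpt 0), γ.integral_const_mul]
    simp only [pow_zero, one_mul, zero_add, pow_one]
    rw [γ.integral_sub hcv hcz, hv.2, hone]
    simp
  | succ k ih =>
    have h1 : ContinuousOn (fun z : ℂ => z⁻¹ ^ (k + 1) * (z - v)⁻¹) γ.trace := (hcz.pow _).mul hcv
    have h2 : ContinuousOn (fun z : ℂ => z⁻¹ ^ (k + 1 + 1)) γ.trace := hcz.pow _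
    rw [γ.integral_congr (hpt (k + 1)), γ.integral_const_mul, γ.integral_sub h1 h2, ih, hpow]
    simp

/-- The sum of the residues at `0` and `v`. -/
theorem integral_inv_pow_mul_inv_sub_mul_eval {v : ℂ} (h0 : γ.Encloses 0) (hv : γ.Encloses v)
    (T : ℂ) (k : ℕ) (p : Polynomial ℂ) :
    γ.integral (fun z => z⁻¹ ^ k * (z - v)⁻¹ * p.eval (z * T))
      = T ^ k * (Polynomial.divX^[k] p).eval (v * T) := by
  have hz0 : ∀ z ∈ γ.trace, z ≠ 0 := fun z hz h => h0.1 (h ▸ hz)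
  have hcz : ContinuousOn (fun z : ℂ => z⁻¹) γ.trace := ContinuousOn.inv₀ continuousOn_id hz0
  have hcv := γ.continuousOn_inv_sub hv.1
  induction k generalizing p with
  | zero =>
    have h := γ.integral_inv_prod_mul_eval (ι := Unit) (v := fun _ => v)
      (fun _ _ _ => rfl) (fun _ => hv.1) (p.comp (Polynomial.C T * Polynomial.X))
    have hw : γ.wind v = 1 := hv.2
    simpa [Lagrange.nodalWeight, hw, mul_comm T] using h
  | succ k ih =>
    -- The constant term of `p` integrates to zero; the rest of `p` cancels one power of `z⁻¹`.
    have hpt : ∀ z ∈ γ.trace, z⁻¹ ^ (k + 1) * (z - v)⁻¹ * p.eval (z * T)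
        = p.coeff 0 * (z⁻¹ ^ (k + 1) * (z - v)⁻¹)
          + T * (z⁻¹ ^ k * (z - v)⁻¹ * p.divX.eval (z * T)) := by
      intro z hz
      have h1 : p.eval (z * T) = p.divX.eval (z * T) * (z * T) + p.coeff 0 := by
        conv_lhs => rw [← Polynomial.divX_mul_X_add p]
        simp
      have := hz0 z hz
      rw [h1, pow_succ]
      generalize z⁻¹ ^ k = c
      field_simp
      ring
    have hcp : ContinuousOn (fun z : ℂ => p.divX.eval (z * T)) γ.trace := by fun_prop
    have h1 : ContinuousOn (fun z : ℂ => p.coeff 0 * (z⁻¹ ^ (k + 1) * (z - v)⁻¹)) γ.trace :=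
      continuousOn_const.mul ((hcz.pow _).mul hcv)
    have h2 : ContinuousOn (fun z : ℂ => T * (z⁻¹ ^ k * (z - v)⁻¹ * p.divX.eval (z * T))) γ.trace :=
      continuousOn_const.mul (((hcz.pow _).mul hcv).mul hcp)
    rw [γ.integral_congr hpt, γ.integral_add h1 h2, γ.integral_const_mul,
      γ.integral_const_mul, γ.integral_inv_pow_mul_inv_sub h0 hv, ih, Function.iterate_succ_apply,
      pow_succ]
    ring

end Contour

/-! ### Coefficient extraction along `Γ₀` -/

theorem IsGammaZero.ne_zero {q : ℝ} {d n : ℕ} {Γ₀ : Contour}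
    (h : IsGammaZero d n q Γ₀) {w : ℂ} (hw : w ∈ Γ₀.trace) {k : ℕ} (hk : k < n) :
    1 - w * (q : ℂ) ^ (d + k) ≠ 0 := by
  intro e
  refine (h.2 k hk).1 ?_
  rwa [← eq_inv_of_mul_eq_one_left (sub_eq_zero.1 e).symm]

/-- For `r < 0` the integrand is regular at the origin, and its only possible poles are excluded by
the contour. -/
theorem IsGammaZero.integral_of_neg {q : ℝ} (hq0 : 0 < q) (hq1 : q < 1) {d n : ℕ} {Γ₀ : Contour}
    (h : IsGammaZero d n q Γ₀) {r : ℤ} (hr : r < 0) :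
    Γ₀.integral (fun w => w ^ (-r - 1) * (∏ k ∈ Finset.range n, (1 - w * (q : ℂ) ^ (d + k)))⁻¹)
      = 0 := by
  have hqc : (q : ℂ) ≠ 0 := by exact_mod_cast hq0.ne'
  have hinj : Function.Injective fun k : Fin n => ((q : ℂ) ^ (d + (k : ℕ)))⁻¹ := by
    intro a b hab
    have h1 : (q : ℂ) ^ (d + (a : ℕ)) = (q : ℂ) ^ (d + (b : ℕ)) := inv_injective hab
    have h2 : q ^ (d + (a : ℕ)) = q ^ (d + (b : ℕ)) := by exact_mod_cast h1
    have h3 := pow_right_injective₀ hq0 hq1.ne h2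
    exact Fin.ext (by omega)
  have hi := Γ₀.integral_inv_prod_mul_eval hinj (fun k => (h.2 k k.2).1)
    (Polynomial.C (∏ k : Fin n, (-(q : ℂ) ^ (d + (k : ℕ)))⁻¹) * Polynomial.X ^ (-r - 1).toNat)
  rw [Finset.sum_eq_zero (fun k _ => by
    rw [show Γ₀.wind ((q : ℂ) ^ (d + (k : ℕ)))⁻¹ = 0 from (h.2 k k.2).2, zero_mul, zero_mul])] at hi
  rw [← hi]
  refine Γ₀.integral_congr fun w hw => ?_
  rw [Polynomial.eval_mul, Polynomial.eval_C, Polynomial.eval_pow, Polynomial.eval_X,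
    Finset.prod_range, ← zpow_natCast w, show ((-r - 1).toNat : ℤ) = -r - 1 by omega, ← mul_assoc,
    ← Finset.prod_inv_distrib, ← Finset.prod_inv_distrib, ← Finset.prod_mul_distrib, mul_comm]
  congr 1
  refine Finset.prod_congr rfl fun k _ => ?_
  rw [← mul_inv]
  congr 1
  have := pow_ne_zero (d + (k : ℕ)) hqc
  field_simp
  ring

theorem IsGammaZero.continuousOn {q : ℝ} {d n : ℕ} {Γ₀ : Contour}
    (h : IsGammaZero d n q Γ₀) (r : ℤ) :
    ContinuousOn (fun w => w ^ r * (∏ k ∈ Finset.range n, (1 - w * (q : ℂ) ^ (d + k)))⁻¹)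
      Γ₀.trace := by
  refine ContinuousOn.mul (fun w hw => ?_) (ContinuousOn.inv₀ (by fun_prop) fun w hw => ?_)
  · exact (continuousAt_zpow₀ w r (Or.inl fun e => h.1.1 (e ▸ hw))).continuousWithinAt
  · exact Finset.prod_ne_zero_iff.2 fun k hk => h.ne_zero hw (Finset.mem_range.1 hk)

/-- The complete homogeneous symmetric polynomials as coefficients of their generating function. -/
theorem IsGammaZero.integral_eq_hq {q : ℝ} (hq0 : 0 < q) (hq1 : q < 1) {d n : ℕ} {Γ₀ : Contour}
    (h : IsGammaZero d n q Γ₀) (r : ℤ) :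
    Γ₀.integral (fun w => w ^ (-r - 1) * (∏ k ∈ Finset.range n, (1 - w * (q : ℂ) ^ (d + k)))⁻¹)
      = hq q d n r := by
  induction n generalizing r with
  | zero =>
    simp only [Finset.range_zero, Finset.prod_empty, inv_one, mul_one]
    rw [hq_no_vars]
    split_ifs with hr
    · subst hr
      have := h.1.2
      simpa using this
    · have := Γ₀.integral_zpow_sub h.1.1 (n := -r - 1) (by omega)
      simpa using this
  | succ n ihn =>
    rcases lt_or_ge r 0 with hr | hr
    · rw [h.integral_of_neg hq0 hq1 hr, hq_of_neg _ _ _ hr]; simp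
    have h' : IsGammaZero d n q Γ₀ := ⟨h.1, fun k hk => h.2 k (by omega)⟩
    -- Splitting off the last factor of the denominator reproduces `hq_succ`.
    have hrec : ∀ r : ℤ, Γ₀.integral (fun w => w ^ (-r - 1) *
          (∏ k ∈ Finset.range (n + 1), (1 - w * (q : ℂ) ^ (d + k)))⁻¹)
        = hq q d n r + (q : ℂ) ^ (d + n) * Γ₀.integral (fun w => w ^ (-(r - 1) - 1) *
          (∏ k ∈ Finset.range (n + 1), (1 - w * (q : ℂ) ^ (d + k)))⁻¹) := by
      intro r
      have hc : ContinuousOn (fun w => (q : ℂ) ^ (d + n) * (w ^ (-(r - 1) - 1) *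
          (∏ k ∈ Finset.range (n + 1), (1 - w * (q : ℂ) ^ (d + k)))⁻¹)) Γ₀.trace :=
        continuousOn_const.mul (h.continuousOn _)
      rw [← ihn h' r, ← Γ₀.integral_const_mul, ← Γ₀.integral_add (h'.continuousOn _) hc]
      refine Γ₀.integral_congr fun w hw => ?_
      have hw0 : w ≠ 0 := fun e => h.1.1 (e ▸ hw)
      have h1 := h.ne_zero hw (Nat.lt_succ_self n)
      have h2 : w ^ (-(r - 1) - 1) = w ^ (-r - 1) * w := by
        rw [← zpow_add_one₀ hw0]; congr 1; ring
      rw [Finset.prod_range_succ, mul_inv, h2]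
      generalize (∏ k ∈ Finset.range n, (1 - w * (q : ℂ) ^ (d + k)))⁻¹ = c
      generalize w ^ (-r - 1) = c'
      field_simp
      ring
    obtain ⟨m, rfl⟩ := Int.eq_ofNat_of_zero_le hr
    clear hr
    induction m with
    | zero =>
      rw [hrec, h.integral_of_neg hq0 hq1 (by simp), Nat.cast_zero, hq_zero_right, hq_zero_right]
      simp
    | succ m ih =>
      rw [hrec, hq_succ, show ((m + 1 : ℕ) : ℤ) - 1 = m by push_cast; ring, ih]
      push_cast
      rfl

/-! ### Iterated contour integrals as sums over nodes -/

/-- Functions that are polynomial in each variable separately. -/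
def SepPoly {k : ℕ} (F : (Fin k → ℂ) → ℂ) : Prop :=
  ∀ u j, ∃ p : Polynomial ℂ, ∀ s, F (Function.update u j s) = p.eval s

namespace SepPoly

variable {k : ℕ} {ι : Type*}

theorem const (c : ℂ) : SepPoly fun _ : Fin k → ℂ => c :=
  fun _ _ => ⟨Polynomial.C c, fun s => by simp⟩

theorem mul {F G : (Fin k → ℂ) → ℂ} (hF : SepPoly F) (hG : SepPoly G) :
    SepPoly fun u => F u * G u := fun u j => by
  obtain ⟨p, hp⟩ := hF u j
  obtain ⟨p', hp'⟩ := hG u j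
  exact ⟨p * p', fun s => by simp [hp, hp']⟩

theorem sub {F G : (Fin k → ℂ) → ℂ} (hF : SepPoly F) (hG : SepPoly G) :
    SepPoly fun u => F u - G u := fun u j => by
  obtain ⟨p, hp⟩ := hF u j
  obtain ⟨p', hp'⟩ := hG u j
  exact ⟨p - p', fun s => by simp [hp, hp']⟩

theorem sum (t : Finset ι) {F : ι → (Fin k → ℂ) → ℂ} (hF : ∀ i ∈ t, SepPoly (F i)) :
    SepPoly fun u => ∑ i ∈ t, F i u := fun u j => by
  choose! p hp using fun i (hi : i ∈ t) => hF i hi u j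
  refine ⟨∑ i ∈ t, p i, fun s => ?_⟩
  rw [Polynomial.eval_finsetSum]
  exact Finset.sum_congr rfl fun i hi => hp i hi s

theorem prod (t : Finset ι) {F : ι → (Fin k → ℂ) → ℂ} (hF : ∀ i ∈ t, SepPoly (F i)) :
    SepPoly fun u => ∏ i ∈ t, F i u := fun u j => by
  choose! p hp using fun i (hi : i ∈ t) => hF i hi u j
  refine ⟨∏ i ∈ t, p i, fun s => ?_⟩
  rw [Polynomial.eval_prod]
  exact Finset.prod_congr rfl fun i hi => hp i hi s

theorem eval (p : Polynomial ℂ) (i : Fin k) : SepPoly fun u : Fin k → ℂ => p.eval (u i) := by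
  intro u j
  by_cases h : i = j
  · subst h; exact ⟨p, fun s => by simp⟩
  · exact ⟨Polynomial.C (p.eval (u i)), fun s => by simp [h]⟩

theorem coord (i : Fin k) : SepPoly fun u : Fin k → ℂ => u i := by
  simpa using eval Polynomial.X i

theorem cons (v : ℂ) (i : Fin (k + 1)) :
    SepPoly fun u : Fin k → ℂ => (Fin.cons v u : Fin (k + 1) → ℂ) i := by
  induction i using Fin.cases with
  | zero => simpa using const v
  | succ i => simpa using coord i

theorem det {m : ℕ} {A : Fin m → Fin m → (Fin k → ℂ) → ℂ} (hA : ∀ i j, SepPoly (A i j)) :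
    SepPoly fun u => (Matrix.of fun i j => A i j u).det := by
  simp only [Matrix.det_apply', Matrix.of_apply]
  exact sum _ fun σ _ => (const _).mul (prod _ fun i _ => hA _ _)

theorem vdm_comp {m : ℕ} {f : Fin m → (Fin k → ℂ) → ℂ} (hf : ∀ i, SepPoly (f i)) :
    SepPoly fun u => vdm fun i => f i u :=
  prod _ fun i _ => prod _ fun j _ => (hf i).sub (hf j)

end SepPoly

theorem sum_fin_succ_fun {ι : Type*} [Fintype ι] {k : ℕ} (f : (Fin (k + 1) → ι) → ℂ) :
    ∑ J, f J = ∑ i, ∑ I : Fin k → ι, f (Fin.cons i I) := by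
  rw [← (Fin.consEquiv fun _ : Fin (k + 1) => ι).sum_comp, Fintype.sum_prod_type]
  rfl

namespace Contour

variable (γ : Contour)

theorem iterIntegral_congr {k : ℕ} {f g : (Fin k → ℂ) → ℂ}
    (h : ∀ u, (∀ j, u j ∈ γ.trace) → f u = g u) : γ.iterIntegral k f = γ.iterIntegral k g := by
  induction k with
  | zero => exact h _ fun j => j.elim0
  | succ k ih =>
    refine γ.integral_congr fun z hz => ih fun u hu => h _ fun j => ?_
    induction j using Fin.cases with
    | zero => simpa using hz
    | succ j => simpa using hu j

theorem iterIntegral_const_mul {k : ℕ} (c : ℂ) (f : (Fin k → ℂ) → ℂ) :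
    γ.iterIntegral k (fun u => c * f u) = c * γ.iterIntegral k f := by
  induction k with
  | zero => rfl
  | succ k ih => simp only [Contour.iterIntegral, ih, γ.integral_const_mul]

/-- If integration against `ρ` is a sum over nodes for polynomials, then so are iterated integrals. -/
theorem iterIntegral_eq_sum {ι : Type*} [Fintype ι] {ρ : ℂ → ℂ} {κ wt : ι → ℂ}
    {k : ℕ} (hρ : 0 < k → ∀ p : Polynomial ℂ,
      γ.integral (fun u => ρ u * p.eval u) = ∑ i, wt i * p.eval (κ i))
    {F : (Fin k → ℂ) → ℂ} (hF : SepPoly F) :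
    γ.iterIntegral k (fun u => (∏ j, ρ (u j)) * F u)
      = ∑ I : Fin k → ι, (∏ j, wt (I j)) * F (fun j => κ (I j)) := by
  induction k with
  | zero =>
    simp only [Contour.iterIntegral, Finset.univ_eq_empty, Finset.prod_empty, one_mul,
      Finset.univ_unique, Finset.sum_singleton]
    congr 1
    exact Subsingleton.elim _ _
  | succ k ih =>
    have hcons : ∀ (s : ℂ) (u : Fin k → ℂ) (j : Fin k) (z : ℂ),
        (Fin.cons s (Function.update u j z) : Fin (k + 1) → ℂ)
          = Function.update (Fin.cons s u) j.succ z := fun s u j z => Fin.cons_update _ _ _ _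
    have hzero : ∀ (s : ℂ) (u : Fin k → ℂ) (z : ℂ),
        (Fin.cons z u : Fin (k + 1) → ℂ) = Function.update (Fin.cons s u) 0 z :=
      fun s u z => (Fin.update_cons_zero _ _ _).symm
    have hin : ∀ s : ℂ, γ.iterIntegral k (fun us =>
        (∏ j, ρ ((Fin.cons s us : Fin (k + 1) → ℂ) j)) * F (Fin.cons s us))
        = ρ s * ∑ I : Fin k → ι, (∏ j, wt (I j)) * F (Fin.cons s fun j => κ (I j)) := by
      intro s
      rw [← ih (fun _ => hρ (Nat.succ_pos _)) (F := fun us => F (Fin.cons s us)) (fun u j => by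
        obtain ⟨p, hp⟩ := hF (Fin.cons s u) j.succ
        exact ⟨p, fun z => (congrArg F (hcons s u j z)).trans (hp z)⟩), ← γ.iterIntegral_const_mul]
      refine γ.iterIntegral_congr fun u _ => ?_
      rw [Fin.prod_univ_succ]
      simp [mul_assoc]
    have hp : ∀ I : Fin k → ι, ∃ p : Polynomial ℂ, ∀ s,
        F (Fin.cons s fun j => κ (I j)) = p.eval s := by
      intro I
      obtain ⟨p, hp⟩ := hF (Fin.cons 0 fun j => κ (I j)) 0
      exact ⟨p, fun s => by rw [hzero 0]; exact hp s⟩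
    choose p hp using hp
    have := hρ (Nat.succ_pos _)
      (∑ I : Fin k → ι, Polynomial.C (∏ j, wt (I j)) * p I)
    simp only [Polynomial.eval_finsetSum, Polynomial.eval_mul, Polynomial.eval_C, ← hp] at this
    rw [Contour.iterIntegral, γ.integral_congr fun s _ => hin s, this, sum_fin_succ_fun]
    refine Finset.sum_congr rfl fun i _ => ?_
    rw [Finset.mul_sum]
    refine Finset.sum_congr rfl fun I _ => ?_
    rw [Fin.prod_univ_succ, Fin.cons_zero, mul_assoc]
    simp only [Fin.cons_succ]
    congr 3
    funext j
    induction j using Fin.cases <;> simp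

end Contour

/-! ### `Ω`, `Ω̃` and `F_r` as finite sums -/

theorem exists_calPt_eq_eval (d : ℕ) (q : ℂ) (n : ℕ) (t : ℤ) :
    ∃ p : Polynomial ℂ, ∀ z, calPt d q n t z = p.eval z := by
  refine ⟨Polynomial.C (q ^ (-((d : ℤ) * t)) / qPoch q q n) * ∏ j ∈ Finset.range n,
    (1 - Polynomial.C (q ^ (-t) * q * q ^ j) * Polynomial.X), fun z => ?_⟩
  rw [calPt, calP, qPoch, Polynomial.eval_mul, Polynomial.eval_C, Polynomial.eval_prod, div_mul_eq_mul_div,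
    mul_div_assoc]
  congr 2
  refine Finset.prod_congr rfl fun j _ => ?_
  simp
  ring

theorem sepPoly_calPt {k : ℕ} (d : ℕ) (q : ℂ) (n : ℕ) (t : ℤ) (i : Fin k) :
    SepPoly fun u : Fin k → ℂ => calPt d q n t (u i) := by
  obtain ⟨p, hp⟩ := exists_calPt_eq_eval d q n t
  simp only [hp]
  exact SepPoly.eval p i

/-- The nodes `q^{x_i}`. -/
def node (x : Fin (d + N) → ℤ) (q : ℝ) (i : Fin (d + N)) : ℂ := (q : ℂ) ^ x i

/-- The inverse of the derivative of `Q_q` at a node. -/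
def nodeWeight (x : Fin (d + N) → ℤ) (q : ℝ) (i : Fin (d + N)) : ℂ :=
  Lagrange.nodalWeight Finset.univ (node x q) i

open Classical in
/-- The residue weight of a node inside `Γ(q_1, …, q_c)`, zero for the other nodes. -/
def cutWeight (y : Fin d → ℤ) (x : Fin (d + N) → ℤ) (q : ℝ) (i : Fin (d + N)) : ℂ :=
  if ∃ j, y j ≤ x i then nodeWeight x q i else 0

theorem node_ne_zero {q : ℝ} (hq0 : 0 < q) (x : Fin (d + N) → ℤ) (i : Fin (d + N)) :
    node x q i ≠ 0 := zpow_ne_zero _ (by exact_mod_cast hq0.ne')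

theorem zpow_injective_of_lt_one {q : ℝ} (hq0 : 0 < q) (hq1 : q < 1) {a b : ℤ}
    (h : (q : ℂ) ^ a = (q : ℂ) ^ b) : a = b :=
  zpow_right_injective₀ hq0 hq1.ne (by exact_mod_cast h)

theorem node_injective {q : ℝ} (hq0 : 0 < q) (hq1 : q < 1) {x : Fin (d + N) → ℤ}
    (hx : StrictAnti x) : Function.Injective (node x q) :=
  fun _ _ h => hx.injective (zpow_injective_of_lt_one hq0 hq1 h)

theorem IsGammaU.node_notMem {y : Fin d → ℤ} {x : Fin (d + N) → ℤ} {q : ℝ} {Γ : Contour}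
    (h : IsGammaU y x q Γ) (i : Fin (d + N)) : node x q i ∉ Γ.trace := by
  by_cases hi : ∃ j, y j ≤ x i
  · exact ((h.2 i).1 hi).1
  · push Not at hi
    exact ((h.2 i).2 hi).1

theorem IsGammaU.wind_mul {y : Fin d → ℤ} {x : Fin (d + N) → ℤ} {q : ℝ} {Γ : Contour}
    (h : IsGammaU y x q Γ) (i : Fin (d + N)) :
    Γ.wind (node x q i) * nodeWeight x q i = cutWeight y x q i := by
  rw [cutWeight]
  split_ifs with hi
  · rw [show Γ.wind (node x q i) = 1 from ((h.2 i).1 hi).2, one_mul]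
  · push Not at hi
    rw [show Γ.wind (node x q i) = 0 from ((h.2 i).2 hi).2, zero_mul]

theorem IsGammaU.integral_eval {y : Fin d → ℤ} {x : Fin (d + N) → ℤ} (hx : StrictAnti x) {q : ℝ}
    (hq0 : 0 < q) (hq1 : q < 1) {Γ : Contour} (h : IsGammaU y x q Γ) (p : Polynomial ℂ) :
    Γ.integral (fun u => (Qq x q u)⁻¹ * p.eval u) = ∑ i, cutWeight y x q i * p.eval (node x q i) := by
  have := Γ.integral_inv_prod_mul_eval (node_injective hq0 hq1 hx) h.node_notMem p
  refine this.trans (Finset.sum_congr rfl fun i _ => ?_)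
  rw [← h.wind_mul]
  rfl

theorem IsGammaU.integral_inv_sub_eval {y : Fin d → ℤ} {x : Fin (d + N) → ℤ} (hx : StrictAnti x)
    {q : ℝ} (hq0 : 0 < q) (hq1 : q < 1) {Γ : Contour} (h : IsGammaU y x q Γ) (hd : 0 < d) {z : ℂ}
    (hz : Γ.Excludes z) (p : Polynomial ℂ) :
    Γ.integral (fun u => (Qq x q u)⁻¹ * (z - u)⁻¹ * p.eval u)
      = ∑ i, cutWeight y x q i * (z - node x q i)⁻¹ * p.eval (node x q i) := by
  have : Nonempty (Fin (d + N)) := ⟨⟨0, by omega⟩⟩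
  have := Γ.integral_inv_prod_mul_inv_sub_mul_eval (node_injective hq0 hq1 hx) h.node_notMem hz p
  refine this.trans (Finset.sum_congr rfl fun i _ => ?_)
  rw [← h.wind_mul]
  rfl

theorem sepPoly_deltaCut (N : ℕ) (y : Fin d → ℤ) (q : ℂ) : SepPoly fun u => deltaCut N y q u :=
  SepPoly.det fun _ _ => sepPoly_calPt _ _ _ _ _

/-- `Ω_q(0, 0)` as a sum over the nodes. -/
def omegaSum (y : Fin d → ℤ) (x : Fin (d + N) → ℤ) (q : ℝ) : ℂ :=
  ∑ I : Fin d → Fin (d + N), (∏ j, cutWeight y x q (I j)) *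
    (vdm (fun j => node x q (I j)) * deltaCut N y q (fun j => node x q (I j)))

theorem OmegaQ_zero_zero {y : Fin d → ℤ} {x : Fin (d + N) → ℤ} (hx : StrictAnti x)
    {q : ℝ} (hq0 : 0 < q) (hq1 : q < 1) {Γ : Contour} (h : IsGammaU y x q Γ) :
    OmegaQ y x q Γ 0 0 = omegaSum y x q := by
  rw [OmegaQ, omegaSum, ← Γ.iterIntegral_eq_sum (fun _ => h.integral_eval hx hq0 hq1)
    (F := fun u => vdm u * deltaCut N y q u)
    ((SepPoly.vdm_comp fun i => SepPoly.coord i).mul (sepPoly_deltaCut _ _ _))]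
  refine Γ.iterIntegral_congr fun u hu => ?_
  -- The quotients `(0 - u_j) / (0 - u_j)` are `1` because the contour avoids the origin.
  rw [Finset.prod_congr rfl fun j _ => div_self (sub_ne_zero.2 fun e => h.1 (by rw [e]; exact hu j)),
    Finset.prod_const_one]
  ring

theorem OmegaQ_eq {y : Fin d → ℤ} {x : Fin (d + N) → ℤ} (hx : StrictAnti x)
    {q : ℝ} (hq0 : 0 < q) (hq1 : q < 1) {Γ : Contour} (h : IsGammaU y x q Γ) (v : ℂ) {z : ℂ}
    (hz : Γ.Excludes z) :
    OmegaQ y x q Γ v z = ∑ I : Fin d → Fin (d + N),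
      (∏ j, cutWeight y x q (I j) * (z - node x q (I j))⁻¹) * ((∏ j, (v - node x q (I j))) *
      (vdm (fun j => node x q (I j)) * deltaCut N y q (fun j => node x q (I j)))) := by
  have hv : ∀ j, SepPoly fun u : Fin d → ℂ => v - u j :=
    fun j => (SepPoly.const v).sub (SepPoly.coord j)
  -- The one-variable formula is requested only if some variable is integrated, that is for `d > 0`,
  -- when there is a node.
  rw [OmegaQ, ← Γ.iterIntegral_eq_sum (fun hd => h.integral_inv_sub_eval hx hq0 hq1 hd hz)
    (F := fun u => (∏ j, (v - u j)) * (vdm u * deltaCut N y q u))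
    ((SepPoly.prod _ fun j _ => hv j).mul
      ((SepPoly.vdm_comp fun i => SepPoly.coord i).mul (sepPoly_deltaCut _ _ _)))]
  refine Γ.iterIntegral_congr fun u hu => ?_
  simp only [Finset.prod_mul_distrib, div_eq_mul_inv]
  ring

/-! ### Node sums for `F_r` and `Ω̃` when `d = e + 1` -/

section Succ

variable {e : ℕ}

/-- `F_r(v)` as a sum over the nodes. -/
def frSum (y : Fin (e + 1) → ℤ) (x : Fin (e + 1 + N) → ℤ) (q : ℝ) (r : Fin (e + 1)) (v : ℂ) : ℂ :=
  ∑ I : Fin e → Fin (e + 1 + N), (∏ j, cutWeight y x q (I j)) *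
    ((Matrix.of fun α β : Fin e => calPt (e + 1) q (N - 1) (y (r.succAbove β)) (node x q (I α))).det
      * vdm (Fin.cons v (fun j => node x q (I j)) : Fin (e + 1) → ℂ))

theorem sepPoly_minor (y : Fin (e + 1) → ℤ) (q : ℂ) (r : Fin (e + 1)) (v : ℂ) :
    SepPoly fun u : Fin e → ℂ =>
      (Matrix.of fun α β : Fin e => calPt (e + 1) q (N - 1) (y (r.succAbove β)) (u α)).det
      * vdm (Fin.cons v u : Fin (e + 1) → ℂ) :=
  (SepPoly.det fun _ _ => sepPoly_calPt _ _ _ _ _).mul (SepPoly.vdm_comp fun i => SepPoly.cons v i)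

theorem Fr_eq {y : Fin (e + 1) → ℤ} {x : Fin (e + 1 + N) → ℤ} (hx : StrictAnti x)
    {q : ℝ} (hq0 : 0 < q) (hq1 : q < 1) {Γ : Contour} (h : IsGammaU y x q Γ) (r : Fin (e + 1))
    (v : ℂ) : Fr y x q Γ r v = frSum y x q r v := by
  rw [frSum, ← Γ.iterIntegral_eq_sum (fun _ => h.integral_eval hx hq0 hq1)
    (sepPoly_minor y q r v), Fr]
  refine Γ.iterIntegral_congr fun u hu => ?_
  rw [mul_assoc]
  congr 3
  ext α β
  simp only [Matrix.of_apply]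
  congr 2
  apply Fin.ext
  simp only [Fin.succAbove, Fin.lt_def]
  split_ifs with h1 h2 h2
  · rfl
  · exact absurd h1 h2
  · exact absurd h2 h1
  · rfl

/-- After expansion along the first row, only the entry `w^{y_r}` depends on `w`, and its integral
is a coefficient of the generating function. -/
theorem deltaTilde_eq {y : Fin (e + 1) → ℤ} {q : ℝ} (hq0 : 0 < q) (hq1 : q < 1) {n : ℕ}
    {Γ₀ : Contour} (h : IsGammaZero (e + 1) n q Γ₀) (t : ℤ) (u : Fin e → ℂ) :
    deltaTilde N y q Γ₀ n t u = ∑ r : Fin (e + 1), (-1) ^ (r : ℕ) * (hq q (e + 1) n (t - y r) : ℂ) *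
      (Matrix.of fun α β : Fin e => calPt (e + 1) q (N - 1) (y (r.succAbove β)) (u α)).det := by
  have hW : ∀ w, deltaTildeW N y q w u = ∑ r : Fin (e + 1), (-1) ^ (r : ℕ) * w ^ y r *
      (Matrix.of fun α β : Fin e => calPt (e + 1) q (N - 1) (y (r.succAbove β)) (u α)).det := by
    intro w
    rw [deltaTildeW, Matrix.det_succ_row_zero]
    refine Finset.sum_congr rfl fun r _ => ?_
    congr 1
  have hpt : ∀ w ∈ Γ₀.trace, deltaTildeW N y q w u /
      (w ^ (t + 1) * ∏ k ∈ Finset.range n, (1 - w * (q : ℂ) ^ (e + 1 + k)))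
      = ∑ r : Fin (e + 1), ((-1) ^ (r : ℕ) *
        (Matrix.of fun α β : Fin e => calPt (e + 1) q (N - 1) (y (r.succAbove β)) (u α)).det) *
        (w ^ (-(t - y r) - 1) * (∏ k ∈ Finset.range n, (1 - w * (q : ℂ) ^ (e + 1 + k)))⁻¹) := by
    intro w hw
    have hw0 : w ≠ 0 := fun e => h.1.1 (e ▸ hw)
    rw [hW, Finset.sum_div]
    refine Finset.sum_congr rfl fun r _ => ?_
    rw [show -(t - y r) - 1 = y r - (t + 1) by ring, zpow_sub₀ hw0, div_mul_eq_div_div]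
    ring
  have hc : ∀ r ∈ (Finset.univ : Finset (Fin (e + 1))), ContinuousOn (fun w => ((-1) ^ (r : ℕ) *
        (Matrix.of fun α β : Fin e => calPt (e + 1) q (N - 1) (y (r.succAbove β)) (u α)).det) *
        (w ^ (-(t - y r) - 1) * (∏ k ∈ Finset.range n, (1 - w * (q : ℂ) ^ (e + 1 + k)))⁻¹))
        Γ₀.trace := fun r _ => continuousOn_const.mul (h.continuousOn _)
  rw [deltaTilde, Γ₀.integral_congr hpt, Γ₀.integral_sum _ hc]
  refine Finset.sum_congr rfl fun r _ => ?_
  rw [Γ₀.integral_const_mul, h.integral_eq_hq hq0 hq1]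
  ring

theorem OmegaTilde_eq {y : Fin (e + 1) → ℤ} {x : Fin (e + 1 + N) → ℤ} (hx : StrictAnti x)
    {q : ℝ} (hq0 : 0 < q) (hq1 : q < 1) {Γ Γ₀ : Contour} (h : IsGammaU y x q Γ) {n : ℕ}
    (h₀ : IsGammaZero (e + 1) n q Γ₀) (v : ℂ) (t : ℤ) :
    OmegaTilde y x q Γ Γ₀ n v t
      = ∑ r : Fin (e + 1), (-1) ^ (r : ℕ) * (hq q (e + 1) n (t - y r) : ℂ) * frSum y x q r v := by
  have hF : SepPoly fun u : Fin e → ℂ => ∑ r : Fin (e + 1),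
      ((-1) ^ (r : ℕ) * (hq q (e + 1) n (t - y r) : ℂ)) *
      ((Matrix.of fun α β : Fin e => calPt (e + 1) q (N - 1) (y (r.succAbove β)) (u α)).det
      * vdm (Fin.cons v u : Fin (e + 1) → ℂ)) :=
    SepPoly.sum _ fun r _ => (SepPoly.const _).mul (sepPoly_minor y q r v)
  have key := Γ.iterIntegral_eq_sum (fun _ => h.integral_eval hx hq0 hq1) hF
  have h1 : OmegaTilde y x q Γ Γ₀ n v t = Γ.iterIntegral e (fun u => (∏ j, (Qq x q (u j))⁻¹) *
      ∑ r : Fin (e + 1), ((-1) ^ (r : ℕ) * (hq q (e + 1) n (t - y r) : ℂ)) *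
      ((Matrix.of fun α β : Fin e => calPt (e + 1) q (N - 1) (y (r.succAbove β)) (u α)).det
      * vdm (Fin.cons v u : Fin (e + 1) → ℂ))) := by
    rw [OmegaTilde]
    refine Γ.iterIntegral_congr fun u hu => ?_
    rw [deltaTilde_eq hq0 hq1 h₀, mul_assoc, Finset.mul_sum]
    congr 1
    refine Finset.sum_congr rfl fun r _ => ?_
    rw [mul_comm, mul_assoc]
  rw [h1, key]
  simp only [frSum, Finset.mul_sum]
  rw [Finset.sum_comm]
  refine Finset.sum_congr rfl fun r _ => Finset.sum_congr rfl fun I _ => ?_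
  ring

end Succ

/-! ### Antisymmetric sums -/

/-- The minus signs account for the order `u_i - u_j` with `i < j` in `vdm`. -/
theorem vdm_eq_det {k : ℕ} (u : Fin k → ℂ) : vdm u = (Matrix.vandermonde fun i => -u i).det := by
  rw [Matrix.det_vandermonde, vdm]
  exact Finset.prod_congr rfl fun i _ => Finset.prod_congr rfl fun j _ => by ring

theorem vdm_comp_perm {k : ℕ} (u : Fin k → ℂ) (σ : Equiv.Perm (Fin k)) :
    vdm (fun i => u (σ i)) = (Equiv.Perm.sign σ : ℤ) * vdm u := by
  rw [vdm_eq_det, vdm_eq_det]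
  exact Matrix.det_permute σ (Matrix.vandermonde fun i => -u i)

theorem vdm_cons {k : ℕ} (v : ℂ) (u : Fin k → ℂ) :
    vdm (Fin.cons v u : Fin (k + 1) → ℂ) = (∏ j, (v - u j)) * vdm u := by
  unfold vdm
  rw [Fin.prod_univ_succ, Fin.Ioi_zero_eq_map, Finset.prod_map]
  congr 1
  refine Finset.prod_congr rfl fun i _ => ?_
  rw [Fin.Ioi_succ, Finset.prod_map]
  simp

theorem vdm_eq_zero_of_not_injective {k : ℕ} {u : Fin k → ℂ} (h : ¬ Function.Injective u) :
    vdm u = 0 := by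
  rw [vdm_eq_det, Matrix.det_vandermonde_eq_zero_iff]
  simp only [Function.Injective] at h
  push Not at h
  obtain ⟨i, j, hij, hne⟩ := h
  exact ⟨i, j, by rw [hij], hne⟩

/-- Summation of a determinant against an antisymmetric function: each term of the expansion along
the column `r` contributes the same. -/
theorem sum_antisymm_mul_det {ι : Type*} [Fintype ι] {k : ℕ} (S : (Fin (k + 1) → ι) → ℂ)
    (hS : ∀ (σ : Equiv.Perm (Fin (k + 1))) J, S (fun i => J (σ i)) = (Equiv.Perm.sign σ : ℤ) * S J)
    (f : ι → Fin (k + 1) → ℂ) (r : Fin (k + 1)) :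
    ∑ J, S J * (Matrix.of fun α β => f (J α) β).det = (k + 1) * ∑ J, S J * ((-1) ^ (r : ℕ) *
      f (J 0) r * (Matrix.of fun α β : Fin k => f (J α.succ) (r.succAbove β)).det) := by
  set R : (Fin (k + 1) → ι) → ℂ := fun J => S J * ((-1) ^ (r : ℕ) *
      f (J 0) r * (Matrix.of fun α β : Fin k => f (J α.succ) (r.succAbove β)).det) with hR
  -- The cycle that brings row `i` to the front has sign `(-1)^i`, which is the row part of the
  -- cofactor sign.
  have h1 : ∀ J, S J * (Matrix.of fun α β => f (J α) β).det
      = ∑ i : Fin (k + 1), R (fun a => J (i.cycleRange.symm a)) := by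
    intro J
    rw [Matrix.det_succ_column _ r, Finset.mul_sum]
    refine Finset.sum_congr rfl fun i _ => ?_
    simp only [hR, hS, Fin.cycleRange_symm_zero, Fin.cycleRange_symm_succ, Equiv.Perm.sign_symm,
      Fin.sign_cycleRange]
    rw [pow_add]
    push_cast
    rw [show (Matrix.of fun α β => f (J α) β).submatrix i.succAbove r.succAbove
      = Matrix.of fun α β : Fin k => f (J (i.succAbove α)) (r.succAbove β) from rfl,
      Matrix.of_apply]
    ring
  rw [Finset.sum_congr rfl fun J _ => h1 J, Finset.sum_comm]
  have h2 : ∀ i : Fin (k + 1), ∑ J : Fin (k + 1) → ι, R (fun a => J (i.cycleRange.symm a)) = ∑ J, R J :=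
    fun i => Equiv.sum_comp (Equiv.arrowCongr i.cycleRange (Equiv.refl ι)) R
  rw [Finset.sum_congr rfl fun i _ => h2 i]
  simp

/-- Andréief's identity for a Vandermonde determinant. -/
theorem sum_prod_mul_vdm_mul_det {ι : Type*} [Fintype ι] {k : ℕ} (wt κ : ι → ℂ)
    (f : ι → Fin k → ℂ) :
    ∑ I : Fin k → ι, (∏ j, wt (I j)) * (vdm (fun j => κ (I j)) *
        (Matrix.of fun α β => f (I α) β).det)
      = (k.factorial : ℂ) *
        (Matrix.of fun β a : Fin k => ∑ i, wt i * f i β * (-κ i) ^ (a : ℕ)).det := by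
  set R : (Fin k → ι) → ℂ := fun I =>
    (∏ j, wt (I j)) * (vdm (fun j => κ (I j)) * ∏ β, f (I β) β) with hR
  -- The sign of `σ` in the Leibniz formula is absorbed by permuting the Vandermonde factor, so all
  -- permutations contribute equally after relabelling.
  have h1 : ∀ I : Fin k → ι, (∏ j, wt (I j)) * (vdm (fun j => κ (I j)) *
      (Matrix.of fun α β => f (I α) β).det) = ∑ σ : Equiv.Perm (Fin k), R (fun a => I (σ a)) := by
    intro I
    rw [Matrix.det_apply', Finset.mul_sum, Finset.mul_sum]
    refine Finset.sum_congr rfl fun σ _ => ?_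
    simp only [hR, Matrix.of_apply]
    rw [vdm_comp_perm (fun j => κ (I j)) σ, Equiv.prod_comp σ fun j => wt (I j)]
    ring
  rw [Finset.sum_congr rfl fun I _ => h1 I, Finset.sum_comm]
  have h2 : ∀ σ : Equiv.Perm (Fin k), ∑ I : Fin k → ι, R (fun a => I (σ a)) = ∑ I, R I := fun σ =>
    Equiv.sum_comp (Equiv.arrowCongr σ.symm (Equiv.refl ι)) R
  rw [Finset.sum_congr rfl fun σ _ => h2 σ, Finset.sum_const, Finset.card_univ, Fintype.card_perm,
    Fintype.card_fin, nsmul_eq_mul]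
  congr 1
  have h3 := (Matrix.detRowAlternating (R := ℂ) (n := Fin k)).toMultilinearMap.map_sum
    (fun (β : Fin k) (i : ι) => fun a : Fin k => wt i * f i β * (-κ i) ^ (a : ℕ))
  have h4 : (Matrix.of fun β a : Fin k => ∑ i, wt i * f i β * (-κ i) ^ (a : ℕ)).det
      = ∑ I : Fin k → ι, (Matrix.of fun β a : Fin k =>
        wt (I β) * f (I β) β * (-κ (I β)) ^ (a : ℕ)).det := by
    refine Eq.trans ?_ h3
    change Matrix.det _ = Matrix.det _
    congr 1
    ext β a
    simp [Finset.sum_apply]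
  rw [h4]
  refine Finset.sum_congr rfl fun I _ => ?_
  have h5 := Matrix.det_mul_column (fun β : Fin k => wt (I β) * f (I β) β)
    (Matrix.vandermonde fun β => -κ (I β))
  simp only [Matrix.vandermonde_apply] at h5
  rw [h5, ← vdm_eq_det (fun β => κ (I β)), hR, Finset.prod_mul_distrib]
  ring

/-! ### Polynomial identities at the nodes -/

open Polynomial in
theorem coeff_iterate_divX (p : ℂ[X]) (k n : ℕ) : (divX^[k] p).coeff n = p.coeff (n + k) := by
  induction k generalizing p with
  | zero => rfl
  | succ k ih => rw [Function.iterate_succ_apply, ih, coeff_divX, add_assoc]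

open Polynomial in
-- The truncation is `divX^[k] r - v * divX^[k+1] r`; at `v` everything cancels except the constant
-- term of `divX^[k] r`.
theorem eval_iterate_divX_mul (r : ℂ[X]) (v : ℂ) (k : ℕ) :
    (divX^[k + 1] ((X - C v) * r)).eval v = r.coeff k := by
  have h1 : divX^[k + 1] ((X - C v) * r) = divX^[k] r - C v * divX^[k + 1] r := by
    ext n
    rw [coeff_sub, coeff_C_mul, coeff_iterate_divX, coeff_iterate_divX, coeff_iterate_divX, sub_mul,
      coeff_sub, coeff_C_mul, ← add_assoc, coeff_X_mul]
  have h2 := congrArg (Polynomial.eval v) (X_mul_divX_add (divX^[k] r))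
  rw [← Function.iterate_succ_apply' divX, coeff_iterate_divX] at h2
  rw [h1, eval_sub, eval_mul, eval_C]
  simp only [eval_add, eval_mul, eval_X, eval_C, zero_add] at h2
  rw [← h2]
  ring

open Polynomial in
/-- `Q_q` without the factors of the nodes of `I`. -/
def complPoly {k : ℕ} (x : Fin (d + N) → ℤ) (q : ℝ) (I : Fin k → Fin (d + N)) : ℂ[X] :=
  ∏ i ∈ Finset.univ \ Finset.univ.image I, (X - C (node x q i))

theorem complPoly_comp_perm {k : ℕ} (x : Fin (d + N) → ℤ) (q : ℝ) (I : Fin k → Fin (d + N))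
    (σ : Equiv.Perm (Fin k)) : complPoly x q (fun i => I (σ i)) = complPoly x q I := by
  have : Finset.univ.image (fun i => I (σ i)) = Finset.univ.image I := by
    ext i
    simp only [Finset.mem_image, Finset.mem_univ, true_and]
    exact ⟨fun ⟨a, h⟩ => ⟨σ a, h⟩, fun ⟨a, h⟩ => ⟨σ.symm a, by simpa using h⟩⟩
  rw [complPoly, this, complPoly]

open Polynomial in
theorem complPoly_mul_prod {k : ℕ} (x : Fin (d + N) → ℤ) (q : ℝ) {I : Fin k → Fin (d + N)}
    (hI : Function.Injective I) :
    complPoly x q I * ∏ j, (X - C (node x q (I j))) = ∏ i, (X - C (node x q i)) := by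
  rw [complPoly, ← Finset.prod_image (s := Finset.univ) (g := I)
    (f := fun i => X - C (node x q i)) hI.injOn]
  exact Finset.prod_sdiff (Finset.subset_univ _)

open Polynomial in
theorem complPoly_eq_mul_cons {k : ℕ} (x : Fin (d + N) → ℤ) (q : ℝ) {j : Fin (d + N)}
    {I : Fin k → Fin (d + N)} (hI : Function.Injective (Fin.cons j I : Fin (k + 1) → Fin (d + N))) :
    complPoly x q I = (X - C (node x q j)) * complPoly x q (Fin.cons j I : Fin (k + 1) → _) := by
  rw [complPoly, complPoly]
  have h1 : Finset.univ.image (Fin.cons j I : Fin (k + 1) → Fin (d + N))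
      = insert j (Finset.univ.image I) := by
    ext i
    simp [Fin.exists_fin_succ, eq_comm]
  have h2 : j ∉ Finset.univ.image I := by
    simp only [Finset.mem_image, Finset.mem_univ, true_and, not_exists]
    exact fun a h => (Fin.cons_injective_iff.1 hI).1 ⟨a, h⟩
  rw [h1, ← Finset.mul_prod_erase _ _ (show j ∈ Finset.univ \ Finset.univ.image I by simpa using h2)]
  congr 2
  ext i
  simp only [Finset.mem_erase, Finset.mem_sdiff, Finset.mem_univ, true_and, Finset.mem_insert]
  tauto

theorem complPoly_monic {k : ℕ} (x : Fin (d + N) → ℤ) (q : ℝ) (I : Fin k → Fin (d + N)) :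
    (complPoly x q I).Monic := Polynomial.monic_prod_of_monic _ _ fun _ _ => Polynomial.monic_X_sub_C _

theorem natDegree_complPoly (x : Fin (d + N) → ℤ) (q : ℝ) {I : Fin d → Fin (d + N)}
    (hI : Function.Injective I) : (complPoly x q I).natDegree = N := by
  rw [complPoly, Polynomial.natDegree_prod_of_monic _ _ fun _ _ => Polynomial.monic_X_sub_C _]
  simp only [Polynomial.natDegree_X_sub_C, Finset.sum_const, smul_eq_mul, mul_one]
  rw [Finset.card_sdiff_of_subset (Finset.subset_univ _), Finset.card_image_of_injective _ hI]
  simp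

/-- The coefficient formula of Lagrange interpolation; it plays the role of a residue at infinity.
-/
theorem sum_nodeWeight_mul_eval {q : ℝ} (hq0 : 0 < q) (hq1 : q < 1) {x : Fin (d + N) → ℤ}
    (hx : StrictAnti x) {p : Polynomial ℂ} (hp : p.degree < ((d + N : ℕ) : WithBot ℕ)) :
    ∑ j, nodeWeight x q j * p.eval (node x q j) = p.coeff (d + N - 1) := by
  have h := Lagrange.coeff_eq_sum (s := Finset.univ) (v := node x q)
    (node_injective hq0 hq1 hx).injOn (P := p) (by simpa using hp)
  rw [Finset.card_univ, Fintype.card_fin] at h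
  rw [h]
  refine Finset.sum_congr rfl fun i _ => ?_
  rw [nodeWeight, Lagrange.nodalWeight, Finset.prod_inv_distrib, mul_comm]
  rfl

theorem sum_nodeWeight_mul_eval_eq_zero {q : ℝ} (hq0 : 0 < q) (hq1 : q < 1)
    {x : Fin (d + N) → ℤ} (hx : StrictAnti x) {p : Polynomial ℂ} (hp : p.natDegree + 1 < d + N) :
    ∑ j, nodeWeight x q j * p.eval (node x q j) = 0 := by
  rw [sum_nodeWeight_mul_eval hq0 hq1 hx]
  · exact Polynomial.coeff_eq_zero_of_natDegree_lt (by omega)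
  · exact Polynomial.degree_le_natDegree.trans_lt (by exact_mod_cast (by omega))

open Polynomial in
-- Up to terms that vanish at all nodes, the summand is the value of a polynomial whose degree
-- reaches `d + N - 1` only for `a = b`, in which case it is monic.
theorem sum_nodeWeight_divX_complPoly {q : ℝ} (hq0 : 0 < q) (hq1 : q < 1)
    {x : Fin (d + N) → ℤ} (hx : StrictAnti x) {I : Fin d → Fin (d + N)}
    (hI : Function.Injective I) {a b : ℕ} (ha : a < N) (hb : b < N) :
    ∑ j, nodeWeight x q j * (node x q j ^ a * ((divX^[b + 1] (complPoly x q I)).eval (node x q j) *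
      ∏ i, (node x q j - node x q (I i)))) = if a = b then 1 else 0 := by
  set p := complPoly x q I with hp
  set E : ℂ[X] := ∏ i, (X - C (node x q (I i))) with hE
  have hEm : E.Monic := monic_prod_of_monic _ _ fun _ _ => monic_X_sub_C _
  have hEd : E.natDegree = d := by
    rw [hE, natDegree_prod_of_monic _ _ fun _ _ => monic_X_sub_C _]; simp
  have hpN : p.natDegree = N := natDegree_complPoly x q hI
  have hpm : p.leadingCoeff = 1 := complPoly_monic x q I
  have hpc : p.coeff N = 1 := by rw [leadingCoeff, hpN] at hpm; exact hpm
  have hEe : ∀ z, E.eval z = ∏ i, (z - node x q (I i)) := fun z => by simp [hE, eval_prod]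
  have hdd : (divX^[b + 1] p).natDegree ≤ N - (b + 1) := by
    refine natDegree_le_iff_coeff_eq_zero.2 fun n hn => ?_
    rw [coeff_iterate_divX]
    exact coeff_eq_zero_of_natDegree_lt (by omega)
  rcases le_or_gt a b with hab | hab
  · have hdeg : (X ^ a * divX^[b + 1] p * E).natDegree ≤ a + (N - (b + 1)) + d := by
      refine natDegree_mul_le_of_le (natDegree_mul_le_of_le (natDegree_X_pow_le _) hdd) hEd.le
    have h1 : ∀ j, nodeWeight x q j * (node x q j ^ a * ((divX^[b + 1] p).eval (node x q j) *
        ∏ i, (node x q j - node x q (I i))))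
        = nodeWeight x q j * (X ^ a * divX^[b + 1] p * E).eval (node x q j) := by
      intro j
      rw [eval_mul, eval_mul, eval_pow, eval_X, hEe, mul_assoc]
    rw [Finset.sum_congr rfl fun j _ => h1 j]
    split_ifs with h
    · subst h
      rw [sum_nodeWeight_mul_eval hq0 hq1 hx
        (degree_le_natDegree.trans_lt (by exact_mod_cast (by omega)))]
      have hm : (divX^[a + 1] p).Monic := monic_of_natDegree_le_of_coeff_eq_one _ hdd (by
        rw [coeff_iterate_divX, Nat.sub_add_cancel (by omega), hpc])
      have hdd' : (divX^[a + 1] p).natDegree = N - (a + 1) := by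
        refine le_antisymm hdd (le_natDegree_of_ne_zero ?_)
        rw [coeff_iterate_divX, Nat.sub_add_cancel (by omega), hpc]
        exact one_ne_zero
      have hM := ((monic_X_pow a).mul hm).mul hEm
      have hMd : (X ^ a * divX^[a + 1] p * E).natDegree = d + N - 1 := by
        rw [((monic_X_pow a).mul hm).natDegree_mul hEm, (monic_X_pow a).natDegree_mul hm,
          natDegree_X_pow, hdd', hEd]
        omega
      rw [← hMd]
      exact hM
    · exact sum_nodeWeight_mul_eval_eq_zero hq0 hq1 hx (by omega)
  · rw [if_neg (by omega)]
    -- For `a > b` the degree is too large. Since `p * E` vanishes at the nodes, `X^(b+1) *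
    -- divX^[b+1] p` may be replaced by minus the low part of `p`.
    set low := p - X ^ (b + 1) * divX^[b + 1] p with hlow
    have hlowd : low.natDegree ≤ b := by
      refine natDegree_le_iff_coeff_eq_zero.2 fun n hn => ?_
      obtain ⟨c, rfl⟩ : ∃ c, n = c + (b + 1) := ⟨n - (b + 1), by omega⟩
      rw [hlow, coeff_sub, coeff_X_pow_mul, coeff_iterate_divX, sub_self]
    have hdeg : (X ^ (a - (b + 1)) * low * E).natDegree ≤ a - (b + 1) + b + d :=
      natDegree_mul_le_of_le (natDegree_mul_le_of_le (natDegree_X_pow_le _) hlowd) hEd.le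
    have h1 : ∀ j, nodeWeight x q j * (node x q j ^ a * ((divX^[b + 1] p).eval (node x q j) *
        ∏ i, (node x q j - node x q (I i))))
        = -(nodeWeight x q j * (X ^ (a - (b + 1)) * low * E).eval (node x q j)) := by
      intro j
      have h2 : (p * E).eval (node x q j) = 0 := by
        rw [hp, hE, complPoly_mul_prod x q hI, eval_prod]
        exact Finset.prod_eq_zero (Finset.mem_univ j) (by simp)
      rw [eval_mul] at h2
      have h3 : node x q j ^ a = node x q j ^ (a - (b + 1)) * node x q j ^ (b + 1) := by
        rw [← pow_add]; congr 1; omega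
      rw [eval_mul, eval_mul, eval_pow, eval_X, hlow, eval_sub, eval_mul, eval_pow, eval_X,
        ← hEe, h3]
      linear_combination (nodeWeight x q j * node x q j ^ (a - (b + 1))) * h2
    rw [Finset.sum_congr rfl fun j _ => h1 j, Finset.sum_neg_distrib,
      sum_nodeWeight_mul_eval_eq_zero hq0 hq1 hx (by omega), neg_zero]

/-! ### Orthogonality relations -/

/-- The coefficient of `z^{-b-1}` in `Q_q(z) Ω_q(v, z) / (z - v)`, as a sum over the nodes. -/
def rSum (y : Fin d → ℤ) (x : Fin (d + N) → ℤ) (q : ℝ) (b : ℕ) (v : ℂ) : ℂ :=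
  ∑ I : Fin d → Fin (d + N), (∏ j, cutWeight y x q (I j)) *
    (((Polynomial.divX^[b + 1] (complPoly x q I)).eval v * ∏ i, (v - node x q (I i))) *
      (vdm (fun j => node x q (I j)) * deltaCut N y q (fun j => node x q (I j))))

theorem vdm_node_eq_zero {k : ℕ} {x : Fin (d + N) → ℤ} {q : ℝ} {I : Fin k → Fin (d + N)}
    (hI : ¬ Function.Injective I) : vdm (fun j => node x q (I j)) = 0 :=
  vdm_eq_zero_of_not_injective fun h => hI (Function.Injective.of_comp (f := node x q) h)

theorem node_cons {k : ℕ} (x : Fin (d + N) → ℤ) (q : ℝ) (i : Fin (d + N)) (I : Fin k → Fin (d + N)) :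
    (fun j => node x q ((Fin.cons i I : Fin (k + 1) → Fin (d + N)) j))
      = (Fin.cons (node x q i) (fun j => node x q (I j)) : Fin (k + 1) → ℂ) := by
  funext j
  induction j using Fin.cases <;> simp

/-- The relation holds for each index tuple `I`; tuples with repetitions drop out through the
Vandermonde factor. -/
theorem sum_nodeWeight_mul_rSum {q : ℝ} (hq0 : 0 < q) (hq1 : q < 1) (y : Fin d → ℤ)
    {x : Fin (d + N) → ℤ} (hx : StrictAnti x) {a b : ℕ} (ha : a < N) (hb : b < N) :
    ∑ j, nodeWeight x q j * (node x q j ^ a * rSum y x q b (node x q j))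
      = if a = b then omegaSum y x q else 0 := by
  have h1 : ∀ I : Fin d → Fin (d + N), ∑ j, nodeWeight x q j * (node x q j ^ a *
      ((∏ j, cutWeight y x q (I j)) * (((Polynomial.divX^[b + 1] (complPoly x q I)).eval
        (node x q j) * ∏ i, (node x q j - node x q (I i))) *
      (vdm (fun j => node x q (I j)) * deltaCut N y q (fun j => node x q (I j))))))
      = (if a = b then 1 else 0) * ((∏ j, cutWeight y x q (I j)) *
      (vdm (fun j => node x q (I j)) * deltaCut N y q (fun j => node x q (I j)))) := by
    intro I
    by_cases hI : Function.Injective I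
    · rw [← sum_nodeWeight_divX_complPoly hq0 hq1 hx hI ha hb, Finset.sum_mul]
      exact Finset.sum_congr rfl fun j _ => by ring
    · simp [vdm_node_eq_zero hI]
  simp only [rSum, Finset.mul_sum]
  rw [Finset.sum_comm, Finset.sum_congr rfl fun I _ => h1 I, ← Finset.mul_sum, omegaSum]
  split_ifs <;> simp

/-- Joining `j` to `I` turns the truncated polynomial at node `j` into a coefficient of `complPoly`
for the enlarged tuple, which is symmetric in all `d + 1` indices. What remains antisymmetrizes to a
determinant in which column `l` occurs twice. -/
theorem sum_cutWeight_mul_rSum (q : ℝ) (y : Fin d → ℤ) (x : Fin (d + N) → ℤ) (b : ℕ) (l : Fin d) :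
    ∑ j, cutWeight y x q j * (calPt d q (N - 1) (y l) (node x q j) * rSum y x q b (node x q j))
      = 0 := by
  set S : (Fin (d + 1) → Fin (d + N)) → ℂ := fun J => (∏ j, cutWeight y x q (J j)) *
    ((complPoly x q J).coeff b * vdm (fun j => node x q (J j))) with hS
  set f : Fin (d + N) → Fin (d + 1) → ℂ := fun i => Fin.cons
    (calPt d q (N - 1) (y l) (node x q i)) fun β => calPt d q (N - 1) (y β) (node x q i) with hf
  have h1 : ∀ (j : Fin (d + N)) (I : Fin d → Fin (d + N)),
      cutWeight y x q j * (calPt d q (N - 1) (y l) (node x q j) *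
      ((∏ j, cutWeight y x q (I j)) * (((Polynomial.divX^[b + 1] (complPoly x q I)).eval
        (node x q j) * ∏ i, (node x q j - node x q (I i))) *
      (vdm (fun j => node x q (I j)) * deltaCut N y q (fun j => node x q (I j))))))
      = (fun J => S J * ((-1) ^ ((0 : Fin (d + 1)) : ℕ) * f (J 0) 0 *
        (Matrix.of fun α β : Fin d => f (J α.succ) ((0 : Fin (d + 1)).succAbove β)).det))
        (Fin.cons j I) := by
    intro j I
    have hdet : (Matrix.of fun α β : Fin d => f ((Fin.cons j I : Fin (d + 1) → Fin (d + N)) α.succ)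
        ((0 : Fin (d + 1)).succAbove β)).det = deltaCut N y q (fun j => node x q (I j)) := by
      simp [hf, deltaCut]
    have hv : vdm (fun i => node x q ((Fin.cons j I : Fin (d + 1) → Fin (d + N)) i))
        = (∏ i, (node x q j - node x q (I i))) * vdm (fun j => node x q (I j)) := by
      rw [node_cons, vdm_cons]
    have hc : (Polynomial.divX^[b + 1] (complPoly x q I)).eval (node x q j) *
        ((∏ i, (node x q j - node x q (I i))) * vdm (fun j => node x q (I j)))
        = (complPoly x q (Fin.cons j I : Fin (d + 1) → Fin (d + N))).coeff b *
        ((∏ i, (node x q j - node x q (I i))) * vdm (fun j => node x q (I j))) := by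
      by_cases hI : Function.Injective (Fin.cons j I : Fin (d + 1) → Fin (d + N))
      · rw [complPoly_eq_mul_cons x q hI, eval_iterate_divX_mul]
      · rw [← hv, vdm_node_eq_zero hI, mul_zero, mul_zero]
    beta_reduce
    rw [hdet]
    simp only [hS, hv, Fin.prod_univ_succ, Fin.cons_zero, Fin.cons_succ]
    simp only [hf, Fin.cons_zero, Fin.val_zero, pow_zero, one_mul]
    linear_combination (cutWeight y x q j * calPt d q (N - 1) (y l) (node x q j) *
      (∏ j, cutWeight y x q (I j)) * deltaCut N y q (fun j => node x q (I j))) * hc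
  have h2 := sum_antisymm_mul_det S (fun σ J => by
    simp only [hS]
    rw [complPoly_comp_perm, vdm_comp_perm (fun j => node x q (J j)) σ,
      Equiv.prod_comp σ fun j => cutWeight y x q (J j)]
    ring) f 0
  have h3 : ∑ J : Fin (d + 1) → Fin (d + N), S J * (Matrix.of fun α β => f (J α) β).det = 0 := by
    refine Finset.sum_eq_zero fun J _ => ?_
    rw [Matrix.det_zero_of_column_eq (Fin.succ_ne_zero l).symm (fun α => by simp [hf]), mul_zero]
  rw [h3] at h2
  have h4 := (mul_eq_zero.1 h2.symm).resolve_left (by exact_mod_cast Nat.succ_ne_zero d)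
  simp only [rSum, Finset.mul_sum]
  rw [Finset.sum_congr rfl fun j _ => Finset.sum_congr rfl fun I _ => h1 j I]
  exact (sum_fin_succ_fun _).symm.trans h4

/-! ### Orthogonality relations for `F_r` and `Ω̃` -/

section Succ

variable {e : ℕ}

/-- Antisymmetrization assembles the determinant of `𝒫̃` with column `r` replaced by column `l`: two
columns coincide for `r ≠ l`, and nothing changes for `r = l`. The factor `e + 1` counts the rows in
the expansion. -/
theorem sum_cutWeight_mul_frSum (q : ℝ) (y : Fin (e + 1) → ℤ) (x : Fin (e + 1 + N) → ℤ)
    (r l : Fin (e + 1)) :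
    ((e : ℂ) + 1) * ∑ j, cutWeight y x q j * (calPt (e + 1) q (N - 1) (y l) (node x q j) *
      ((-1) ^ (r : ℕ) * frSum y x q r (node x q j))) = if r = l then omegaSum y x q else 0 := by
  set S : (Fin (e + 1) → Fin (e + 1 + N)) → ℂ := fun J => (∏ j, cutWeight y x q (J j)) *
    vdm (fun j => node x q (J j)) with hS
  set f : Fin (e + 1 + N) → Fin (e + 1) → ℂ := fun i β =>
    calPt (e + 1) q (N - 1) (y (if β = r then l else β)) (node x q i) with hf
  have h1 : ∀ (j : Fin (e + 1 + N)) (I : Fin e → Fin (e + 1 + N)),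
      cutWeight y x q j * (calPt (e + 1) q (N - 1) (y l) (node x q j) *
      ((-1) ^ (r : ℕ) * ((∏ j, cutWeight y x q (I j)) *
      ((Matrix.of fun α β : Fin e =>
        calPt (e + 1) q (N - 1) (y (r.succAbove β)) (node x q (I α))).det
      * vdm (Fin.cons (node x q j) (fun j => node x q (I j)) : Fin (e + 1) → ℂ)))))
      = (fun J => S J * ((-1) ^ (r : ℕ) * f (J 0) r *
        (Matrix.of fun α β : Fin e => f (J α.succ) (r.succAbove β)).det)) (Fin.cons j I) := by
    intro j I
    simp only [hS, hf, Fin.prod_univ_succ, Fin.cons_zero, Fin.cons_succ, if_true,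
      Fin.succAbove_ne, if_false, node_cons]
    ring
  have h2 := sum_antisymm_mul_det S (fun σ J => by
    simp only [hS]
    rw [vdm_comp_perm (fun j => node x q (J j)) σ,
      Equiv.prod_comp σ fun j => cutWeight y x q (J j)]
    ring) f r
  have h3 : ∑ j, cutWeight y x q j * (calPt (e + 1) q (N - 1) (y l) (node x q j) *
      ((-1) ^ (r : ℕ) * frSum y x q r (node x q j))) = ∑ J, S J * ((-1) ^ (r : ℕ) * f (J 0) r *
        (Matrix.of fun α β : Fin e => f (J α.succ) (r.succAbove β)).det) := by
    simp only [frSum, Finset.mul_sum]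
    rw [Finset.sum_congr rfl fun j _ => Finset.sum_congr rfl fun I _ => h1 j I]
    exact (sum_fin_succ_fun fun J => S J * ((-1) ^ (r : ℕ) * f (J 0) r *
        (Matrix.of fun α β : Fin e => f (J α.succ) (r.succAbove β)).det)).symm
  rw [h3, ← h2]
  split_ifs with hrl
  · subst hrl
    rw [omegaSum]
    refine Finset.sum_congr rfl fun J _ => ?_
    rw [hS, mul_assoc, deltaCut]
    congr 3
    ext α β
    simp only [hf, Matrix.of_apply]
    split_ifs with h
    · rw [h]
    · rfl
  · refine Finset.sum_eq_zero fun J _ => ?_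
    rw [Matrix.det_zero_of_column_eq hrl (fun α => by simp [hf]), mul_zero]

/-- In its argument `frSum` has degree at most `e`, so the product with a power below `N` stays
under the critical degree `e + N`. -/
theorem sum_nodeWeight_mul_frSum {q : ℝ} (hq0 : 0 < q) (hq1 : q < 1) (y : Fin (e + 1) → ℤ)
    {x : Fin (e + 1 + N) → ℤ} (hx : StrictAnti x) (r : Fin (e + 1)) {a : ℕ} (ha : a < N) :
    ∑ j, nodeWeight x q j * (node x q j ^ a * frSum y x q r (node x q j)) = 0 := by
  simp only [frSum, Finset.mul_sum]
  rw [Finset.sum_comm]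
  refine Finset.sum_eq_zero fun I _ => ?_
  open Polynomial in
  have h := sum_nodeWeight_mul_eval_eq_zero hq0 hq1 hx
    (p := X ^ a * ∏ i, (X - C (node x q (I i)))) (by
      refine (Nat.succ_le_succ (natDegree_mul_le_of_le (natDegree_X_pow_le _)
        (natDegree_prod_of_monic _ _ fun _ _ => monic_X_sub_C _).le)).trans_lt ?_
      simp
      omega)
  simp only [Polynomial.eval_mul, Polynomial.eval_pow, Polynomial.eval_X, Polynomial.eval_prod,
    Polynomial.eval_sub, Polynomial.eval_C] at h
  calc _ = (∑ j, nodeWeight x q j * (node x q j ^ a * ∏ i, (node x q j - node x q (I i)))) *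
      ((∏ j, cutWeight y x q (I j)) * ((Matrix.of fun α β : Fin e =>
        calPt (e + 1) q (N - 1) (y (r.succAbove β)) (node x q (I α))).det *
          vdm (fun j => node x q (I j)))) := by
        rw [Finset.sum_mul]
        refine Finset.sum_congr rfl fun j _ => ?_
        rw [vdm_cons]
        ring
    _ = 0 := by rw [h, zero_mul]

theorem sum_cutWeight_mul_omegaTilde (q : ℝ) (y : Fin (e + 1) → ℤ) (x : Fin (e + 1 + N) → ℤ)
    (n : ℕ) (t : ℤ) (l : Fin (e + 1)) :
    ∑ j, cutWeight y x q j * (calPt (e + 1) q (N - 1) (y l) (node x q j) * (((e : ℂ) + 1) *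
      ∑ r : Fin (e + 1), (-1) ^ (r : ℕ) * (hq q (e + 1) n (t - y r) : ℂ) *
        frSum y x q r (node x q j))) = hq q (e + 1) n (t - y l) * omegaSum y x q := by
  have h := sum_cutWeight_mul_frSum (N := N) q y x
  calc _ = ∑ r : Fin (e + 1), (hq q (e + 1) n (t - y r) : ℂ) * (((e : ℂ) + 1) *
      ∑ j, cutWeight y x q j * (calPt (e + 1) q (N - 1) (y l) (node x q j) *
      ((-1) ^ (r : ℕ) * frSum y x q r (node x q j)))) := by
        simp only [Finset.mul_sum]
        rw [Finset.sum_comm]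
        exact Finset.sum_congr rfl fun r _ => Finset.sum_congr rfl fun j _ => by ring
    _ = _ := by simp [h]

theorem sum_nodeWeight_mul_omegaTilde {q : ℝ} (hq0 : 0 < q) (hq1 : q < 1) (y : Fin (e + 1) → ℤ)
    {x : Fin (e + 1 + N) → ℤ} (hx : StrictAnti x) (n : ℕ) (t : ℤ) (a : ℕ) (ha : a < N) :
    ∑ j, nodeWeight x q j * (node x q j ^ a * (((e : ℂ) + 1) *
      ∑ r : Fin (e + 1), (-1) ^ (r : ℕ) * (hq q (e + 1) n (t - y r) : ℂ) *
        frSum y x q r (node x q j))) = 0 := by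
  calc _ = ∑ r : Fin (e + 1), (hq q (e + 1) n (t - y r) : ℂ) * (((e : ℂ) + 1) * (-1) ^ (r : ℕ) *
      ∑ j, nodeWeight x q j * (node x q j ^ a * frSum y x q r (node x q j))) := by
        simp only [Finset.mul_sum]
        rw [Finset.sum_comm]
        exact Finset.sum_congr rfl fun r _ => Finset.sum_congr rfl fun j _ => by ring
    _ = _ := by simp [sum_nodeWeight_mul_frSum hq0 hq1 y hx _ ha]

end Succ

/-! ### Inversion of the top matrix -/

theorem calP_zpow {q : ℝ} (hq0 : 0 < q) (L : ℕ) (r : ℤ) :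
    calP q L ((q : ℂ) ^ r) = (qRatio q L r : ℂ) := by
  have hqc : (q : ℂ) ≠ 0 := by exact_mod_cast hq0.ne'
  rw [calP, qPoch, qPoch, ← Finset.prod_div_distrib, qRatio]
  push_cast
  refine Finset.prod_congr rfl fun j _ => ?_
  rw [zpow_add₀ hqc, zpow_add₀ hqc, zpow_one, zpow_natCast, pow_succ']

/-- The spread condition enters here. A node with `x_j ≥ y_b` for some `b` has `x_j - y_l ≥ -(N -
1)`, so the polynomial form of `h` is valid even if `x_j < y_l`; for all other nodes `h` vanishes.
Thus the same cut serves every row. -/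
theorem topMat_of_lt_mul_nodeWeight {q : ℝ} (hq0 : 0 < q) (hq1 : q < 1) {y : Fin d → ℤ}
    (hspread : ∀ i j, y i - y j ≤ (N : ℤ) - 1) (x : Fin (d + N) → ℤ) (l : Fin (d + N))
    (hl : (l : ℕ) < d) (j : Fin (d + N)) :
    (topMat y x q l j : ℂ) * nodeWeight x q j = node x q j ^ d *
      (cutWeight y x q j * calPt d q (N - 1) (y ⟨l, hl⟩) (node x q j)) := by
  have hqc : (q : ℂ) ≠ 0 := by exact_mod_cast hq0.ne'
  rw [topMat, Matrix.of_apply, entrance_of_lt hq0.ne' _ _ _ hl, yFull_of_lt _ _ hl, cutWeight]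
  split_ifs with h
  · obtain ⟨b, hb⟩ := h
    have h1 := hspread ⟨l, hl⟩ b
    have h2 := hspread b b
    -- The spread condition with `i = j` forces `N ≥ 1`.
    obtain ⟨M, rfl⟩ : ∃ M, N = M + 1 := ⟨N - 1, by omega⟩
    rw [hq_eq_qRatio hq0 hq1 _ _ _ (by push_cast at h1; omega), Nat.add_sub_cancel, calPt, node,
      ← zpow_add₀ hqc, ← sub_eq_add_neg, calP_zpow hq0]
    push_cast
    rw [← zpow_natCast ((q : ℂ) ^ x j), ← zpow_natCast (q : ℂ), ← zpow_mul, ← zpow_mul,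
      show (d : ℤ) * (x j - y ⟨l, hl⟩) = x j * d + -(d * y ⟨l, hl⟩) by ring, zpow_add₀ hqc]
    ring
  · push Not at h
    rw [hq_of_neg _ _ _ (by have := h ⟨l, hl⟩; omega)]
    simp

theorem topMat_of_ge {q : ℝ} (hq0 : 0 < q) (hq1 : q < 1) (y : Fin d → ℤ) (x : Fin (d + N) → ℤ)
    (l : Fin (d + N)) (hl : d ≤ (l : ℕ)) (j : Fin (d + N)) :
    (topMat y x q l j : ℂ) = node x q j ^ d * (node x q j ^ ((l : ℕ) - d) *
      (qFact q (d + N - (l + 1)) : ℂ)⁻¹) := by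
  rw [topMat, Matrix.of_apply, entrance_of_ge_of_lt hq0 hq1 _ _ _ hl l.2, node]
  push_cast
  rw [← mul_assoc, ← pow_add, Nat.add_sub_cancel' hl, ← zpow_natCast ((q : ℂ) ^ x j), ← zpow_mul,
    mul_comm (x j), zpow_mul, zpow_natCast]

/-- The equations that determine a column of the inverse of the top matrix. -/
theorem sum_topMat_mul {q : ℝ} (hq0 : 0 < q) (hq1 : q < 1) {y : Fin d → ℤ}
    (hspread : ∀ i j, y i - y j ≤ (N : ℤ) - 1) (x : Fin (d + N) → ℤ) {G E : Fin (d + N) → ℂ}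
    (h1 : ∀ l : Fin d, ∑ j, cutWeight y x q j * (calPt d q (N - 1) (y l) (node x q j) * G j)
      = E (Fin.castAdd N l))
    (h2 : ∀ a : Fin N, ∑ j, nodeWeight x q j * (node x q j ^ (a : ℕ) * G j)
      = qFact q (N - (a + 1)) * E (Fin.natAdd d a)) (l : Fin (d + N)) :
    ∑ j, (topMat y x q l j : ℂ) * ((node x q j ^ d)⁻¹ * nodeWeight x q j * G j) = E l := by
  have hk : ∀ j, node x q j ^ d ≠ 0 := fun j => pow_ne_zero _ (node_ne_zero hq0 x j)
  induction l using Fin.addCases with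
  | left l =>
    rw [← h1 l]
    refine Finset.sum_congr rfl fun j _ => ?_
    have := topMat_of_lt_mul_nodeWeight hq0 hq1 hspread x (Fin.castAdd N l) l.2 j
    change _ = node x q j ^ d * (cutWeight y x q j * calPt d q (N - 1) (y l) (node x q j)) at this
    linear_combination ((node x q j ^ d)⁻¹ * G j) * this + (cutWeight y x q j *
      calPt d q (N - 1) (y l) (node x q j) * G j) * inv_mul_cancel₀ (hk j)
  | right a =>
    have hf : (qFact q (N - (a + 1)) : ℂ) ≠ 0 := by exact_mod_cast (qFact_pos hq0 hq1 _).ne'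
    rw [← mul_right_injective₀ hf |>.eq_iff, ← h2 a, Finset.mul_sum]
    refine Finset.sum_congr rfl fun j _ => ?_
    rw [topMat_of_ge hq0 hq1 y x _ (by simp), Fin.val_natAdd, Nat.add_sub_cancel_left,
      show d + N - (d + (a : ℕ) + 1) = N - (a + 1) by omega]
    have := hk j
    field_simp

theorem sum_inv_topMat_mul {y : Fin d → ℤ} {x : Fin (d + N) → ℤ} {q : ℝ}
    (hA : (topMat y x q).det ≠ 0) {B E : Fin (d + N) → ℂ}
    (h : ∀ l, ∑ j, (topMat y x q l j : ℂ) * B j = E l) (j : Fin (d + N)) :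
    ∑ l, (((topMat y x q)⁻¹ j l : ℝ) : ℂ) * E l = B j := by
  have h1 : ∀ k, ∑ l, (((topMat y x q)⁻¹ j l : ℝ) : ℂ) * (topMat y x q l k : ℂ)
      = if j = k then 1 else 0 := by
    intro k
    have := congrFun (congrFun (Matrix.nonsing_inv_mul _ (isUnit_iff_ne_zero.2 hA)) j) k
    rw [Matrix.mul_apply, Matrix.one_apply] at this
    have h2 := congrArg (fun r : ℝ => (r : ℂ)) this
    push_cast at h2
    rw [h2]
    split_ifs <;> simp
  simp only [← h, Finset.mul_sum, ← mul_assoc]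
  rw [Finset.sum_comm]
  simp only [← Finset.sum_mul, h1]
  simp

/-- By Andréief's identity this is `d!` times a determinant. A null vector gives a polynomial of
degree below `d` whose sums against the cut `𝒫̃` vanish by assumption and against monomials by
degree. Invertibility of the top matrix makes it zero at all nodes, and `d` distinct nodes suffice
to kill its coefficients. -/
theorem omegaSum_ne_zero {q : ℝ} (hq0 : 0 < q) (hq1 : q < 1) {y : Fin d → ℤ}
    {x : Fin (d + N) → ℤ} (hx : StrictAnti x) (hspread : ∀ i j, y i - y j ≤ (N : ℤ) - 1)
    (hA : (topMat y x q).det ≠ 0) : omegaSum y x q ≠ 0 := by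
  have h0 := sum_prod_mul_vdm_mul_det (cutWeight y x q) (node x q)
    fun i (β : Fin d) => calPt d q (N - 1) (y β) (node x q i)
  rw [show omegaSum y x q = _ from h0]
  refine mul_ne_zero (by exact_mod_cast d.factorial_ne_zero) fun hdet => ?_
  obtain ⟨c, hc, hEc⟩ := Matrix.exists_mulVec_eq_zero_iff.2 hdet
  set G : Fin (d + N) → ℂ := fun j => ∑ a : Fin d, (-node x q j) ^ (a : ℕ) * c a with hG
  have h1 : ∀ l : Fin d, ∑ j, cutWeight y x q j *
      (calPt d q (N - 1) (y l) (node x q j) * G j) = 0 := by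
    intro l
    have := congrFun hEc l
    simp only [Matrix.mulVec, dotProduct, Matrix.of_apply, Finset.sum_mul, Pi.zero_apply] at this
    rw [← this, Finset.sum_comm]
    refine Finset.sum_congr rfl fun j _ => ?_
    simp only [hG, Finset.mul_sum]
    exact Finset.sum_congr rfl fun a _ => by ring
  have h2 : ∀ a : Fin N, ∑ j, nodeWeight x q j * (node x q j ^ (a : ℕ) * G j) = 0 := by
    intro a
    simp only [hG, Finset.mul_sum]
    rw [Finset.sum_comm]
    refine Finset.sum_eq_zero fun b _ => ?_
    have := sum_nodeWeight_mul_eval_eq_zero hq0 hq1 hx (p := Polynomial.X ^ ((a : ℕ) + b))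
      (by rw [Polynomial.natDegree_X_pow]; omega)
    simp only [Polynomial.eval_pow, Polynomial.eval_X] at this
    calc _ = ((-1) ^ (b : ℕ) * c b) * ∑ j, nodeWeight x q j * node x q j ^ ((a : ℕ) + b) := by
          rw [Finset.mul_sum]
          refine Finset.sum_congr rfl fun j _ => ?_
          rw [neg_pow, pow_add]
          ring
      _ = 0 := by rw [this, mul_zero]
  have h3 := sum_topMat_mul hq0 hq1 hspread x (G := G) (E := fun _ => 0) h1
    (fun a => by rw [h2 a, mul_zero])
  have h4 := fun j => sum_inv_topMat_mul hA h3 j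
  have h5 : ∀ j, G j = 0 := by
    intro j
    have := h4 j
    simp only [mul_zero, Finset.sum_const_zero] at this
    refine (mul_eq_zero.1 this.symm).resolve_left (mul_ne_zero
      (inv_ne_zero (pow_ne_zero _ (node_ne_zero hq0 x j))) ?_)
    exact Lagrange.nodalWeight_ne_zero (node_injective hq0 hq1 hx).injOn (Finset.mem_univ j)
  have h6 : (Matrix.vandermonde fun i : Fin d => -node x q (Fin.castAdd N i)).mulVec c = 0 := by
    funext i
    exact h5 (Fin.castAdd N i)
  refine hc (Matrix.eq_zero_of_mulVec_eq_zero (Matrix.det_vandermonde_ne_zero_iff.2 ?_) h6)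
  intro a b hab
  exact Fin.castAdd_injective d N (node_injective hq0 hq1 hx (neg_injective hab))

/-- The coefficient of `w^b` in `Φ_q(w)`. -/
def phiCoeff (N n : ℕ) (q : ℂ) (b : ℕ) : ℂ := ∏ r ∈ Finset.Icc (n + 1) N, (1 - q ^ (r - (b + 1)))

theorem PhiQ_eq_sum (N n : ℕ) (q w : ℂ) :
    PhiQ N n q w = ∑ b ∈ Finset.range n, w ^ b * phiCoeff N n q b := by
  have : Finset.Icc 1 n = (Finset.range n).map ⟨fun b => b + 1, add_left_injective 1⟩ := by
    ext k
    simp only [Finset.mem_Icc, Finset.mem_map, Finset.mem_range, Function.Embedding.coeFn_mk]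
    exact ⟨fun h => ⟨k - 1, by omega, by omega⟩, fun ⟨b, h1, h2⟩ => by omega⟩
  rw [PhiQ, this, Finset.sum_map]
  rfl

/-- This converts the normalization of the virtual entrance functions at level `N` into that at
level `n`. -/
theorem phiCoeff_mul_qFact (q : ℝ) {N n b : ℕ} (hb : b < n) (hn : n ≤ N) :
    phiCoeff N n q b * (qFact q (n - (b + 1)) : ℂ) = qFact q (N - (b + 1)) := by
  induction N, hn using Nat.le_induction with
  | base => simp [phiCoeff]
  | succ N hN ih =>
    rw [phiCoeff, Finset.prod_Icc_succ_top (by omega), mul_right_comm, ← phiCoeff, ih,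
      show N + 1 - (b + 1) = N - (b + 1) + 1 by omega, qFact_succ]
    push_cast
    rfl

/-- The `rSum` terms solve the virtual rows and are invisible to the first `d` rows; `O` does the
opposite. It is kept abstract so that `d = 0`, with `O = 0`, is treated together with `d ≥ 1`, with
`O` equal to `d` times `Ω̃` at the nodes. -/
theorem sum_inv_topMat_mul_entrance {q : ℝ} (hq0 : 0 < q) (hq1 : q < 1) {y : Fin d → ℤ}
    {x : Fin (d + N) → ℤ} (hx : StrictAnti x) (hspread : ∀ i j, y i - y j ≤ (N : ℤ) - 1)
    (hA : (topMat y x q).det ≠ 0) {n : ℕ} (hn : n ≤ N) (t : ℤ) {O : Fin (d + N) → ℂ}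
    (hO1 : ∀ l : Fin d, ∑ j, cutWeight y x q j * (calPt d q (N - 1) (y l) (node x q j) * O j)
      = hq q d n (t - y l) * omegaSum y x q)
    (hO2 : ∀ a < N, ∑ j, nodeWeight x q j * (node x q j ^ a * O j) = 0) (j : Fin (d + N)) :
    ∑ l, (((topMat y x q)⁻¹ j l : ℝ) : ℂ) * (entrance y q n l t : ℂ)
      = (node x q j ^ d)⁻¹ * nodeWeight x q j * ((∑ b ∈ Finset.range n,
        phiCoeff N n q b * ((q : ℂ) ^ t) ^ (d + b) * rSum y x q b (node x q j) + O j)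
          / omegaSum y x q) := by
  have hΩ := omegaSum_ne_zero hq0 hq1 hx hspread hA
  refine sum_inv_topMat_mul hA (sum_topMat_mul hq0 hq1 hspread x
    (G := fun j => (∑ b ∈ Finset.range n, phiCoeff N n q b * ((q : ℂ) ^ t) ^ (d + b) *
      rSum y x q b (node x q j) + O j) / omegaSum y x q)
    (E := fun l => (entrance y q n l t : ℂ)) (fun l => ?_) fun a => ?_) j
  · have hE : entrance y q n (Fin.castAdd N l) t = hq q d n (t - y l) := by
      rw [entrance_of_lt hq0.ne' _ _ _ l.2, yFull_of_lt _ _ l.2]; rfl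
    rw [hE, eq_comm, ← mul_div_cancel_right₀ (hq q d n (t - y l) : ℂ) hΩ, ← hO1 l, Finset.sum_div]
    have h1 : ∑ j, cutWeight y x q j * (calPt d q (N - 1) (y l) (node x q j) *
        ∑ b ∈ Finset.range n, phiCoeff N n q b * ((q : ℂ) ^ t) ^ (d + b) *
          rSum y x q b (node x q j)) = 0 := by
      simp only [Finset.mul_sum]
      rw [Finset.sum_comm]
      refine Finset.sum_eq_zero fun b _ => ?_
      calc _ = phiCoeff N n q b * ((q : ℂ) ^ t) ^ (d + b) * ∑ j, cutWeight y x q j *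
          (calPt d q (N - 1) (y l) (node x q j) * rSum y x q b (node x q j)) := by
            rw [Finset.mul_sum]
            exact Finset.sum_congr rfl fun j _ => by ring
        _ = 0 := by rw [sum_cutWeight_mul_rSum, mul_zero]
    rw [← Finset.sum_div, ← add_zero (∑ j, _), ← h1, ← Finset.sum_add_distrib, Finset.sum_div]
    exact Finset.sum_congr rfl fun j _ => by ring
  · have h1 : ∑ j, nodeWeight x q j * (node x q j ^ (a : ℕ) *
        ∑ b ∈ Finset.range n, phiCoeff N n q b * ((q : ℂ) ^ t) ^ (d + b) *
          rSum y x q b (node x q j)) = if (a : ℕ) < n then phiCoeff N n q a *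
            ((q : ℂ) ^ t) ^ (d + (a : ℕ)) * omegaSum y x q else 0 := by
      simp only [Finset.mul_sum]
      rw [Finset.sum_comm]
      have h2 : ∀ b ∈ Finset.range n, ∑ j, nodeWeight x q j * (node x q j ^ (a : ℕ) *
          (phiCoeff N n q b * ((q : ℂ) ^ t) ^ (d + b) * rSum y x q b (node x q j)))
          = if b = a then phiCoeff N n q a * ((q : ℂ) ^ t) ^ (d + (a : ℕ)) * omegaSum y x q
            else 0 := by
        intro b hb
        have h3 := sum_nodeWeight_mul_rSum hq0 hq1 y hx a.2
          ((Finset.mem_range.1 hb).trans_le hn)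
        calc _ = phiCoeff N n q b * ((q : ℂ) ^ t) ^ (d + b) * ∑ j, nodeWeight x q j *
            (node x q j ^ (a : ℕ) * rSum y x q b (node x q j)) := by
              rw [Finset.mul_sum]
              exact Finset.sum_congr rfl fun j _ => by ring
          _ = _ := by
            rw [h3]
            by_cases hab : (a : ℕ) = b
            · simp [hab]
            · rw [if_neg hab, if_neg (Ne.symm hab), mul_zero]
      rw [Finset.sum_congr rfl h2, Finset.sum_ite_eq']
      simp
    have h4 : ∑ j, nodeWeight x q j * (node x q j ^ (a : ℕ) * ((∑ b ∈ Finset.range n,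
        phiCoeff N n q b * ((q : ℂ) ^ t) ^ (d + b) * rSum y x q b (node x q j) + O j)
          / omegaSum y x q)) = if (a : ℕ) < n then phiCoeff N n q a *
            ((q : ℂ) ^ t) ^ (d + (a : ℕ)) else 0 := by
      calc _ = (∑ j, nodeWeight x q j * (node x q j ^ (a : ℕ) *
          ∑ b ∈ Finset.range n, phiCoeff N n q b * ((q : ℂ) ^ t) ^ (d + b) *
          rSum y x q b (node x q j)) + ∑ j, nodeWeight x q j * (node x q j ^ (a : ℕ) * O j))
            / omegaSum y x q := by
            rw [← Finset.sum_add_distrib, Finset.sum_div]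
            exact Finset.sum_congr rfl fun j _ => by ring
        _ = _ := by
          rw [h1, hO2 a a.2, add_zero]
          split_ifs
          · rw [mul_div_cancel_right₀ _ hΩ]
          · rw [zero_div]
    rw [h4]
    split_ifs with han
    · rw [entrance_of_ge_of_lt hq0 hq1 _ _ _ (by simp) (by simpa using han), Fin.val_natAdd,
        show d + n - (d + (a : ℕ) + 1) = n - (a + 1) by omega, ← phiCoeff_mul_qFact q han hn]
      have hf : (qFact q (n - (a + 1)) : ℂ) ≠ 0 := by exact_mod_cast (qFact_pos hq0 hq1 _).ne'
      push_cast
      rw [← zpow_natCast, ← zpow_mul, mul_comm t, zpow_mul, zpow_natCast]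
      field_simp
    · rw [entrance_of_ge _ _ _ (by simpa using han)]
      simp

/-! ### The basic hypergeometric series -/

/-- In base `q⁻¹` the symbol runs through the factors of `(q;q)_M` from the largest exponent
downwards. -/
theorem qPoch_pow_mul_qFact {q : ℝ} (hq0 : 0 < q) {M k : ℕ} (hk : k ≤ M) :
    qPoch ((q : ℂ) ^ M) (q : ℂ)⁻¹ k * (qFact q (M - k) : ℂ) = qFact q M := by
  have hqc : (q : ℂ) ≠ 0 := by exact_mod_cast hq0.ne'
  induction k with
  | zero => simp [qPoch]
  | succ k ih =>
    have h1 : (q : ℂ) ^ M * (q : ℂ)⁻¹ ^ k = (q : ℂ) ^ (M - (k + 1) + 1) := by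
      rw [inv_pow, ← div_eq_mul_inv, ← pow_sub₀ _ hqc (by omega) |>.trans (div_eq_mul_inv _ _).symm]
      congr 1
      omega
    have h2 : (qFact q (M - k) : ℂ)
        = qFact q (M - (k + 1)) * (1 - (q : ℂ) ^ (M - (k + 1) + 1)) := by
      rw [show M - k = M - (k + 1) + 1 by omega, qFact_succ]
      push_cast
      rfl
    rw [← ih (by omega), h2, qPoch, Finset.prod_range_succ, ← qPoch, h1]
    ring

theorem PhiQ_eq_phi21 {q : ℝ} (hq0 : 0 < q) (hq1 : q < 1) {N n : ℕ} (hn1 : 1 ≤ n) (hn : n ≤ N)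
    (w : ℂ) : PhiQ N n q w = qPoch ((q : ℂ) ^ (N - 1)) (q : ℂ)⁻¹ (N - n)
      * phi21 (q : ℂ)⁻¹ ((q : ℂ) ^ (n - 1)) ((q : ℂ) ^ (N - 1)) (q : ℂ)⁻¹ w := by
  have hqc : (q : ℂ) ≠ 0 := by exact_mod_cast hq0.ne'
  have hF : ∀ L, (qFact q L : ℂ) ≠ 0 := fun L => by exact_mod_cast (qFact_pos hq0 hq1 L).ne'
  rw [phi21, tsum_eq_sum (s := Finset.range n), PhiQ_eq_sum, Finset.mul_sum]
  · refine Finset.sum_congr rfl fun k hk => ?_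
    have hk := Finset.mem_range.1 hk
    have h1 := qPoch_pow_mul_qFact hq0 (show N - n ≤ N - 1 by omega)
    have h2 := qPoch_pow_mul_qFact hq0 (show k ≤ n - 1 by omega)
    have h3 := qPoch_pow_mul_qFact hq0 (show k ≤ N - 1 by omega)
    have h4 := phiCoeff_mul_qFact q hk hn
    rw [show N - 1 - (N - n) = n - 1 by omega] at h1
    rw [show n - (k + 1) = n - 1 - k by omega, show N - (k + 1) = N - 1 - k by omega] at h4
    have h5 : qPoch ((q : ℂ) ^ (N - 1)) (q : ℂ)⁻¹ k ≠ 0 := fun h => hF (N - 1) (by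
      rw [← h3, h, zero_mul])
    have h6 : qPoch (q : ℂ)⁻¹ (q : ℂ)⁻¹ k ≠ 0 := by
      refine Finset.prod_ne_zero_iff.2 fun j _ h => ?_
      rw [← pow_succ', inv_pow, sub_eq_zero, eq_comm, inv_eq_one] at h
      have := (one_sub_pow_succ_pos hq0 hq1 j).ne'
      exact this (by rw [sub_eq_zero]; exact_mod_cast h.symm)
    -- The first parameter equals the base, so two of the four Pochhammer symbols cancel.
    rw [mul_div_mul_left _ _ h6, ← mul_assoc, mul_comm]
    congr 1
    rw [eq_comm, ← mul_div_assoc, div_eq_iff h5]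
    refine mul_right_cancel₀ (hF (n - 1 - k)) ?_
    rw [mul_assoc, h2, h1, mul_right_comm, h4, mul_comm, h3]
  · intro k hk
    have hk : n ≤ k := by simpa using hk
    -- The series terminates: the factor with index `n - 1` is `1 - q^{n-1} q^{-(n-1)}`.
    have : qPoch ((q : ℂ) ^ (n - 1)) (q : ℂ)⁻¹ k = 0 := by
      refine Finset.prod_eq_zero (i := n - 1) (Finset.mem_range.2 (by omega)) ?_
      rw [← mul_pow, mul_inv_cancel₀ hqc, one_pow, sub_self]
    rw [this]
    simp

/-! ### The integral along `Γ_v` -/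

theorem IsGammaV.notMem {x : Fin (d + N) → ℤ} {q : ℝ} {m : ℕ} {s t : ℤ} {Γv : Contour}
    (h : IsGammaV x q m s t Γv) (j : Fin (d + N)) : (q : ℂ) ^ (x j - t) ∉ Γv.trace := by
  rw [IsGammaV] at h
  split_ifs at h
  · rcases lt_or_ge (x j) s with hj | hj
    · exact (h.2 j hj).1
    · have := (h.1 (x j - s).toNat).1
      rwa [show s - t + ((x j - s).toNat : ℤ) = x j - t by omega] at this
  · by_cases hj : x j = s
    · rw [hj]; exact h.1.1
    · exact (h.2 j hj).1

/-- The winding number supplies the cut-off `x_j ≥ s` that the polynomial `𝒫` lacks. For `m = N`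
both sides reduce to the indicator of `x_j = s`. -/
theorem IsGammaV.wind_mul_calP {x : Fin (d + N) → ℤ} {q : ℝ} (hq0 : 0 < q) (hq1 : q < 1) {m : ℕ}
    (hm : m ≤ N) {s t : ℤ} {Γv : Contour} (h : IsGammaV x q m s t Γv) (j : Fin (d + N)) :
    Γv.wind ((q : ℂ) ^ (x j - t)) * calP q (N - m - 1) ((q : ℂ) ^ (x j - s))
      = hq q (d + m) (N - m) (x j - s) * (((q : ℂ) ^ (x j - s)) ^ (d + m))⁻¹ := by
  have hqc : (q : ℂ) ≠ 0 := by exact_mod_cast hq0.ne'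
  rw [IsGammaV] at h
  split_ifs at h with hmN
  · rcases lt_or_ge (x j) s with hj | hj
    · rw [show Γv.wind _ = 0 from (h.2 j hj).2, hq_of_neg _ _ _ (by omega)]
      simp
    · have := (h.1 (x j - s).toNat).2
      rw [show s - t + ((x j - s).toNat : ℤ) = x j - t by omega] at this
      obtain ⟨L, hL⟩ : ∃ L, N - m = L + 1 := ⟨N - m - 1, by omega⟩
      rw [show Γv.wind _ = 1 from this, hL, Nat.add_sub_cancel, calP_zpow hq0,
        hq_eq_qRatio hq0 hq1 _ _ _ (by omega)]
      push_cast
      rw [← zpow_natCast, ← zpow_natCast, ← zpow_mul, ← zpow_mul, mul_comm (x j - s)]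
      have := zpow_ne_zero (((d + m : ℕ) : ℤ) * (x j - s)) hqc
      field_simp
  · rw [show N - m = 0 by omega, hq_no_vars]
    by_cases hj : x j = s
    · rw [hj, show Γv.wind _ = 1 from h.1.2]
      simp [calP, qPoch]
    · rw [show Γv.wind _ = 0 from (h.2 j hj).2, if_neg (by omega)]
      simp

theorem Qq_mul_zpow {q : ℝ} (hq0 : 0 < q) (x : Fin (d + N) → ℤ) (t : ℤ) (v : ℂ) :
    Qq x q (v * (q : ℂ) ^ t) = ((q : ℂ) ^ t) ^ (d + N) * ∏ j, (v - (q : ℂ) ^ (x j - t)) := by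
  have hqc : (q : ℂ) ≠ 0 := by exact_mod_cast hq0.ne'
  have : ((q : ℂ) ^ t) ^ (d + N) = ∏ _j : Fin (d + N), (q : ℂ) ^ t := by simp
  rw [this, ← Finset.prod_mul_distrib, Qq]
  refine Finset.prod_congr rfl fun j _ => ?_
  rw [zpow_sub₀ hqc]
  have := zpow_ne_zero t hqc
  field_simp

/-- Each of the `d + N - 1` differences of nodes carries a factor `q^{-t}`. -/
theorem nodalWeight_scaled {q : ℝ} (hq0 : 0 < q) (x : Fin (d + N) → ℤ) (t : ℤ) (j : Fin (d + N)) :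
    (((q : ℂ) ^ t) ^ (d + N))⁻¹ * Lagrange.nodalWeight Finset.univ (fun j => (q : ℂ) ^ (x j - t)) j
      = ((q : ℂ) ^ t)⁻¹ * nodeWeight x q j := by
  have hqc : (q : ℂ) ≠ 0 := by exact_mod_cast hq0.ne'
  have hT := zpow_ne_zero t hqc
  have h1 : Lagrange.nodalWeight Finset.univ (fun j => (q : ℂ) ^ (x j - t)) j
      = ((q : ℂ) ^ t) ^ (d + N - 1) * nodeWeight x q j := by
    have : ((q : ℂ) ^ t) ^ (d + N - 1) = ∏ _i ∈ Finset.univ.erase j, (q : ℂ) ^ t := by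
      simp [Finset.card_erase_of_mem]
    rw [this, nodeWeight, Lagrange.nodalWeight, Lagrange.nodalWeight, ← Finset.prod_mul_distrib]
    refine Finset.prod_congr rfl fun i _ => ?_
    simp only [node]
    rw [zpow_sub₀ hqc, zpow_sub₀ hqc, ← sub_div, inv_div, div_eq_mul_inv]
  have h2 : ((q : ℂ) ^ t) ^ (d + N) = ((q : ℂ) ^ t) ^ (d + N - 1) * (q : ℂ) ^ t := by
    rw [← pow_succ]
    congr 1
    have := j.2
    omega
  have h3 := pow_ne_zero (d + N - 1) hT
  rw [h1, h2, mul_inv]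
  field_simp

/-- The weight of a node after the integration along `Γ_v`. -/
def gammaVWeight (x : Fin (d + N) → ℤ) (q : ℝ) (m : ℕ) (s t : ℤ) (j : Fin (d + N)) : ℂ :=
  hq q (d + m) (N - m) (x j - s) * (((q : ℂ) ^ t)⁻¹ * nodeWeight x q j *
    (((q : ℂ) ^ (x j - t)) ^ m * (((q : ℂ) ^ (x j - s)) ^ (d + m))⁻¹))

theorem IsGammaV.integral_eval {x : Fin (d + N) → ℤ} (hx : StrictAnti x) {q : ℝ} (hq0 : 0 < q)
    (hq1 : q < 1) {m : ℕ} (hm : m ≤ N) {s t : ℤ} {Γv : Contour} (h : IsGammaV x q m s t Γv)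
    (p : Polynomial ℂ) :
    Γv.integral (fun v => v ^ m * (calP q (N - m - 1) (v * (q : ℂ) ^ (t - s)) /
      Qq x q (v * (q : ℂ) ^ t)) * p.eval (v * (q : ℂ) ^ t))
      = ∑ j, gammaVWeight x q m s t j * p.eval (node x q j) := by
  have hqc : (q : ℂ) ≠ 0 := by exact_mod_cast hq0.ne'
  -- With first parameter `0` the prefactor of `calPt` is `1`, and the shift `s - t` gives the
  -- argument `v q^{t-s}`.
  obtain ⟨c, hc⟩ := exists_calPt_eq_eval 0 q (N - m - 1) (s - t)
  have hc' : ∀ z, calP q (N - m - 1) (z * (q : ℂ) ^ (t - s)) = c.eval z := fun z => by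
    rw [← hc, calPt, neg_sub]
    simp
  have hinj : Function.Injective fun j => (q : ℂ) ^ (x j - t) := fun a b hab =>
    hx.injective (by have := zpow_injective_of_lt_one hq0 hq1 hab; omega)
  have hI := Γv.integral_inv_prod_mul_eval hinj h.notMem
    (Polynomial.X ^ m * c * p.comp (Polynomial.X * Polynomial.C ((q : ℂ) ^ t)))
  simp only [Polynomial.eval_mul, Polynomial.eval_pow, Polynomial.eval_X, Polynomial.eval_comp,
    Polynomial.eval_C] at hI
  calc _ = Γv.integral (fun v => (((q : ℂ) ^ t) ^ (d + N))⁻¹ *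
        ((∏ j, (v - (q : ℂ) ^ (x j - t)))⁻¹ * (v ^ m * c.eval v * p.eval (v * (q : ℂ) ^ t)))) := by
        refine Γv.integral_congr fun v _ => ?_
        rw [hc', Qq_mul_zpow hq0, div_eq_mul_inv, mul_inv]
        ring
    _ = _ := by
      rw [Γv.integral_const_mul, hI, Finset.mul_sum]
      refine Finset.sum_congr rfl fun j _ => ?_
      have h1 := h.wind_mul_calP hq0 hq1 hm j
      have h2 := nodalWeight_scaled hq0 x t j
      have h3 : (q : ℂ) ^ (x j - t) * (q : ℂ) ^ t = node x q j := by
        rw [node, ← zpow_add₀ hqc, sub_add_cancel]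
      have h4 : c.eval ((q : ℂ) ^ (x j - t)) = calP q (N - m - 1) ((q : ℂ) ^ (x j - s)) := by
        rw [← hc', ← zpow_add₀ hqc, sub_add_sub_cancel]
      rw [h3, h4, gammaVWeight]
      linear_combination (((q : ℂ) ^ (x j - t)) ^ m * p.eval (node x q j) *
        (Γv.wind ((q : ℂ) ^ (x j - t)) * calP q (N - m - 1) ((q : ℂ) ^ (x j - s)))) * h2 +
        (((q : ℂ) ^ (x j - t)) ^ m * p.eval (node x q j) * ((q : ℂ) ^ t)⁻¹ * nodeWeight x q j) * h1

/-! ### The terms of the kernel as sums over the nodes -/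

open Polynomial in
theorem exists_rSum_eq_eval (y : Fin d → ℤ) (x : Fin (d + N) → ℤ) (q : ℝ) (b : ℕ) :
    ∃ p : ℂ[X], ∀ v, rSum y x q b v = p.eval v := by
  refine ⟨∑ I : Fin d → Fin (d + N), C (∏ j, cutWeight y x q (I j)) *
    ((divX^[b + 1] (complPoly x q I) * ∏ i, (X - C (node x q (I i)))) *
      C (vdm (fun j => node x q (I j)) * deltaCut N y q (fun j => node x q (I j)))), fun v => ?_⟩
  simp only [rSum, eval_finsetSum, eval_mul, eval_C, eval_prod, eval_sub, eval_X]

open Polynomial in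
theorem exists_frSum_eq_eval {e : ℕ} (y : Fin (e + 1) → ℤ) (x : Fin (e + 1 + N) → ℤ) (q : ℝ)
    (r : Fin (e + 1)) : ∃ p : ℂ[X], ∀ v, frSum y x q r v = p.eval v := by
  refine ⟨∑ I : Fin e → Fin (e + 1 + N), C (∏ j, cutWeight y x q (I j)) *
    (C (Matrix.of fun α β : Fin e =>
      calPt (e + 1) q (N - 1) (y (r.succAbove β)) (node x q (I α))).det *
      ((∏ i, (X - C (node x q (I i)))) * C (vdm fun j => node x q (I j)))), fun v => ?_⟩
  simp only [frSum, vdm_cons, eval_finsetSum, eval_mul, eval_C, eval_prod, eval_sub, eval_X]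

/-- The denominators `z - u_j` at the chosen nodes divide `Q_q(z)`, so the product is polynomial in
`z` and its only poles along `Γ_∞` come from the explicit factors. -/
theorem Qq_mul_OmegaQ {y : Fin d → ℤ} {x : Fin (d + N) → ℤ} (hx : StrictAnti x)
    {q : ℝ} (hq0 : 0 < q) (hq1 : q < 1) {Γ : Contour} (h : IsGammaU y x q Γ) (v : ℂ) {z : ℂ}
    (hz : Γ.Excludes z) :
    Qq x q z * OmegaQ y x q Γ v z = ∑ I : Fin d → Fin (d + N), (∏ j, cutWeight y x q (I j)) *
      ((complPoly x q I).eval z * ((∏ i, (v - node x q (I i))) *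
      (vdm (fun j => node x q (I j)) * deltaCut N y q (fun j => node x q (I j))))) := by
  rw [OmegaQ_eq hx hq0 hq1 h v hz, Finset.mul_sum]
  refine Finset.sum_congr rfl fun I _ => ?_
  by_cases hI : Function.Injective I
  swap
  · simp [vdm_node_eq_zero hI]
  by_cases hc : ∀ j, cutWeight y x q (I j) ≠ 0
  swap
  · push Not at hc
    obtain ⟨j, hj⟩ := hc
    rw [Finset.prod_eq_zero (Finset.mem_univ j) (by rw [hj, zero_mul]),
      Finset.prod_eq_zero (f := fun j => cutWeight y x q (I j)) (Finset.mem_univ j) hj]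
    simp
  -- The point `z` may be a node, but only one with winding number zero; its cut weight vanishes,
  -- contrary to `hc`.
  have hne : ∀ j, z - node x q (I j) ≠ 0 := by
    intro j hj
    have h1 := h.wind_mul (I j)
    rw [← sub_eq_zero.1 hj, show Γ.wind z = 0 from hz.2, zero_mul] at h1
    exact hc j h1.symm
  have h2 : (complPoly x q I).eval z * ∏ j, (z - node x q (I j)) = Qq x q z := by
    have := congrArg (Polynomial.eval z) (complPoly_mul_prod x q hI)
    simp only [Polynomial.eval_mul, Polynomial.eval_prod, Polynomial.eval_sub, Polynomial.eval_X,
      Polynomial.eval_C] at this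
    exact this
  have h3 : (∏ j, (z - node x q (I j))) * (∏ j, (z - node x q (I j)))⁻¹ = 1 :=
    mul_inv_cancel₀ (Finset.prod_ne_zero_iff.2 fun j _ => hne j)
  rw [Finset.prod_mul_distrib, Finset.prod_inv_distrib, ← h2]
  linear_combination ((∏ j, cutWeight y x q (I j)) *
      ((complPoly x q I).eval z * ((∏ i, (v - node x q (I i))) *
      (vdm (fun j => node x q (I j)) * deltaCut N y q (fun j => node x q (I j)))))) * h3

/-- The term `w^b` of `Φ_q` at `w = z⁻¹`, divided by `z`, contributes `z^{-b-1}`. The residues at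
`0` and `v` then truncate each `complPoly`, which produces `rSum`. -/
theorem integral_gammaInf {y : Fin d → ℤ} {x : Fin (d + N) → ℤ} (hx : StrictAnti x)
    {q : ℝ} (hq0 : 0 < q) (hq1 : q < 1) {Γ Γinf : Contour} (h : IsGammaU y x q Γ) (n : ℕ) (t : ℤ)
    (h0 : Γinf.Encloses 0) (hΓ : ∀ z ∈ Γinf.trace, Γ.Excludes (z * (q : ℂ) ^ t)) {v : ℂ}
    (hv : Γinf.Encloses v) :
    Γinf.integral (fun z => PhiQ N n q z⁻¹ / z * (z - v)⁻¹ *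
      (Qq x q (z * (q : ℂ) ^ t) * OmegaQ y x q Γ (v * (q : ℂ) ^ t) (z * (q : ℂ) ^ t)))
      = ∑ b ∈ Finset.range n, phiCoeff N n q b * ((q : ℂ) ^ t) ^ (b + 1) *
        rSum y x q b (v * (q : ℂ) ^ t) := by
  set T := (q : ℂ) ^ t
  have hz0 : ∀ z ∈ Γinf.trace, z ≠ 0 := fun z hz e => h0.1 (e ▸ hz)
  have hcont : ∀ (I : Fin d → Fin (d + N)) (b : ℕ), ContinuousOn (fun z => z⁻¹ ^ (b + 1) *
      (z - v)⁻¹ * (complPoly x q I).eval (z * T)) Γinf.trace := by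
    intro I b
    refine ContinuousOn.mul (ContinuousOn.mul ?_ (Γinf.continuousOn_inv_sub hv.1)) ?_
    · exact ContinuousOn.pow (ContinuousOn.inv₀ continuousOn_id hz0) _
    · fun_prop
  have hcont' : ∀ (c : ℂ) (I : Fin d → Fin (d + N)) (b : ℕ), ContinuousOn (fun z => c *
      (z⁻¹ ^ (b + 1) * (z - v)⁻¹ * (complPoly x q I).eval (z * T))) Γinf.trace :=
    fun c I b => continuousOn_const.mul (hcont I b)
  set K : (Fin d → Fin (d + N)) → ℂ := fun I => (∏ j, cutWeight y x q (I j)) *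
      ((∏ i, (v * T - node x q (I i))) * (vdm (fun j => node x q (I j)) *
        deltaCut N y q (fun j => node x q (I j)))) with hK
  calc _ = Γinf.integral (fun z => ∑ b ∈ Finset.range n, ∑ I : Fin d → Fin (d + N),
        phiCoeff N n q b * K I * (z⁻¹ ^ (b + 1) * (z - v)⁻¹ * (complPoly x q I).eval (z * T))) := by
        refine Γinf.integral_congr fun z hz => ?_
        rw [Qq_mul_OmegaQ hx hq0 hq1 h _ (hΓ z hz), PhiQ_eq_sum, Finset.sum_div, mul_assoc,
          Finset.sum_mul]
        refine Finset.sum_congr rfl fun b _ => ?_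
        rw [Finset.mul_sum, Finset.mul_sum]
        refine Finset.sum_congr rfl fun I _ => ?_
        rw [hK, pow_succ, div_eq_mul_inv]
        ring
    _ = ∑ b ∈ Finset.range n, ∑ I : Fin d → Fin (d + N), phiCoeff N n q b * K I *
        (T ^ (b + 1) * (Polynomial.divX^[b + 1] (complPoly x q I)).eval (v * T)) := by
        rw [Γinf.integral_sum _ fun b _ => continuousOn_finsetSum _ fun I _ => hcont' _ I b]
        refine Finset.sum_congr rfl fun b _ => ?_
        rw [Γinf.integral_sum _ fun I _ => hcont' _ I b]
        refine Finset.sum_congr rfl fun I _ => ?_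
        rw [Γinf.integral_const_mul, Γinf.integral_inv_pow_mul_inv_sub_mul_eval h0 hv]
    _ = _ := by
      refine Finset.sum_congr rfl fun b _ => ?_
      rw [rSum, Finset.mul_sum]
      refine Finset.sum_congr rfl fun I _ => ?_
      rw [hK]
      ring

theorem K1_eq {y : Fin d → ℤ} {x : Fin (d + N) → ℤ} (hx : StrictAnti x)
    {q : ℝ} (hq0 : 0 < q) (hq1 : q < 1) {Γ Γv Γinf : Contour} (h : IsGammaU y x q Γ) {m : ℕ}
    (hm : m ≤ N) (n : ℕ) {s t : ℤ} (hv : IsGammaV x q m s t Γv) (hinf : IsGammaInf q t Γ Γv Γinf) :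
    K1 y x q Γ Γv Γinf m s n t = ∑ j, gammaVWeight x q m s t j * ((∑ b ∈ Finset.range n,
      phiCoeff N n q b * ((q : ℂ) ^ t) ^ (b + 1) * rSum y x q b (node x q j)) / omegaSum y x q) := by
  choose p hp using exists_rSum_eq_eval y x q
  have key := hv.integral_eval hx hq0 hq1 hm (Polynomial.C (omegaSum y x q)⁻¹ *
    ∑ b ∈ Finset.range n, Polynomial.C (phiCoeff N n q b * ((q : ℂ) ^ t) ^ (b + 1)) * p b)
  simp only [Polynomial.eval_mul, Polynomial.eval_C, Polynomial.eval_finsetSum, ← hp] at key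
  simp only [div_eq_mul_inv _ (omegaSum y x q), mul_comm _ (omegaSum y x q)⁻¹]
  rw [← key, K1]
  refine Γv.integral_congr fun v hvt => ?_
  rw [← integral_gammaInf hx hq0 hq1 h n t hinf.1 hinf.2.2.2 (hinf.2.1 v hvt), mul_assoc]
  congr 1
  rw [← Γinf.integral_const_mul, ← Γinf.integral_const_mul]
  refine Γinf.integral_congr fun z _ => ?_
  rw [OmegaQ_zero_zero hx hq0 hq1 h]
  ring

theorem K2_eq {e : ℕ} {y : Fin (e + 1) → ℤ} {x : Fin (e + 1 + N) → ℤ} (hx : StrictAnti x)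
    {q : ℝ} (hq0 : 0 < q) (hq1 : q < 1) {Γ Γ₀ Γv : Contour} (h : IsGammaU y x q Γ) {m n : ℕ}
    (h₀ : IsGammaZero (e + 1) n q Γ₀) (hm : m ≤ N) {s t : ℤ} (hv : IsGammaV x q m s t Γv) :
    K2 y x q Γ Γ₀ Γv m s n t = ∑ j, gammaVWeight x q m s t j * (((e + 1 : ℕ) : ℂ) /
      ((q : ℂ) ^ t) ^ e * (∑ r : Fin (e + 1), (-1) ^ (r : ℕ) * (hq q (e + 1) n (t - y r) : ℂ) *
        frSum y x q r (node x q j)) / omegaSum y x q) := by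
  choose p hp using exists_frSum_eq_eval (N := N) y x q
  have key := hv.integral_eval hx hq0 hq1 hm (Polynomial.C (omegaSum y x q)⁻¹ *
    ∑ r : Fin (e + 1), Polynomial.C ((-1) ^ (r : ℕ) * (hq q (e + 1) n (t - y r) : ℂ)) * p r)
  simp only [Polynomial.eval_mul, Polynomial.eval_C, Polynomial.eval_finsetSum, ← hp] at key
  have h1 : K2 y x q Γ Γ₀ Γv m s n t = ((e + 1 : ℕ) : ℂ) / ((q : ℂ) ^ t) ^ e *
      ∑ j, gammaVWeight x q m s t j * ((omegaSum y x q)⁻¹ * ∑ r : Fin (e + 1),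
        (-1) ^ (r : ℕ) * (hq q (e + 1) n (t - y r) : ℂ) * frSum y x q r (node x q j)) := by
    rw [← key, K2, ← zpow_natCast ((q : ℂ) ^ t), ← zpow_mul,
      show (((e + 1 : ℕ) : ℤ) - 1) * t = t * e by push_cast; ring]
    congr 1
    refine Γv.integral_congr fun v _ => ?_
    rw [OmegaTilde_eq hx hq0 hq1 h h₀, OmegaQ_zero_zero hx hq0 hq1 h, div_eq_inv_mul _ (omegaSum y x q)]
  rw [h1, Finset.mul_sum]
  exact Finset.sum_congr rfl fun j _ => by ring

theorem K0_eq {q : ℝ} (hq0 : 0 < q) (hq1 : q < 1) (d m : ℕ) (s : ℤ) (n : ℕ) (t : ℤ) :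
    K0 q m s n t = (q : ℂ) ^ (((d : ℤ) + m) * (s - t)) *
      ((-(if m < n then hq q (d + m) (n - m) (t - s) else 0) : ℝ) : ℂ) := by
  have hqc : (q : ℂ) ≠ 0 := by exact_mod_cast hq0.ne'
  rw [K0]
  by_cases hmn : m < n
  swap
  · simp [hmn]
  by_cases hst : s ≤ t
  swap
  · simp [hst, hq_of_neg q (d + m) (n - m) (show t - s < 0 by omega)]
  obtain ⟨L, hL⟩ : ∃ L, n - m = L + 1 := ⟨n - m - 1, by omega⟩
  have h1 := calP_zpow hq0 L (t - s)
  rw [calP] at h1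
  rw [if_pos ⟨hmn, hst⟩, if_pos hmn, hL, Nat.add_sub_cancel, h1,
    hq_eq_qRatio hq0 hq1 _ _ _ (by omega)]
  push_cast
  rw [← zpow_natCast (q : ℂ), ← zpow_mul, mul_neg, ← mul_assoc, ← zpow_add₀ hqc,
    show ((d : ℤ) + m) * (s - t) + ((d + m : ℕ) : ℤ) * (t - s) = 0 by push_cast; ring]
  simp

/-- The integral representation, with the equations for the last term left open. -/
theorem Kq_mul_eq {q : ℝ} (hq0 : 0 < q) (hq1 : q < 1) {y : Fin d → ℤ}
    {x : Fin (d + N) → ℤ} (hx : StrictAnti x) (hspread : ∀ i j, y i - y j ≤ (N : ℤ) - 1)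
    (hA : (topMat y x q).det ≠ 0) (hH : (Hmat y x q).det ≠ 0) (m : ℕ) {n : ℕ} (hn : n ≤ N)
    (s t : ℤ) {O : Fin (d + N) → ℂ}
    (hO1 : ∀ l : Fin d, ∑ j, cutWeight y x q j * (calPt d q (N - 1) (y l) (node x q j) * O j)
      = hq q d n (t - y l) * omegaSum y x q)
    (hO2 : ∀ a < N, ∑ j, nodeWeight x q j * (node x q j ^ a * O j) = 0) :
    ((q ^ (((d : ℤ) + m) * (s - t)) * Kq y x q m s n t : ℝ) : ℂ)
      = K0 q m s n t + ∑ j, gammaVWeight x q m s t j * ((∑ b ∈ Finset.range n,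
      phiCoeff N n q b * ((q : ℂ) ^ t) ^ (b + 1) * rSum y x q b (node x q j)) / omegaSum y x q)
      + ∑ j, gammaVWeight x q m s t j * ((q : ℂ) ^ t / ((q : ℂ) ^ t) ^ d * O j / omegaSum y x q) := by
  have hqc : (q : ℂ) ≠ 0 := by exact_mod_cast hq0.ne'
  have hT := zpow_ne_zero t hqc
  have hsol := sum_inv_topMat_mul_entrance hq0 hq1 hx hspread hA hn t hO1 hO2
  rw [Kq_eq hq0 hq1 y x hH, K0_eq hq0 hq1 d]
  push_cast
  rw [mul_add, add_assoc]
  congr 1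
  rw [← Finset.sum_add_distrib, Finset.mul_sum]
  refine Finset.sum_congr rfl fun j _ => ?_
  rw [hsol j, gammaVWeight]
  -- The conjugation factor `q^{(d+m)(s-t)}` matches the powers of `q` left over from the integral
  -- along `Γ_v`.
  have hexp : (q : ℂ) ^ (((d : ℤ) + m) * (s - t)) * (node x q j ^ d)⁻¹ * ((q : ℂ) ^ t) ^ d
      = ((q : ℂ) ^ (x j - t)) ^ m * (((q : ℂ) ^ (x j - s)) ^ (d + m))⁻¹ := by
    simp only [node, ← zpow_natCast, ← zpow_mul, ← zpow_neg, ← zpow_add₀ hqc]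
    congr 1
    push_cast
    ring
  have h1 : ∑ b ∈ Finset.range n, phiCoeff N n q b * ((q : ℂ) ^ t) ^ (d + b) *
      rSum y x q b (node x q j) = ((q : ℂ) ^ t) ^ d * ((q : ℂ) ^ t)⁻¹ * ∑ b ∈ Finset.range n,
      phiCoeff N n q b * ((q : ℂ) ^ t) ^ (b + 1) * rSum y x q b (node x q j) := by
    rw [Finset.mul_sum]
    refine Finset.sum_congr rfl fun b _ => ?_
    rw [pow_add, pow_succ]
    field_simp
  rw [h1, ← hexp]
  have hTd := pow_ne_zero d hT
  have hk := pow_ne_zero d (node_ne_zero hq0 x j)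
  field_simp

end Lozenge

end

/-! ### The theorem -/

open Lozenge in
theorem theorem6p2 (d N : ℕ) (y : Fin d → ℤ) (x : Fin (d + N) → ℤ)
    (hy : StrictAnti y) (hx : StrictAnti x)
    (hspread : ∀ i j, y i - y j ≤ (N : ℤ) - 1)
    (hleft : ∀ i : Fin (d + N), (i : ℕ) + 1 = d + N → x i = -(d : ℤ) - N)
    (hne : (configs y x).Nonempty)
    (q : ℝ) (hq0 : 0 < q) (hq1 : q < 1) :
    -- `K_q` is a correlation kernel of the red dot process under `P_q`
    IsCorrelationKernel y x q (Kq y x q) ∧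
    -- Petrov's function as a basic hypergeometric series
    (∀ (n : ℕ) (w : ℂ), 1 ≤ n → n ≤ N →
      PhiQ N n q w
        = qPoch ((q : ℂ) ^ (N - 1)) (q : ℂ)⁻¹ (N - n)
          * phi21 (q : ℂ)⁻¹ ((q : ℂ) ^ (n - 1)) ((q : ℂ) ^ (N - 1)) (q : ℂ)⁻¹ w) ∧
    ∀ Γ : Contour, IsGammaU y x q Γ →
      OmegaQ y x q Γ 0 0 ≠ 0 ∧
      ∀ (m n : ℕ), m ≤ N → n ≤ N → ∀ (s t : ℤ) (Γ₀ : Contour), IsGammaZero d n q Γ₀ →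
        -- the second expression for `Ω̃_q`
        (1 ≤ d → ∀ v : ℂ, OmegaTilde y x q Γ Γ₀ n v t
          = ∑ r : Fin d, if y r ≤ t then (-1) ^ (r : ℕ) * (hq q d n (t - y r) : ℂ) * Fr y x q Γ r v
              else 0) ∧
        ∀ Γv : Contour, IsGammaV x q m s t Γv →
          -- the integral representation of the kernel
          (∀ Γinf : Contour, IsGammaInf q t Γ Γv Γinf →
            ((q ^ (((d : ℤ) + m) * (s - t)) * Kq y x q m s n t : ℝ) : ℂ)
              = K0 q m s n t + K1 y x q Γ Γv Γinf m s n t + K2 y x q Γ Γ₀ Γv m s n t) ∧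
          -- `K_q^{(2)}` vanishes to the left of the lower cuts
          ((∀ j, t < y j) → K2 y x q Γ Γ₀ Γv m s n t = 0) := by
  have hA := topMat_det_ne_zero hq0 hq1 hy hx hne
  have hH := Hmat_det_ne_zero hq0 hq1 hx hspread hleft hA
  refine ⟨isCorrelationKernel_Kq hq0 hq1 hy hx hne hH,
    fun n w hn1 hn => PhiQ_eq_phi21 hq0 hq1 hn1 hn w, fun Γ hΓ => ⟨?_, ?_⟩⟩
  · rw [OmegaQ_zero_zero hx hq0 hq1 hΓ]
    exact omegaSum_ne_zero hq0 hq1 hx hspread hA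
  intro m n hm hn s t Γ₀ h₀
  cases d with
  | zero =>
    refine ⟨fun h => absurd h (by omega), fun Γv hΓv => ⟨fun Γinf hinf => ?_, fun _ => ?_⟩⟩
    · rw [Kq_mul_eq hq0 hq1 hx hspread hA hH m hn s t (O := 0) (fun l => l.elim0) (by simp),
        K1_eq hx hq0 hq1 hΓ hm n hΓv hinf]
      simp [K2]
    · simp [K2]
  | succ e =>
    refine ⟨fun _ v => ?_, fun Γv hΓv => ⟨fun Γinf hinf => ?_, fun ht => ?_⟩⟩
    · rw [OmegaTilde_eq hx hq0 hq1 hΓ h₀]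
      refine Finset.sum_congr rfl fun r _ => ?_
      rw [Fr_eq hx hq0 hq1 hΓ]
      split_ifs with hr
      · rfl
      -- Terms with `y_r > t` carry a complete symmetric polynomial of negative degree.
      · rw [hq_of_neg _ _ _ (by omega)]
        simp
    · have hT : (q : ℂ) ^ t ≠ 0 := zpow_ne_zero t (by exact_mod_cast hq0.ne')
      -- Here `O` is `d = e + 1` times the node sum of `Ω̃`. It remains to match `q^t / (q^t)^d`
      -- with the prefactor `(q^t)^{-e}` of the last term.
      rw [Kq_mul_eq hq0 hq1 hx hspread hA hH m hn s t
        (sum_cutWeight_mul_omegaTilde q y x n t) (sum_nodeWeight_mul_omegaTilde hq0 hq1 y hx n t),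
        K1_eq hx hq0 hq1 hΓ hm n hΓv hinf, K2_eq hx hq0 hq1 hΓ h₀ hm hΓv]
      congr 1
      refine Finset.sum_congr rfl fun j _ => ?_
      congr 2
      rw [pow_succ]
      push_cast
      field_simp
    · rw [K2_eq hx hq0 hq1 hΓ h₀ hm hΓv]
      refine Finset.sum_eq_zero fun j _ => ?_
      rw [Finset.sum_eq_zero fun r _ => by rw [hq_of_neg _ _ _ (by have := ht r; omega)]; simp]
      simp
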